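/- **Setting.** Let $\mathcal S,\mathcal A$ be finite sets with $\mathcal A\neq\emptyset$, let $h$ be a horizon, $d=|\mathcal S||\mathcal A|$, $p_0$ an initial distribution on $\mathcal S$, $\overline p(\cdot\mid s,a)$ transition probabilities, and $\overline r\in\mathbb R^d$ state-action utilities with $\|\overline r\|_2\le S_r$. A trajectory $\tau=(s_1,a_1,\dots,s_h,a_h,s_{h+1})$ has visit-count vector $x(\tau)\in\mathbb R^d$ and utility $\overline r^Tx(\tau)$. For a deterministic policy $\pi:\mathcal S\times\{1,\dots,h\}\to\mathcal A$, let $V(p,r,\pi)$ be the expected total reward of an episode under dynamics $p$, rewards $r$, policy $\pi$ and initial distribution $p_0$; $\pi$ is called *optimal* if it maximizes $V(\overline p,\overline r,\cdot)$. Given two trajectories $\tau_1,\tau_2$, the second is preferred with probability $\tfrac12+\overline r^T(x(\tau_2)-x(\tau_1))$ (linear link; this number is assumed to lie in $[0,1]$ for any two trajectories that can occur). **Algorithm (Dueling Posterior Sampling with Bayesian linear regression).** Fix $\lambda\ge1$, $\delta\in(0,1)$, $R\ge0$ and Dirichlet parameters $\alpha_{s,a,s'}>0$. In iteration $i=1,2,\dots$,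 given the history of the iterations $k<i$, consisting of $\pi_{k1},\pi_{k2},\tau_{k1},\tau_{k2}$ and $y_k\in\{-\tfrac12,\tfrac12\}$ (with $y_k=\tfrac12$ iff $\tau_{k2}$ was preferred), put $x_k=x(\tau_{k2})-x(\tau_{k1})$, $$M_i=\lambda I+\sum_{k<i}x_kx_k^T,\quad \hat r_i=M_i^{-1}\sum_{k<i}y_kx_k,\quad \beta_i(\delta)=R\sqrt{2\log\frac{\det(M_i)^{1/2}\lambda^{-d/2}}{\delta}}+\sqrt\lambda\,S_r .$$ For $j=1,2$, independently, sample rewards $\tilde r_{ij}\sim\mathcal N(\hat r_i,\beta_i(\delta)^2M_i^{-1})$ and, independently of them and for each $(s,a)$ independently, dynamics $\tilde p_{ij}(\cdot\mid s,a)\sim\mathrm{Dirichlet}\big((\alpha_{s,a,s'}+n^{(i)}_{s,a,s'})_{s'}\big)$, where $n^{(i)}_{s,a,s'}$ is the number of transitions $(s,a)\to s'$ in the history. Let $\pi_{ij}$ be a deterministic policy maximizing $V(\tilde p_{ij},\tilde r_{ij},\cdot)$, ties being broken by an arbitrary fixed (measurable, possibly random) rule. Roll out $\pi_{i1},\pi_{i2}$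 in the true environment to obtain $\tau_{i1},\tau_{i2}$, and observe the preference $y_i$. Assume that the label noise $\eta_i=y_i-\overline r^Tx_i$ is conditionally $R$-sub-Gaussian: for all $i$ and all $t\in\mathbb R$, $\mathbb E[e^{t\eta_i}\mid x_1,\dots,x_{i-1},\eta_1,\dots,\eta_{i-1}]\le e^{t^2R^2/2}$ almost surely. **Theorem 1.** With probability at least $1-\delta$, both sampled policies $\pi_{i1},\pi_{i2}$ converge in distribution to the optimal policy. That is, there is an event $G$ with $P(G)\ge1-\delta$ such that 1. at every outcome in $G$, the conditional probability, given the history of the first $i-1$ iterations, that a policy $\pi_{ij}$ sampled in iteration $i$ is optimal tends to $1$ as $i\to\infty$ (this conditional probability is the same for $j=1,2$); and 2. $P(\pi_{ij}\text{ is optimal}\mid G)\to1$ as $i\to\infty$, for $j=1$ and $j=2$. If the optimal policy $\pi^*$ is unique, "$\pi_{ij}$ is optimal" means $\pi_{ij}=\pi^*$. -/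

import Mathlib

open MeasureTheory ProbabilityTheory Filter Topology

namespace DPS

/-! ### Finite-horizon Markov decision processes -/

/-- A trajectory `s₁, a₁, …, s_h, a_h, s_{h+1}`; time steps are indexed from `0`. -/
structure Traj (S A : Type*) (h : ℕ) where
  st : Fin (h + 1) → S
  act : Fin h → A

/-- Deterministic, time-dependent policies. -/
abbrev Policy (S A : Type*) (h : ℕ) := S → Fin h → A

/-- Transition parameters: `p s a s'` is the probability of moving from `s` to `s'` under `a`. -/
abbrev Dyn (S A : Type*) := S → A → S → ℝ

/-- Reward (utility) vectors in `ℝ^d`, `d = |S| |A|`, with the Euclidean norm. -/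
abbrev Rew (S A : Type*) := EuclideanSpace ℝ (S × A)

noncomputable instance {S A : Type*} {h : ℕ} [Fintype S] [DecidableEq S] [Fintype A] :
    Fintype (Traj S A h) :=
  Fintype.ofEquiv ((Fin (h + 1) → S) × (Fin h → A))
    ⟨fun q => ⟨q.1, q.2⟩, fun τ => (τ.st, τ.act), fun _ => rfl, fun _ => rfl⟩

section MDP

variable {S A : Type*} {h : ℕ} [Fintype S] [DecidableEq S] [Fintype A] [DecidableEq A]

/-- Total utility of a trajectory under the reward vector `r`. -/
noncomputable def utility (r : Rew S A) (τ : Traj S A h) : ℝ :=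
  ∑ t : Fin h, r (τ.st t.castSucc, τ.act t)

/-- The feature vector of a trajectory: number of visits to each state-action pair. -/
noncomputable def visits (τ : Traj S A h) : S × A → ℝ :=
  fun q => ∑ t : Fin h, if (τ.st t.castSucc, τ.act t) = q then 1 else 0

/-- Number of observed transitions `(s, a) → s'` along a trajectory. -/
noncomputable def transitions (τ : Traj S A h) (s : S) (a : A) (s' : S) : ℝ :=
  ∑ t : Fin h, if τ.st t.castSucc = s ∧ τ.act t = a ∧ τ.st t.succ = s' then 1 else 0

/-- Probability of the trajectory `τ` when the policy `π` is rolled out. -/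
noncomputable def trajProb (p₀ : S → ℝ) (p : Dyn S A) (π : Policy S A h) (τ : Traj S A h) : ℝ :=
  p₀ (τ.st 0) * ∏ t : Fin h,
    if τ.act t = π (τ.st t.castSucc) t then p (τ.st t.castSucc) (τ.act t) (τ.st t.succ) else 0

/-- The value `V(p, r, π)`: expected total utility of an episode. -/
noncomputable def value (p₀ : S → ℝ) (p : Dyn S A) (r : Rew S A) (π : Policy S A h) : ℝ :=
  ∑ τ : Traj S A h, trajProb p₀ p π τ * utility r τ

/-- `π` is an optimal policy for the dynamics `p` and the rewards `r`. -/
def IsOptimal (p₀ : S → ℝ) (p : Dyn S A) (r : Rew S A) (π : Policy S A h) : Prop :=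
  ∀ π' : Policy S A h, value p₀ p r π' ≤ value p₀ p r π

end MDP

/-- The true environment: initial distribution, transition dynamics and utilities, such that the
linear link gives a probability for every pair of trajectories that can occur. -/
structure Env (S A : Type*) (h : ℕ) [Fintype S] [DecidableEq S] [Fintype A] [DecidableEq A] where
  p₀ : S → ℝ
  p : Dyn S A
  r : Rew S A
  p₀_mem : p₀ ∈ stdSimplex ℝ S
  p_mem : ∀ s a, p s a ∈ stdSimplex ℝ S
  link_range : ∀ (π₁ π₂ : Policy S A h) (τ₁ τ₂ : Traj S A h),
    0 < trajProb p₀ p π₁ τ₁ → 0 < trajProb p₀ p π₂ τ₂ → |utility r τ₂ - utility r τ₁| ≤ 1 / 2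

/-- The user-chosen parameters of the algorithm: regularization `lam`, sub-Gaussian constant `R`,
bound `Sr` on the norm of the utilities, failure probability `δ`, Dirichlet prior `α`. -/
structure Params (S A : Type*) where
  lam : ℝ
  R : ℝ
  Sr : ℝ
  δ : ℝ
  α : S → A → S → ℝ

/-- The Dirichlet distribution with parameters `a`: independent `Gamma(a k, 1)` variables divided
by their sum. -/
noncomputable def dirichlet {ι : Type*} [Fintype ι] (a : ι → ℝ) : Measure (ι → ℝ) :=
  (Measure.pi fun k => gammaMeasure (a k) 1).map fun g k => g k / ∑ l, g l

/-- A rule that breaks ties randomly in `argmax_π V(p, r, π)`: `prob p r` is a probability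
distribution on the maximizers. -/
structure TieBreak (S A : Type*) (h : ℕ) [Fintype S] [DecidableEq S] [Fintype A] [DecidableEq A]
    (p₀ : S → ℝ) where
  prob : Dyn S A → Rew S A → Policy S A h → ℝ
  measurable_prob : ∀ π, Measurable fun q : Dyn S A × Rew S A => prob q.1 q.2 π
  nonneg : ∀ p r π, 0 ≤ prob p r π
  sum_eq_one : ∀ p r, ∑ π, prob p r π = 1
  optimal : ∀ p r π, prob p r π ≠ 0 → IsOptimal p₀ p r π

/-! ### The algorithm -/

/-- What happens in one iteration: the two sampled policies, the two trajectories, and whether the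
second trajectory is preferred to the first. -/
structure Round (S A : Type*) (h : ℕ) where
  pol : Fin 2 → Policy S A h
  traj : Fin 2 → Traj S A h
  pref : Bool

section Algorithm

variable {S A : Type*} {h : ℕ} [Fintype S] [DecidableEq S] [Fintype A] [DecidableEq A]

/-- The difference `x = x₂ - x₁` of the feature vectors of the two trajectories. -/
noncomputable def Round.x (c : Round S A h) : S × A → ℝ := visits (c.traj 1) - visits (c.traj 0)

/-- The label `y ∈ {-1/2, 1/2}`. -/
noncomputable def Round.y (c : Round S A h) : ℝ := if c.pref then 1 / 2 else -(1 / 2)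

/-- The label noise `η = y - rᵀ x`. -/
noncomputable def Round.noise (r : Rew S A) (c : Round S A h) : ℝ := c.y - r.ofLp ⬝ᵥ c.x

/- Iterations are numbered from `0`, so that iteration `n` is preceded by `n` iterations. Below,
`c : ℕ → Round S A h` is a sequence of rounds, and everything that is indexed by `n` depends only
on the history `c 0, …, c (n - 1)` available at the start of iteration `n`. -/

/-- The matrix `M = λ I + ∑ x xᵀ`. -/
noncomputable def gram (P : Params S A) (n : ℕ) (c : ℕ → Round S A h) :
    Matrix (S × A) (S × A) ℝ :=
  P.lam • (1 : Matrix (S × A) (S × A) ℝ) +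
    ∑ k ∈ Finset.range n, Matrix.vecMulVec (c k).x (c k).x

/-- The ridge regression (MAP) estimate `M⁻¹ ∑ y x`. -/
noncomputable def rewMean (P : Params S A) (n : ℕ) (c : ℕ → Round S A h) : Rew S A :=
  WithLp.toLp 2 ((gram P n c)⁻¹.mulVec (∑ k ∈ Finset.range n, (c k).y • (c k).x))

/-- The factor `β(δ) = R √(2 log (det(M)^{1/2} λ^{-d/2} / δ)) + √λ S_r`. -/
noncomputable def beta (P : Params S A) (n : ℕ) (c : ℕ → Round S A h) : ℝ :=
  P.R * Real.sqrt (2 * Real.log ((gram P n c).det ^ (1 / 2 : ℝ) *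
    P.lam ^ (-(Fintype.card (S × A) : ℝ) / 2) / P.δ)) + Real.sqrt P.lam * P.Sr

/-- The sampling distribution `N(r̂, β(δ)² M⁻¹)` of the rewards. -/
noncomputable def rewPosterior (P : Params S A) (n : ℕ) (c : ℕ → Round S A h) :
    Measure (Rew S A) :=
  multivariateGaussian (rewMean P n c) (beta P n c ^ 2 • (gram P n c)⁻¹)

/-- The posterior of the dynamics: independent Dirichlet distributions for the state-action pairs,
whose parameters are the prior ones plus the numbers of observed transitions. -/
noncomputable def dynPosterior (P : Params S A) (n : ℕ) (c : ℕ → Round S A h) :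
    Measure (Dyn S A) :=
  Measure.pi fun s => Measure.pi fun a => dirichlet fun s' =>
    P.α s a s' + ∑ k ∈ Finset.range n, ∑ j : Fin 2, transitions ((c k).traj j) s a s'

/-- Probability that the policy `π` is selected in iteration `n`, given the history: dynamics and
rewards are sampled independently from their posteriors, and an optimal policy for the sampled
dynamics and rewards is returned. -/
noncomputable def selectProb {p₀ : S → ℝ} (P : Params S A) (tb : TieBreak S A h p₀) (n : ℕ)
    (c : ℕ → Round S A h) (π : Policy S A h) : ℝ :=
  ∫ q, tb.prob q.1 q.2 π ∂((dynPosterior P n c).prod (rewPosterior P n c))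

/-- Probability of the outcome `b` of the preference query, under the linear link function:
the second trajectory is preferred with probability `1/2 + (r(τ₂) - r(τ₁))`. -/
noncomputable def prefProb (r : Rew S A) (τ₁ τ₂ : Traj S A h) (b : Bool) : ℝ :=
  if b then 1 / 2 + (utility r τ₂ - utility r τ₁) else 1 / 2 - (utility r τ₂ - utility r τ₁)

/-- Probability that iteration `n` has the outcome `d`, given the history: two policies are
selected independently, each is rolled out in the true environment, and the two trajectories are
compared. -/
noncomputable def roundProb (E : Env S A h) (P : Params S A) (tb : TieBreak S A h E.p₀) (n : ℕ)
    (c : ℕ → Round S A h) (d : Round S A h) : ℝ :=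
  (∏ j : Fin 2, selectProb P tb n c (d.pol j) * trajProb E.p₀ E.p (d.pol j) (d.traj j)) *
    prefProb E.r (d.traj 0) (d.traj 1) d.pref

/-- `X 0, X 1, …` are the iterations of a run of Dueling Posterior Sampling: the law of the process
is given by the conditional probabilities `roundProb`. -/
structure IsDPS {Ω : Type*} [MeasurableSpace Ω] (μ : Measure Ω) (E : Env S A h) (P : Params S A)
    (tb : TieBreak S A h E.p₀) (X : ℕ → Ω → Round S A h) : Prop where
  measurableSet_eq : ∀ n d, MeasurableSet {ω | X n ω = d}
  law : ∀ (n : ℕ) (c : ℕ → Round S A h),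
    μ.real {ω | ∀ k < n + 1, X k ω = c k} =
      μ.real {ω | ∀ k < n, X k ω = c k} * roundProb E P tb n c (c n)

/-- The σ-algebra generated by the features and the label noise of the iterations before `n`. -/
noncomputable abbrev pastSigma {Ω : Type*} (r : Rew S A) (X : ℕ → Ω → Round S A h) (n : ℕ) : MeasurableSpace Ω :=
  ⨆ k : Fin n, MeasurableSpace.comap (fun ω => ((X k ω).x, (X k ω).noise r)) inferInstance

open Classical in
/-- Probability, given the history, that a policy sampled in iteration `n` is optimal in the true
environment. -/
noncomputable def optimalProb (E : Env S A h) (P : Params S A) (tb : TieBreak S A h E.p₀) (n : ℕ)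
    (c : ℕ → Round S A h) : ℝ :=
  ∑ π : Policy S A h with IsOptimal E.p₀ E.p E.r π, selectProb P tb n c π

end Algorithm

end DPS

/-!
Convergence in fact holds almost surely, so that `G` can be taken to be a set of full measure; the
confidence level `δ` only enters through the scale `β` of the reward posterior.

Three facts hold on almost every path. The error of the ridge regression estimate is of the order
of `β` in the metric of the Gram matrix `M` (`IsDPS.ae_reward_error`). The transition frequencies
of pairs with `N` visits deviate from the transition probabilities by at most `N / i + C i ^ 2`
for all `i` at once (`IsDPS.ae_transDev_le`). For every sequence of events, the sum of the
conditional probabilities is controlled by the number of events that occur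
(`IsDPS.ae_sum_condMean_le`). All three come from nonnegative supermartingales
(`IsDPS.ae_exists_bound`). The rest is a deterministic argument on such a path.

A history is called uninformed if some reachable state-action pair has at most `B β³` visits, or if
some direction `v` has value differences of size `1` although `vᵀ M v ≤ (β / e) ^ 2`. If it is not
uninformed, then with high probability the sampled dynamics are within `O(1 / β)` of the true ones
at all pairs that matter, and the sampled utilities have the true value differences up to a small
error; as there are finitely many policies, there is a gap between optimal and other policies, and
the selected policy is optimal (`RegularPath.exists_le_optimalProb`). If it is uninformed, then
the sampled utilities are close to any given target at distance `O(β √(1 + β))` from the true ones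
in the metric of `M`, with a probability that is at least exponential in `-β`. A bonus on rarely
visited pairs is such a target, and it forces a visit to one of them; otherwise, the targets
`r ± κ v` make the two policies differ in the direction `v`. Hence the next round is informative
with a probability of at least `exp (-k (1 + β))` (`RegularPath.exists_exp_le_condMean`).

Informative rounds increase the determinant of `M` or the number of visits to a rarely visited
pair, so there are only polynomially many in `β` of them (`sum_informativeInd_le`). If a history
is uninformed, then so were, up to constants, all histories since `β` passed half of its present
value; as `β²` is at most of the order of `log det M`, which grows at most logarithmically in the
number of rounds, these are at least `exp (c β²)` many. Their number times `exp (-k (1 + β))` is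
more than polynomial in `β`, which bounds `β` along uninformed histories
(`exists_beta_le_of_uninformed`). If there were infinitely many of them, `β` would be bounded
throughout, and infinitely many conditional probabilities would be bounded below, although their
sum is bounded (`RegularPath.eventually_not_uninformed`).

The argument divides by `R`. Label noise of sub-Gaussian constant `0` would vanish, which it does
not when two identical trajectories are compared (`IsDPS.R_ne_zero`).
-/

set_option linter.unusedSectionVars false

namespace DPS

/-! ### Trajectories, values and the simulation lemma -/

section Trajectories

variable {S A : Type*} {h : ℕ} [Fintype S] [DecidableEq S] [Fintype A] [DecidableEq A]

/-- Splitting off the first step of a trajectory. -/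
def Traj.consEquiv (S A : Type*) (h : ℕ) : Traj S A (h + 1) ≃ (S × A) × Traj S A h where
  toFun τ := ((τ.st 0, τ.act 0), ⟨fun t => τ.st t.succ, fun t => τ.act t.succ⟩)
  invFun q := ⟨Fin.cons q.1.1 q.2.st, Fin.cons q.1.2 q.2.act⟩
  left_inv τ := by
    cases τ
    simp only [Traj.mk.injEq]
    exact ⟨Fin.cons_self_tail _, Fin.cons_self_tail _⟩
  right_inv q := by simp

/-- The total weight of all trajectories for time-dependent transition weights `w`. -/
noncomputable def chainSum (p₀ : S → ℝ) (w : Fin h → S → A → S → ℝ) : ℝ :=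
  ∑ τ : Traj S A h, p₀ (τ.st 0) * ∏ t : Fin h, w t (τ.st t.castSucc) (τ.act t) (τ.st t.succ)

theorem chainSum_zero (p₀ : S → ℝ) (w : Fin 0 → S → A → S → ℝ) :
    chainSum p₀ w = ∑ s, p₀ s := by
  let e : Traj S A 0 ≃ S :=
    ⟨fun τ => τ.st 0, fun s => ⟨fun _ => s, Fin.elim0⟩, fun τ => by
      cases τ
      simp only [Traj.mk.injEq]
      exact ⟨funext fun t => congrArg _ (Fin.ext (by omega)), funext fun t => t.elim0⟩,
      fun s => rfl⟩
  unfold chainSum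
  rw [← e.sum_comp]
  simp [e]

theorem chainSum_succ (p₀ : S → ℝ) (w : Fin (h + 1) → S → A → S → ℝ) :
    chainSum p₀ w =
      chainSum (fun s' => ∑ q : S × A, p₀ q.1 * w 0 q.1 q.2 s') (fun t => w t.succ) := by
  unfold chainSum
  rw [← (Traj.consEquiv S A h).symm.sum_comp, Fintype.sum_prod_type, Finset.sum_comm]
  refine Finset.sum_congr rfl fun τ _ => ?_
  rw [Finset.sum_mul]
  refine Finset.sum_congr rfl fun q _ => ?_
  simp [Traj.consEquiv, Fin.prod_univ_succ, mul_assoc]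

theorem chainSum_le {p₀ : S → ℝ} {w : Fin h → S → A → S → ℝ} (hp₀ : ∀ s, 0 ≤ p₀ s)
    (hw : ∀ t s a s', 0 ≤ w t s a s') (hw1 : ∀ t s, ∑ a, ∑ s', w t s a s' ≤ 1) :
    chainSum p₀ w ≤ ∑ s, p₀ s := by
  induction h generalizing p₀ with
  | zero => exact (chainSum_zero p₀ w).le
  | succ h ih =>
    rw [chainSum_succ]
    refine (ih (fun s => Finset.sum_nonneg fun q _ => mul_nonneg (hp₀ _) (hw _ _ _ _))
      (fun t => hw t.succ) (fun t => hw1 t.succ)).trans ?_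
    rw [Finset.sum_comm, Fintype.sum_prod_type]
    refine Finset.sum_le_sum fun s _ => ?_
    simp_rw [← Finset.mul_sum]
    exact mul_le_of_le_one_right (hp₀ s) (hw1 0 s)

theorem chainSum_eq {p₀ : S → ℝ} {w : Fin h → S → A → S → ℝ}
    (hw1 : ∀ t s, ∑ a, ∑ s', w t s a s' = 1) :
    chainSum p₀ w = ∑ s, p₀ s := by
  induction h generalizing p₀ with
  | zero => exact chainSum_zero p₀ w
  | succ h ih =>
    rw [chainSum_succ, ih fun t => hw1 t.succ, Finset.sum_comm, Fintype.sum_prod_type]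
    refine Finset.sum_congr rfl fun s _ => ?_
    simp_rw [← Finset.mul_sum, hw1, mul_one]

theorem sum_trajProb_eq_chainSum (p₀ : S → ℝ) (p : Dyn S A) (π : Policy S A h) :
    ∑ τ : Traj S A h, trajProb p₀ p π τ =
      chainSum p₀ (fun t s a s' => if a = π s t then p s a s' else 0) := rfl

theorem sum_trajProb_le_one {p₀ : S → ℝ} {p : Dyn S A} (hp₀ : p₀ ∈ stdSimplex ℝ S)
    (hp : ∀ s a s', 0 ≤ p s a s') (hp1 : ∀ s a, ∑ s', p s a s' ≤ 1) (π : Policy S A h) :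
    ∑ τ : Traj S A h, trajProb p₀ p π τ ≤ 1 := by
  rw [sum_trajProb_eq_chainSum, ← hp₀.2]
  refine chainSum_le hp₀.1 (fun t s a s' => ?_) fun t s => ?_
  · split_ifs
    exacts [hp _ _ _, le_rfl]
  · rw [Finset.sum_eq_single (π s t)] <;> simp +contextual [hp1]

theorem sum_trajProb {p₀ : S → ℝ} {p : Dyn S A} (hp₀ : p₀ ∈ stdSimplex ℝ S)
    (hp : ∀ s a, p s a ∈ stdSimplex ℝ S) (π : Policy S A h) :
    ∑ τ : Traj S A h, trajProb p₀ p π τ = 1 := by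
  rw [sum_trajProb_eq_chainSum, ← hp₀.2]
  refine chainSum_eq fun t s => ?_
  rw [Finset.sum_eq_single (π s t)] <;> simp +contextual [(hp _ _).2]

theorem trajProb_nonneg {p₀ : S → ℝ} {p : Dyn S A} (hp₀ : ∀ s, 0 ≤ p₀ s)
    (hp : ∀ s a s', 0 ≤ p s a s') (π : Policy S A h) (τ : Traj S A h) :
    0 ≤ trajProb p₀ p π τ := by
  refine mul_nonneg (hp₀ _) (Finset.prod_nonneg fun t _ => ?_)
  split_ifs
  exacts [hp _ _ _, le_rfl]

/-- Two products of numbers from `[0, 1]` differ by at most the sum of the differences. -/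
theorem abs_prod_sub_prod_le {ι : Type*} (s : Finset ι) (f g : ι → ℝ)
    (hf : ∀ i, |f i| ≤ 1) (hg : ∀ i, |g i| ≤ 1) :
    |∏ i ∈ s, f i - ∏ i ∈ s, g i| ≤ ∑ i ∈ s, |f i - g i| := by
  classical
  induction s using Finset.induction_on with
  | empty => simp
  | insert a s ha ih =>
    rw [Finset.prod_insert ha, Finset.prod_insert ha, Finset.sum_insert ha]
    have h1 : |∏ i ∈ s, f i| ≤ 1 := by
      rw [Finset.abs_prod]
      exact Finset.prod_le_one (fun _ _ => abs_nonneg _) fun i _ => hf i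
    calc |f a * ∏ i ∈ s, f i - g a * ∏ i ∈ s, g i|
        = |(f a - g a) * ∏ i ∈ s, f i + g a * (∏ i ∈ s, f i - ∏ i ∈ s, g i)| := by ring_nf
      _ ≤ |f a - g a| * |∏ i ∈ s, f i| + |g a| * |∏ i ∈ s, f i - ∏ i ∈ s, g i| := by
          rw [← abs_mul, ← abs_mul]
          exact abs_add_le _ _
      _ ≤ |f a - g a| * 1 + 1 * ∑ i ∈ s, |f i - g i| := by
          gcongr
          exact hg a
      _ = _ := by ring

/-- If two dynamics differ by at most `err` on the state-action pairs of `τ`, then the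
probabilities of `τ` differ by at most `h * err`. -/
theorem abs_trajProb_sub_le {p₀ : S → ℝ} {p p' : Dyn S A} (hp₀ : p₀ ∈ stdSimplex ℝ S)
    (hp : ∀ s a, p s a ∈ stdSimplex ℝ S) (hp' : ∀ s a, p' s a ∈ stdSimplex ℝ S)
    (π : Policy S A h) (τ : Traj S A h) {err : ℝ} (herr : 0 ≤ err)
    (h' : ∀ t : Fin h, ∀ s', |p' (τ.st t.castSucc) (τ.act t) s' -
      p (τ.st t.castSucc) (τ.act t) s'| ≤ err) :
    |trajProb p₀ p' π τ - trajProb p₀ p π τ| ≤ h * err := by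
  have key : ∀ (q : Dyn S A), (∀ s a, q s a ∈ stdSimplex ℝ S) → ∀ t : Fin h,
      |if τ.act t = π (τ.st t.castSucc) t then
        q (τ.st t.castSucc) (τ.act t) (τ.st t.succ) else 0| ≤ 1 := by
    intro q hq t
    split_ifs
    · rw [abs_of_nonneg ((hq _ _).1 _)]
      exact (mem_Icc_of_mem_stdSimplex (hq _ _) _).2
    · simp
  unfold trajProb
  rw [← mul_sub, abs_mul]
  have h0 := mem_Icc_of_mem_stdSimplex hp₀ (τ.st 0)
  refine (mul_le_of_le_one_left (abs_nonneg _) (by rw [abs_of_nonneg h0.1]; exact h0.2)).trans ?_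
  refine (abs_prod_sub_prod_le _ _ _ (key p' hp') (key p hp)).trans ?_
  refine (Finset.sum_le_card_nsmul _ _ err fun t _ => ?_).trans (by simp)
  split_ifs
  · exact h' t _
  · simpa using herr

theorem utility_eq_dotProduct (r : Rew S A) (τ : Traj S A h) :
    utility r τ = r.ofLp ⬝ᵥ visits τ := by
  simp only [utility, visits, dotProduct, Finset.mul_sum]
  rw [Finset.sum_comm]
  refine Finset.sum_congr rfl fun t _ => ?_
  simp

theorem abs_coord_le_norm (r : Rew S A) (q : S × A) : |r q| ≤ ‖r‖ := by
  simpa using PiLp.norm_apply_le r q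

theorem abs_utility_le (r : Rew S A) (τ : Traj S A h) : |utility r τ| ≤ h * ‖r‖ := by
  refine (Finset.abs_sum_le_sum_abs _ _).trans ?_
  refine (Finset.sum_le_card_nsmul _ _ ‖r‖ fun t _ => abs_coord_le_norm r _).trans (by simp)

theorem utility_add (r r' : Rew S A) (τ : Traj S A h) :
    utility (r + r') τ = utility r τ + utility r' τ := by
  simp [utility, Finset.sum_add_distrib]

theorem utility_smul (k : ℝ) (r : Rew S A) (τ : Traj S A h) :
    utility (k • r) τ = k * utility r τ := by
  simp [utility, Finset.mul_sum]

theorem value_add (p₀ : S → ℝ) (p : Dyn S A) (r r' : Rew S A) (π : Policy S A h) :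
    value p₀ p (r + r') π = value p₀ p r π + value p₀ p r' π := by
  simp [value, utility_add, mul_add, Finset.sum_add_distrib]

theorem value_smul (p₀ : S → ℝ) (p : Dyn S A) (k : ℝ) (r : Rew S A) (π : Policy S A h) :
    value p₀ p (k • r) π = k * value p₀ p r π := by
  simp only [value, utility_smul, Finset.mul_sum]
  exact Finset.sum_congr rfl fun τ _ => by ring

theorem visits_nonneg (τ : Traj S A h) (q : S × A) : 0 ≤ visits τ q :=
  Finset.sum_nonneg fun t _ => by split_ifs <;> simp

theorem sum_visits (τ : Traj S A h) : ∑ q, visits τ q = h := by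
  simp only [visits]
  rw [Finset.sum_comm]
  simp

theorem sum_transitions (τ : Traj S A h) (s : S) (a : A) :
    ∑ s', transitions τ s a s' = visits τ (s, a) := by
  simp only [transitions, visits]
  rw [Finset.sum_comm]
  refine Finset.sum_congr rfl fun t _ => ?_
  by_cases h1 : τ.st t.castSucc = s ∧ τ.act t = a
  · simp [h1.1, h1.2]
  · rw [if_neg (by simpa using h1), Finset.sum_eq_zero]
    intro s' _
    rw [if_neg (by tauto)]

theorem transitions_nonneg (τ : Traj S A h) (s : S) (a : A) (s' : S) :
    0 ≤ transitions τ s a s' :=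
  Finset.sum_nonneg fun t _ => by split_ifs <;> simp

theorem one_le_visits {τ : Traj S A h} (t : Fin h) :
    1 ≤ visits τ (τ.st t.castSucc, τ.act t) := by
  unfold visits
  refine le_trans (by simp) (Finset.single_le_sum
    (f := fun u => if (τ.st u.castSucc, τ.act u) = (τ.st t.castSucc, τ.act t) then (1 : ℝ) else 0)
    (fun u _ => ?_) (Finset.mem_univ t))
  split_ifs <;> simp

/-- The value is bounded by the horizon times the norm of the rewards. -/
theorem abs_value_le {p₀ : S → ℝ} {p : Dyn S A} (hp₀ : p₀ ∈ stdSimplex ℝ S)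
    (hp : ∀ s a, p s a ∈ stdSimplex ℝ S) (r : Rew S A) (π : Policy S A h) :
    |value p₀ p r π| ≤ h * ‖r‖ := by
  have hn := trajProb_nonneg hp₀.1 (fun s a => (hp s a).1) π
  calc |value p₀ p r π| ≤ ∑ τ, trajProb p₀ p π τ * (h * ‖r‖) := by
        refine (Finset.abs_sum_le_sum_abs _ _).trans (Finset.sum_le_sum fun τ _ => ?_)
        rw [abs_mul, abs_of_nonneg (hn τ)]
        exact mul_le_mul_of_nonneg_left (abs_utility_le r τ) (hn τ)
    _ = h * ‖r‖ := by rw [← Finset.sum_mul, sum_trajProb hp₀ hp, one_mul]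

/-- Simulation lemma: if `p'` is within `err` of `p` at every state-action pair that `π` can reach
under `p`, then the values of `π` under `p` and `p'` are close. -/
theorem abs_value_sub_le {p₀ : S → ℝ} {p p' : Dyn S A} (hp₀ : p₀ ∈ stdSimplex ℝ S)
    (hp : ∀ s a, p s a ∈ stdSimplex ℝ S) (hp' : ∀ s a, p' s a ∈ stdSimplex ℝ S)
    (r : Rew S A) (π : Policy S A h) {err : ℝ} (herr : 0 ≤ err)
    (h' : ∀ τ : Traj S A h, 0 < trajProb p₀ p π τ → ∀ t : Fin h, ∀ s',
      |p' (τ.st t.castSucc) (τ.act t) s' - p (τ.st t.castSucc) (τ.act t) s'| ≤ err) :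
    |value p₀ p' r π - value p₀ p r π| ≤
      2 * (Fintype.card (Traj S A h) * (h * err)) * (h * ‖r‖) := by
  have hn := trajProb_nonneg hp₀.1 (fun s a => (hp s a).1) π
  have hn' := trajProb_nonneg hp₀.1 (fun s a => (hp' s a).1) π
  -- a trajectory has either positive probability under `p`, or its probability under `p'` is an
  -- excess that the trajectories of the first kind have to lose
  have h1 : ∀ τ, |trajProb p₀ p' π τ - trajProb p₀ p π τ| ≤
      (trajProb p₀ p' π τ - trajProb p₀ p π τ) + 2 * (h * err) := by
    intro τ
    have h3 : 0 ≤ h * err := by positivity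
    rcases (hn τ).eq_or_lt with h0 | h0
    · rw [← h0, sub_zero, abs_of_nonneg (hn' τ)]
      linarith
    · have := abs_trajProb_sub_le hp₀ hp hp' π τ herr (h' τ h0)
      rcases abs_cases (trajProb p₀ p' π τ - trajProb p₀ p π τ) with h2 | h2 <;> linarith
  have h2 : ∑ τ, |trajProb p₀ p' π τ - trajProb p₀ p π τ| ≤
      2 * (Fintype.card (Traj S A h) * (h * err)) := by
    refine (Finset.sum_le_sum fun τ _ => h1 τ).trans ?_
    rw [Finset.sum_add_distrib, Finset.sum_sub_distrib, sum_trajProb hp₀ hp, sum_trajProb hp₀ hp']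
    simp only [Finset.sum_const, Finset.card_univ, nsmul_eq_mul]
    linarith
  unfold value
  rw [← Finset.sum_sub_distrib]
  simp_rw [← sub_mul]
  refine (Finset.abs_sum_le_sum_abs _ _).trans ?_
  calc ∑ τ, |(trajProb p₀ p' π τ - trajProb p₀ p π τ) * utility r τ|
      ≤ ∑ τ, |trajProb p₀ p' π τ - trajProb p₀ p π τ| * (h * ‖r‖) := by
        refine Finset.sum_le_sum fun τ _ => ?_
        rw [abs_mul]
        exact mul_le_mul_of_nonneg_left (abs_utility_le r τ) (abs_nonneg _)
    _ ≤ _ := by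
        rw [← Finset.sum_mul]
        exact mul_le_mul_of_nonneg_right h2 (by positivity)

end Trajectories

/-! ### Quadratic forms and the Gram matrix -/

section QuadraticForms

open Matrix
open scoped MatrixOrder

variable {ι : Type*} [Fintype ι] [DecidableEq ι]

/-- The quadratic form `vᵀ M v`. -/
noncomputable def quad (M : Matrix ι ι ℝ) (v : ι → ℝ) : ℝ := v ⬝ᵥ M *ᵥ v

theorem quad_nonneg {M : Matrix ι ι ℝ} (hM : M.PosDef) (v : ι → ℝ) : 0 ≤ quad M v := by
  simpa [quad] using hM.posSemidef.dotProduct_mulVec_nonneg v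

theorem dotProduct_mulVec_symm {M : Matrix ι ι ℝ} (hM : M.IsHermitian) (v w : ι → ℝ) :
    v ⬝ᵥ M *ᵥ w = w ⬝ᵥ M *ᵥ v := by
  have h1 : Mᵀ = M := by simpa using hM.eq
  rw [dotProduct_mulVec, ← mulVec_transpose, h1, dotProduct_comm]

theorem quad_add {M : Matrix ι ι ℝ} (hM : M.IsHermitian) (v w : ι → ℝ) :
    quad M (v + w) = quad M v + 2 * (v ⬝ᵥ M *ᵥ w) + quad M w := by
  simp only [quad, mulVec_add, dotProduct_add, add_dotProduct, dotProduct_mulVec_symm hM w v]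
  ring

theorem quad_smul (M : Matrix ι ι ℝ) (k : ℝ) (v : ι → ℝ) :
    quad M (k • v) = k ^ 2 * quad M v := by
  simp only [quad, mulVec_smul, dotProduct_smul, smul_dotProduct, smul_eq_mul]
  ring

theorem quad_add_le {M : Matrix ι ι ℝ} (hM : M.PosDef) (v w : ι → ℝ) :
    quad M (v + w) ≤ 2 * quad M v + 2 * quad M w := by
  have h1 := quad_nonneg hM (v - w)
  rw [sub_eq_add_neg, ← neg_one_smul ℝ w, quad_add hM.isHermitian, quad_smul, mulVec_smul,
    dotProduct_smul] at h1
  rw [quad_add hM.isHermitian]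
  simp only [smul_eq_mul] at h1
  linarith

theorem mulVec_inv_mulVec {M : Matrix ι ι ℝ} (hM : M.PosDef) (v : ι → ℝ) :
    M *ᵥ (M⁻¹ *ᵥ v) = v := by
  rw [mulVec_mulVec, mul_nonsing_inv _ ((isUnit_iff_isUnit_det M).1 hM.isUnit), one_mulVec]

theorem quad_inv_mulVec {M : Matrix ι ι ℝ} (hM : M.PosDef) (v : ι → ℝ) :
    quad M (M⁻¹ *ᵥ v) = quad M⁻¹ v := by
  rw [quad, mulVec_inv_mulVec hM, dotProduct_comm, quad]

/-- Cauchy-Schwarz inequality between the norms given by `M` and `M⁻¹`. -/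
theorem sq_dotProduct_le {M : Matrix ι ι ℝ} (hM : M.PosDef) (v x : ι → ℝ) :
    (v ⬝ᵥ x) ^ 2 ≤ quad M v * quad M⁻¹ x := by
  have h1 : ∀ t : ℝ, 0 ≤ quad M v * (t * t) + (2 * (v ⬝ᵥ x)) * t + quad M⁻¹ x := by
    intro t
    have h2 := quad_nonneg hM (t • v + M⁻¹ *ᵥ x)
    rw [quad_add hM.isHermitian, quad_smul, quad_inv_mulVec hM, mulVec_inv_mulVec hM,
      smul_dotProduct, smul_eq_mul] at h2
    linarith
  have h3 := discrim_le_zero h1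
  unfold discrim at h3
  linarith

theorem quad_add_vecMulVec (M : Matrix ι ι ℝ) (x v : ι → ℝ) :
    quad (M + vecMulVec x x) v = quad M v + (x ⬝ᵥ v) ^ 2 := by
  simp only [quad, add_mulVec, vecMulVec_mulVec, dotProduct_add]
  rw [op_smul_eq_smul, dotProduct_smul, dotProduct_comm v x, smul_eq_mul, sq]

theorem posDef_add_vecMulVec {M : Matrix ι ι ℝ} (hM : M.PosDef) (x : ι → ℝ) :
    (M + vecMulVec x x).PosDef :=
  hM.add_posSemidef (by simpa using posSemidef_vecMulVec_self_star x)

theorem det_add_vecMulVec {M : Matrix ι ι ℝ} (hM : M.PosDef) (x : ι → ℝ) :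
    (M + vecMulVec x x).det = M.det * (1 + quad M⁻¹ x) := by
  rw [vecMulVec_eq Unit, det_add_replicateCol_mul_replicateRow
    ((isUnit_iff_isUnit_det M).1 hM.isUnit)]
  congr 1
  rw [det_unique, Matrix.add_apply, one_apply_eq, Matrix.mul_assoc]
  simp [Matrix.mul_apply, quad, dotProduct, mulVec]

/-- Sherman-Morrison formula. -/
theorem inv_add_vecMulVec {M : Matrix ι ι ℝ} (hM : M.PosDef) (x : ι → ℝ) :
    (M + vecMulVec x x)⁻¹ = M⁻¹ - (1 + quad M⁻¹ x)⁻¹ • vecMulVec (M⁻¹ *ᵥ x) (M⁻¹ *ᵥ x) := by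
  apply inv_eq_right_inv
  have h0 : 1 + quad M⁻¹ x ≠ 0 := by
    have := quad_nonneg hM.inv x
    positivity
  have h1 := (isUnit_iff_isUnit_det M).1 hM.isUnit
  apply ext_of_mulVec_single
  intro i
  generalize (Pi.single i 1 : ι → ℝ) = e
  have h2 : x ⬝ᵥ M⁻¹ *ᵥ e = e ⬝ᵥ M⁻¹ *ᵥ x := dotProduct_mulVec_symm hM.inv.isHermitian _ _
  have h3 : (M⁻¹ *ᵥ x) ⬝ᵥ e = e ⬝ᵥ M⁻¹ *ᵥ x := dotProduct_comm _ _
  rw [← mulVec_mulVec, one_mulVec, sub_mulVec, smul_mulVec, vecMulVec_mulVec, op_smul_eq_smul,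
    add_mulVec, mulVec_sub, mulVec_smul, mulVec_smul, mulVec_inv_mulVec hM, mulVec_inv_mulVec hM,
    vecMulVec_mulVec, op_smul_eq_smul, dotProduct_sub, dotProduct_smul, dotProduct_smul, h2, h3]
  change _ + (_ - _ • _ • quad M⁻¹ x) • x = _
  simp only [smul_eq_mul]
  have h4 : (e ⬝ᵥ M⁻¹ *ᵥ x) - (1 + quad M⁻¹ x)⁻¹ * ((e ⬝ᵥ M⁻¹ *ᵥ x) * quad M⁻¹ x) =
      (1 + quad M⁻¹ x)⁻¹ * (e ⬝ᵥ M⁻¹ *ᵥ x) := by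
    field_simp
    ring
  rw [h4, smul_smul]
  abel

/-- How the squared norm `Sᵀ M⁻¹ S` changes in one step of online linear regression. -/
theorem quad_inv_add_vecMulVec {M : Matrix ι ι ℝ} (hM : M.PosDef) (x v : ι → ℝ) (η : ℝ) :
    quad (M + vecMulVec x x)⁻¹ (v + η • x) = quad M⁻¹ v +
      (-(v ⬝ᵥ M⁻¹ *ᵥ x) ^ 2 + 2 * η * (v ⬝ᵥ M⁻¹ *ᵥ x) + η ^ 2 * quad M⁻¹ x) /
        (1 + quad M⁻¹ x) := by
  have h0 : 1 + quad M⁻¹ x ≠ 0 := by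
    have := quad_nonneg hM.inv x
    positivity
  have h1 : ∀ u : ι → ℝ, quad (M + vecMulVec x x)⁻¹ u =
      quad M⁻¹ u - (1 + quad M⁻¹ x)⁻¹ * (u ⬝ᵥ M⁻¹ *ᵥ x) ^ 2 := by
    intro u
    rw [inv_add_vecMulVec hM]
    simp only [quad, sub_mulVec, smul_mulVec, vecMulVec_mulVec, op_smul_eq_smul, dotProduct_sub,
      dotProduct_smul, smul_eq_mul]
    rw [dotProduct_comm (M⁻¹ *ᵥ x) u]
    ring
  rw [h1, quad_add hM.inv.isHermitian, quad_smul, add_dotProduct, smul_dotProduct,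
    mulVec_smul, dotProduct_smul]
  change _ + 2 * η • _ + _ - _ * (_ + η • quad M⁻¹ x) ^ 2 = _
  simp only [smul_eq_mul]
  field_simp
  ring

/-- A bound between quadratic forms implies one between determinants. -/
theorem det_le_pow_mul_det {A B : Matrix ι ι ℝ} (hA : A.PosDef) (hB : B.PosDef) {c : ℝ}
    (h : ∀ v, quad B v ≤ c * quad A v) : B.det ≤ c ^ Fintype.card ι * A.det := by
  obtain ⟨C, hC⟩ := CStarAlgebra.nonneg_iff_eq_star_mul_self.mp
    (Matrix.nonneg_iff_posSemidef.2 hA.inv.posSemidef)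
  rw [star_eq_conjTranspose, conjTranspose_eq_transpose_of_trivial] at hC
  have hdet : C.det * C.det * A.det = 1 := by
    have h1 := congrArg det hC
    rw [det_mul, det_transpose, det_nonsing_inv, Ring.inverse_eq_inv'] at h1
    rw [← h1, inv_mul_cancel₀ hA.det_pos.ne']
  have hCA : C * A * Cᵀ = 1 := by
    have h1 : Cᵀ * (C * A) = 1 := by
      rw [← Matrix.mul_assoc, ← hC, nonsing_inv_mul _ ((isUnit_iff_isUnit_det A).1 hA.isUnit)]
    exact mul_eq_one_comm.1 h1
  have hD : (C * B * Cᵀ).PosSemidef := by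
    have := hB.posSemidef.mul_mul_conjTranspose_same C
    rwa [conjTranspose_eq_transpose_of_trivial] at this
  have hq : ∀ (B : Matrix ι ι ℝ) v, v ⬝ᵥ (C * B * Cᵀ) *ᵥ v = quad B (Cᵀ *ᵥ v) := by
    intro B v
    rw [quad, ← mulVec_mulVec, ← mulVec_mulVec, dotProduct_mulVec v C, ← mulVec_transpose]
  have hle : (C * B * Cᵀ).det ≤ c ^ Fintype.card ι := by
    rw [hD.isHermitian.det_eq_prod_eigenvalues, ← Finset.card_univ, ← Finset.prod_const]
    refine Finset.prod_le_prod (fun i _ => hD.eigenvalues_nonneg i) fun i _ => ?_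
    rw [hD.isHermitian.eigenvalues_eq]
    have h1 := h (Cᵀ *ᵥ (hD.isHermitian.eigenvectorBasis i).ofLp)
    rw [← hq, ← hq, hCA, one_mulVec] at h1
    have h2 : (hD.isHermitian.eigenvectorBasis i).ofLp ⬝ᵥ
        (hD.isHermitian.eigenvectorBasis i).ofLp = 1 := by
      have := EuclideanSpace.real_norm_sq_eq (hD.isHermitian.eigenvectorBasis i)
      rw [hD.isHermitian.eigenvectorBasis.orthonormal.1 i] at this
      simpa [dotProduct, sq] using this.symm
    rw [h2, mul_one] at h1
    simpa using h1
  rw [det_mul, det_mul, det_transpose] at hle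
  calc B.det = (C.det * B.det * C.det) * A.det := by
        linear_combination -(B.det) * hdet
    _ ≤ _ := mul_le_mul_of_nonneg_right hle hA.det_pos.le

end QuadraticForms

section Gram

open Matrix

variable {S A : Type*} {h : ℕ} [Fintype S] [DecidableEq S] [Fintype A] [DecidableEq A]
  {P : Params S A}

theorem gram_zero (P : Params S A) (c : ℕ → Round S A h) : gram P 0 c = P.lam • 1 := by
  simp [gram]

theorem gram_succ (P : Params S A) (n : ℕ) (c : ℕ → Round S A h) :
    gram P (n + 1) c = gram P n c + vecMulVec (c n).x (c n).x := by
  rw [gram, gram, Finset.sum_range_succ, add_assoc]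

theorem gram_posDef (hlam : 0 < P.lam) (n : ℕ) (c : ℕ → Round S A h) : (gram P n c).PosDef := by
  induction n with
  | zero =>
    rw [gram_zero]
    exact PosDef.one.smul hlam
  | succ n ih =>
    rw [gram_succ]
    exact posDef_add_vecMulVec ih _

theorem quad_gram (P : Params S A) (n : ℕ) (c : ℕ → Round S A h) (v : S × A → ℝ) :
    quad (gram P n c) v = P.lam * (v ⬝ᵥ v) + ∑ k ∈ Finset.range n, ((c k).x ⬝ᵥ v) ^ 2 := by
  induction n with
  | zero => simp [gram_zero, quad, smul_mulVec]
  | succ n ih => rw [gram_succ, quad_add_vecMulVec, ih, Finset.sum_range_succ, add_assoc]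

theorem quad_gram_mono (P : Params S A) {m n : ℕ} (hmn : m ≤ n) (c : ℕ → Round S A h)
    (v : S × A → ℝ) : quad (gram P m c) v ≤ quad (gram P n c) v := by
  rw [quad_gram, quad_gram]
  gcongr

theorem det_gram_succ (hlam : 0 < P.lam) (n : ℕ) (c : ℕ → Round S A h) :
    (gram P (n + 1) c).det = (gram P n c).det * (1 + quad (gram P n c)⁻¹ (c n).x) := by
  rw [gram_succ, det_add_vecMulVec (gram_posDef hlam n c)]

theorem sum_abs_x_le (c : Round S A h) : ∑ q, |c.x q| ≤ 2 * h := by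
  calc ∑ q, |c.x q| ≤ ∑ q, (visits (c.traj 1) q + visits (c.traj 0) q) := by
        refine Finset.sum_le_sum fun q _ => (abs_sub _ _).trans_eq ?_
        rw [abs_of_nonneg (visits_nonneg _ _), abs_of_nonneg (visits_nonneg _ _)]
    _ = 2 * h := by
        rw [Finset.sum_add_distrib, sum_visits, sum_visits]
        ring

theorem sq_x_dotProduct_le (c : Round S A h) (v : S × A → ℝ) :
    (c.x ⬝ᵥ v) ^ 2 ≤ (2 * h) ^ 2 * (v ⬝ᵥ v) := by
  have h1 : ∑ q, c.x q ^ 2 ≤ (2 * h : ℝ) ^ 2 := by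
    calc ∑ q, c.x q ^ 2 = ∑ q, |c.x q| ^ 2 := by simp
      _ ≤ (∑ q, |c.x q|) ^ 2 := Finset.sum_sq_le_sq_sum_of_nonneg fun q _ => abs_nonneg _
      _ ≤ _ := by
        gcongr
        exact sum_abs_x_le c
  have h2 := Finset.sum_mul_sq_le_sq_mul_sq Finset.univ c.x v
  calc (c.x ⬝ᵥ v) ^ 2 ≤ (∑ q, c.x q ^ 2) * ∑ q, v q ^ 2 := h2
    _ ≤ (2 * h) ^ 2 * ∑ q, v q ^ 2 := by gcongr
    _ = _ := by simp [dotProduct, sq]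

/-- The determinant of the Gram matrix grows at most polynomially with the number of rounds. -/
theorem det_gram_le (hlam : 1 ≤ P.lam) {m n : ℕ} (hmn : m ≤ n) (c : ℕ → Round S A h) :
    (gram P n c).det ≤
      (1 + (2 * h) ^ 2 * ((n : ℝ) - m)) ^ Fintype.card (S × A) * (gram P m c).det := by
  have hl : 0 < P.lam := by linarith
  refine det_le_pow_mul_det (gram_posDef hl m c) (gram_posDef hl n c) fun v => ?_
  have hv : 0 ≤ v ⬝ᵥ v := by
    simpa using dotProduct_self_star_nonneg v
  have h1 : v ⬝ᵥ v ≤ quad (gram P m c) v := by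
    rw [quad_gram]
    have : 0 ≤ ∑ k ∈ Finset.range m, ((c k).x ⬝ᵥ v) ^ 2 := Finset.sum_nonneg fun k _ => sq_nonneg _
    nlinarith
  have h2 : quad (gram P n c) v - quad (gram P m c) v ≤ (2 * h) ^ 2 * ((n : ℝ) - m) * (v ⬝ᵥ v) := by
    rw [quad_gram, quad_gram, ← Finset.sum_range_add_sum_Ico _ hmn]
    have h3 : ∑ k ∈ Finset.Ico m n, ((c k).x ⬝ᵥ v) ^ 2 ≤
        ∑ k ∈ Finset.Ico m n, (2 * h : ℝ) ^ 2 * (v ⬝ᵥ v) :=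
      Finset.sum_le_sum fun k _ => sq_x_dotProduct_le (c k) v
    rw [Finset.sum_const, Nat.card_Ico, nsmul_eq_mul, Nat.cast_sub hmn] at h3
    linarith
  have h4 : (0 : ℝ) ≤ (n : ℝ) - m := sub_nonneg.2 (by exact_mod_cast hmn)
  have h5 : (2 * h : ℝ) ^ 2 * ((n : ℝ) - m) * (v ⬝ᵥ v) ≤
      (2 * h : ℝ) ^ 2 * ((n : ℝ) - m) * quad (gram P m c) v := by gcongr
  linarith

end Gram

/-! ### Information gain and the scale of the reward posterior -/

section Beta

variable {S A : Type*} {h : ℕ} [Fintype S] [DecidableEq S] [Fintype A] [DecidableEq A]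
  {P : Params S A}

/-- The logarithmic growth `log (det M_n / det M_0)` of the determinant of the Gram matrix. -/
noncomputable def infoGain (P : Params S A) (n : ℕ) (c : ℕ → Round S A h) : ℝ :=
  Real.log (gram P n c).det - Real.log (gram P 0 c).det

/-- The squared norm of the feature vector of round `n` in the metric of the inverse Gram matrix:
a measure of how much this round tells about the utilities. -/
noncomputable def novelty (P : Params S A) (n : ℕ) (c : ℕ → Round S A h) : ℝ :=
  quad (gram P n c)⁻¹ (c n).x

theorem novelty_nonneg (hlam : 0 < P.lam) (n : ℕ) (c : ℕ → Round S A h) : 0 ≤ novelty P n c :=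
  quad_nonneg (gram_posDef hlam n c).inv _

theorem infoGain_zero (P : Params S A) (c : ℕ → Round S A h) : infoGain P 0 c = 0 := sub_self _

theorem infoGain_succ (hlam : 0 < P.lam) (n : ℕ) (c : ℕ → Round S A h) :
    infoGain P (n + 1) c = infoGain P n c + Real.log (1 + novelty P n c) := by
  have h1 := (gram_posDef hlam n c).det_pos
  have h2 := novelty_nonneg hlam n c
  rw [infoGain, infoGain, det_gram_succ hlam, Real.log_mul h1.ne' (by unfold novelty at h2; positivity),
    novelty]
  ring

theorem infoGain_mono (hlam : 0 < P.lam) (c : ℕ → Round S A h) :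
    Monotone fun n => infoGain P n c := by
  refine monotone_nat_of_le_succ fun n => ?_
  rw [infoGain_succ hlam]
  have := Real.log_nonneg (by linarith [novelty_nonneg hlam n c] : 1 ≤ 1 + novelty P n c)
  linarith

theorem infoGain_nonneg (hlam : 0 < P.lam) (n : ℕ) (c : ℕ → Round S A h) : 0 ≤ infoGain P n c := by
  simpa [infoGain_zero] using infoGain_mono hlam c (Nat.zero_le n)

theorem infoGain_sub_le (hlam : 1 ≤ P.lam) {m n : ℕ} (hmn : m ≤ n) (c : ℕ → Round S A h) :
    infoGain P n c - infoGain P m c ≤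
      Fintype.card (S × A) * Real.log (1 + (2 * h) ^ 2 * ((n : ℝ) - m)) := by
  have hl : 0 < P.lam := by linarith
  have h4 : (0 : ℝ) ≤ (n : ℝ) - m := sub_nonneg.2 (by exact_mod_cast hmn)
  have h5 : (0 : ℝ) < 1 + (2 * h) ^ 2 * ((n : ℝ) - m) := by positivity
  have h1 := Real.log_le_log (gram_posDef hl n c).det_pos (det_gram_le hlam hmn c)
  rw [Real.log_mul (by positivity) (gram_posDef hl m c).det_pos.ne', Real.log_pow] at h1
  unfold infoGain
  linarith

theorem beta_eq (hlam : 0 < P.lam) (hδ : 0 < P.δ) (n : ℕ) (c : ℕ → Round S A h) :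
    beta P n c = P.R * Real.sqrt (infoGain P n c + 2 * Real.log P.δ⁻¹) +
      Real.sqrt P.lam * P.Sr := by
  have h1 := (gram_posDef hlam n c).det_pos
  have h2 : (gram P 0 c).det = P.lam ^ Fintype.card (S × A) := by
    rw [gram_zero, Matrix.det_smul, Matrix.det_one, mul_one]
  unfold beta
  rw [Real.log_div (by positivity) hδ.ne', Real.log_mul (by positivity) (by positivity),
    Real.log_rpow h1, Real.log_rpow hlam, infoGain, h2, Real.log_pow, Real.log_inv]
  congr 3
  ring

/-- Hypotheses on the parameters. That `R` is positive follows from its being a sub-Gaussian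
constant of the label noise. -/
structure Params.Good (P : Params S A) : Prop where
  one_le_lam : 1 ≤ P.lam
  R_pos : 0 < P.R
  Sr_nonneg : 0 ≤ P.Sr
  δ_pos : 0 < P.δ
  δ_lt_one : P.δ < 1

theorem Params.Good.lam_pos (hP : P.Good) : 0 < P.lam := by linarith [hP.one_le_lam]

theorem Params.Good.log_pos (hP : P.Good) : 0 < Real.log P.δ⁻¹ :=
  Real.log_pos ((one_lt_inv₀ hP.δ_pos).2 hP.δ_lt_one)

/-- A lower bound for all `beta P n c`, positive for `R > 0` and `δ < 1`. -/
noncomputable def betaMin (P : Params S A) : ℝ := P.R * Real.sqrt (2 * Real.log P.δ⁻¹)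

theorem betaMin_pos (hP : P.Good) : 0 < betaMin P :=
  mul_pos hP.R_pos (Real.sqrt_pos.2 (mul_pos two_pos hP.log_pos))

theorem betaMin_le (hP : P.Good) (n : ℕ) (c : ℕ → Round S A h) : betaMin P ≤ beta P n c := by
  rw [beta_eq hP.lam_pos hP.δ_pos]
  have h1 := infoGain_nonneg hP.lam_pos n c
  have h2 : betaMin P ≤ P.R * Real.sqrt (infoGain P n c + 2 * Real.log P.δ⁻¹) := by
    refine mul_le_mul_of_nonneg_left (Real.sqrt_le_sqrt ?_) hP.R_pos.le
    linarith
  have h3 : 0 ≤ Real.sqrt P.lam * P.Sr := mul_nonneg (Real.sqrt_nonneg _) hP.Sr_nonneg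
  linarith

theorem beta_pos (hP : P.Good) (n : ℕ) (c : ℕ → Round S A h) : 0 < beta P n c :=
  (betaMin_pos hP).trans_le (betaMin_le hP n c)

theorem beta_mono (hP : P.Good) (c : ℕ → Round S A h) : Monotone fun n => beta P n c := by
  intro m n hmn
  simp only [beta_eq hP.lam_pos hP.δ_pos]
  have h1 := infoGain_mono hP.lam_pos c hmn
  have h2 : Real.sqrt (infoGain P m c + 2 * Real.log P.δ⁻¹) ≤
      Real.sqrt (infoGain P n c + 2 * Real.log P.δ⁻¹) := Real.sqrt_le_sqrt (by simpa using h1)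
  have h3 := mul_le_mul_of_nonneg_left h2 hP.R_pos.le
  linarith

theorem R_sq_mul_le_beta_sq (hP : P.Good) (n : ℕ) (c : ℕ → Round S A h) :
    P.R ^ 2 * (infoGain P n c + 2 * Real.log P.δ⁻¹) ≤ beta P n c ^ 2 := by
  have h1 := infoGain_nonneg hP.lam_pos n c
  have h2 := hP.log_pos
  have h3 : 0 ≤ Real.sqrt P.lam * P.Sr := mul_nonneg (Real.sqrt_nonneg _) hP.Sr_nonneg
  have h4 := hP.R_pos
  have h5 : 0 ≤ infoGain P n c + 2 * Real.log P.δ⁻¹ := by linarith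
  rw [beta_eq hP.lam_pos hP.δ_pos]
  calc P.R ^ 2 * (infoGain P n c + 2 * Real.log P.δ⁻¹)
      = (P.R * Real.sqrt (infoGain P n c + 2 * Real.log P.δ⁻¹)) ^ 2 := by
        rw [mul_pow, Real.sq_sqrt h5]
    _ ≤ _ := by
        refine pow_le_pow_left₀ (mul_nonneg h4.le (Real.sqrt_nonneg _)) ?_ 2
        linarith

theorem R_sq_mul_infoGain_le (hP : P.Good) (n : ℕ) (c : ℕ → Round S A h) :
    P.R ^ 2 * infoGain P n c ≤ beta P n c ^ 2 := by
  have h1 := R_sq_mul_le_beta_sq hP n c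
  have h2 := mul_pos (pow_pos hP.R_pos 2) hP.log_pos
  linarith

/-- If `β` doubles between two rounds, then the determinant has grown by a factor that is
exponential in `β²`. -/
theorem infoGain_sub_ge_of_beta_lt (hP : P.Good) {m n : ℕ} {c : ℕ → Round S A h}
    (hmn : beta P m c < beta P n c / 2) :
    (beta P n c - 2 * (Real.sqrt P.lam * P.Sr)) ≤
      2 * P.R * Real.sqrt (infoGain P n c - infoGain P m c) := by
  have h1 := infoGain_nonneg hP.lam_pos m c
  have h2 := hP.log_pos
  rw [beta_eq hP.lam_pos hP.δ_pos, beta_eq hP.lam_pos hP.δ_pos] at hmn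
  rw [beta_eq hP.lam_pos hP.δ_pos]
  set a := infoGain P m c + 2 * Real.log P.δ⁻¹ with ha
  set b := infoGain P n c + 2 * Real.log P.δ⁻¹ with hb
  have h3 : infoGain P n c - infoGain P m c = b - a := by rw [ha, hb]; ring
  rw [h3]
  have h4 : 0 ≤ Real.sqrt P.lam * P.Sr := mul_nonneg (Real.sqrt_nonneg _) hP.Sr_nonneg
  have h5 : Real.sqrt b ≤ Real.sqrt (b - a) + Real.sqrt a := by
    have ha0 : 0 ≤ a := by positivity
    rcases le_or_gt a b with hab | hab
    · refine Real.sqrt_le_iff.2 ⟨by positivity, ?_⟩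
      have h6 := mul_nonneg (Real.sqrt_nonneg (b - a)) (Real.sqrt_nonneg a)
      linarith [Real.sq_sqrt (sub_nonneg.2 hab), Real.sq_sqrt ha0,
        add_sq (Real.sqrt (b - a)) (Real.sqrt a)]
    · have := Real.sqrt_le_sqrt hab.le
      have := Real.sqrt_nonneg (b - a)
      linarith
  have h6 := mul_le_mul_of_nonneg_left h5 hP.R_pos.le
  nlinarith

end Beta

/-! ### Gaussian measures of ellipsoids -/

section Gaussian

open Matrix
open scoped MatrixOrder

variable {ι : Type*} [Fintype ι] [DecidableEq ι]

/-- In the metric of the precision matrix, a ball for `N(m, b² M⁻¹)` is a Euclidean ball for the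
standard Gaussian distribution. -/
theorem multivariateGaussian_ball {M : Matrix ι ι ℝ} (hM : M.PosDef) {b : ℝ} (hb : 0 < b)
    (m y : EuclideanSpace ℝ ι) :
    ∃ ξ₀ : EuclideanSpace ℝ ι, b ^ 2 * ‖ξ₀‖ ^ 2 = quad M (y - m).ofLp ∧ ∀ ρ : ℝ, 0 ≤ ρ →
      (multivariateGaussian m (b ^ 2 • M⁻¹)).real {x | quad M (x - y).ofLp ≤ b ^ 2 * ρ ^ 2} =
        (stdGaussian (EuclideanSpace ℝ ι)).real (Metric.closedBall ξ₀ ρ) := by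
  have hS : (b ^ 2 • M⁻¹).PosDef := hM.inv.smul (by positivity)
  set T := CFC.sqrt (b ^ 2 • M⁻¹) with hT
  have hTT : T * T = b ^ 2 • M⁻¹ :=
    CFC.sqrt_mul_sqrt_self _ (Matrix.nonneg_iff_posSemidef.2 hS.posSemidef)
  have hTh : Tᵀ = T := by
    have := (Matrix.nonneg_iff_posSemidef.1 (CFC.sqrt_nonneg (b ^ 2 • M⁻¹))).isHermitian.eq
    rwa [conjTranspose_eq_transpose_of_trivial] at this
  have hMu := (isUnit_iff_isUnit_det M).1 hM.isUnit
  have hb2 : b ^ 2 ≠ 0 := by positivity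
  have h1 : T * ((b ^ 2)⁻¹ • (T * M)) = 1 := by
    rw [Matrix.mul_smul, ← Matrix.mul_assoc, hTT, Matrix.smul_mul, nonsing_inv_mul _ hMu, smul_smul,
      inv_mul_cancel₀ hb2, one_smul]
  have h2 : T * M * T = b ^ 2 • 1 := by
    have := mul_eq_one_comm.1 h1
    rw [Matrix.smul_mul] at this
    rw [← this, smul_smul, mul_inv_cancel₀ hb2, one_smul]
  have hq : ∀ ζ : EuclideanSpace ℝ ι, quad M (T *ᵥ ζ.ofLp) = b ^ 2 * ‖ζ‖ ^ 2 := by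
    intro ζ
    have h3 : quad M (T *ᵥ ζ.ofLp) = ζ.ofLp ⬝ᵥ (T * M * T) *ᵥ ζ.ofLp := by
      rw [quad, ← mulVec_mulVec, ← mulVec_mulVec, dotProduct_mulVec ζ.ofLp T, ← mulVec_transpose,
        hTh]
    rw [h3, h2, smul_mulVec, one_mulVec, dotProduct_smul, smul_eq_mul,
      EuclideanSpace.real_norm_sq_eq]
    simp [dotProduct, sq]
  refine ⟨WithLp.toLp 2 (((b ^ 2)⁻¹ • (T * M)) *ᵥ (y - m).ofLp), ?_, fun ρ hρ => ?_⟩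
  · rw [← hq, mulVec_mulVec, h1, one_mulVec]
  · have hmeas : Measurable fun x : EuclideanSpace ℝ ι => m + toEuclideanCLM (𝕜 := ℝ) T x := by
      fun_prop
    have hset : MeasurableSet {x : EuclideanSpace ℝ ι | quad M (x - y).ofLp ≤ b ^ 2 * ρ ^ 2} := by
      unfold quad
      refine measurableSet_le (Continuous.measurable ?_) measurable_const
      fun_prop
    rw [multivariateGaussian, map_measureReal_apply hmeas hset]
    congr 1
    ext x
    have h4 : (m + toEuclideanCLM (𝕜 := ℝ) T x - y).ofLp =
        T *ᵥ (x - WithLp.toLp 2 (((b ^ 2)⁻¹ • (T * M)) *ᵥ (y - m).ofLp)).ofLp := by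
      rw [WithLp.ofLp_sub, WithLp.ofLp_sub _ x, mulVec_sub, mulVec_mulVec _ T, h1, one_mulVec,
        WithLp.ofLp_add, ofLp_toEuclideanCLM, WithLp.ofLp_sub]
      abel
    simp only [Set.mem_preimage, Set.mem_ofPred_eq, Metric.mem_closedBall, dist_eq_norm]
    rw [h4, hq, mul_le_mul_iff_right₀ (by positivity), pow_le_pow_iff_left₀ (norm_nonneg _) hρ
      two_ne_zero]

theorem le_gaussianReal_Icc (a : ℝ) {s U : ℝ} (hs : 0 ≤ s) (hs1 : s ≤ 1) (ha : |a| ≤ U) :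
    s / 3 * Real.exp (-(U + 1) ^ 2 / 2) ≤ (gaussianReal 0 1).real (Set.Icc (a - s) (a + s)) := by
  rw [measureReal_def, gaussianReal_apply_eq_integral 0 one_ne_zero,
    ENNReal.toReal_ofReal (setIntegral_nonneg measurableSet_Icc fun x _ =>
      gaussianPDFReal_nonneg _ _ _)]
  have h1 : ∀ x ∈ Set.Icc (a - s) (a + s),
      1 / 6 * Real.exp (-(U + 1) ^ 2 / 2) ≤ gaussianPDFReal 0 1 x := by
    intro x hx
    have h2 : |x| ≤ U + 1 := by
      rw [abs_le] at ha ⊢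
      constructor <;> linarith [hx.1, hx.2]
    have h3 : x ^ 2 ≤ (U + 1) ^ 2 := sq_le_sq' (by linarith [(abs_le.1 h2).1]) (abs_le.1 h2).2
    have h4 : (1 : ℝ) / 6 ≤ (Real.sqrt (2 * Real.pi))⁻¹ := by
      rw [one_div]
      refine inv_anti₀ (Real.sqrt_pos.2 (by positivity)) ?_
      rw [Real.sqrt_le_left (by norm_num)]
      linarith [Real.pi_le_four]
    unfold gaussianPDFReal
    simp only [NNReal.coe_one, mul_one, sub_zero]
    gcongr
  have h5 := setIntegral_ge_of_const_le measurableSet_Icc (by simp) h1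
    (integrable_gaussianPDFReal 0 1).integrableOn
  rw [smul_eq_mul, Real.volume_real_Icc_of_le (by linarith)] at h5
  linarith

/-- A lower bound for the probability that a standard Gaussian vector lies in a small ball. -/
theorem le_stdGaussian_closedBall (ξ₀ : EuclideanSpace ℝ ι) {ρ U : ℝ} (hρ : 0 ≤ ρ) (hρ1 : ρ ≤ 1)
    (hU : ‖ξ₀‖ ≤ U) :
    (ρ / (3 * (Fintype.card ι + 1)) * Real.exp (-(U + 1) ^ 2 / 2)) ^ Fintype.card ι ≤
      (stdGaussian (EuclideanSpace ℝ ι)).real (Metric.closedBall ξ₀ ρ) := by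
  have hd : (0 : ℝ) < Fintype.card ι + 1 := by positivity
  set s : ℝ := ρ / (Fintype.card ι + 1) with hs
  have hs0 : 0 ≤ s := by positivity
  have hs1 : s ≤ 1 := by
    rw [hs, div_le_one hd]
    have : (0 : ℝ) ≤ Fintype.card ι := by positivity
    linarith
  rw [← map_pi_eq_stdGaussian, map_measureReal_apply (by fun_prop) measurableSet_closedBall]
  have hsub : (Set.univ.pi fun i => Set.Icc (ξ₀ i - s) (ξ₀ i + s)) ⊆
      WithLp.toLp 2 ⁻¹' Metric.closedBall ξ₀ ρ := by
    intro x hx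
    rw [Set.mem_preimage, Metric.mem_closedBall, dist_eq_norm]
    have h1 : ∀ i, |x i - ξ₀ i| ≤ s := fun i => by
      have := hx i (Set.mem_univ i)
      rw [abs_le]
      constructor <;> linarith [this.1, this.2]
    refine abs_le_of_sq_le_sq' ?_ hρ |>.2
    rw [EuclideanSpace.real_norm_sq_eq]
    calc ∑ i, ((WithLp.toLp 2 x - ξ₀ : EuclideanSpace ℝ ι).ofLp i) ^ 2
        = ∑ i, |x i - ξ₀ i| ^ 2 := by simp
      _ ≤ (∑ i, |x i - ξ₀ i|) ^ 2 := Finset.sum_sq_le_sq_sum_of_nonneg fun i _ => abs_nonneg _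
      _ ≤ (Fintype.card ι * s) ^ 2 := by
          refine pow_le_pow_left₀ (Finset.sum_nonneg fun i _ => abs_nonneg _) ?_ 2
          exact (Finset.sum_le_card_nsmul _ _ s fun i _ => h1 i).trans (by simp)
      _ ≤ ρ ^ 2 := by
          refine pow_le_pow_left₀ (by positivity) ?_ 2
          rw [hs, mul_div_assoc', div_le_iff₀ hd]
          nlinarith
  refine le_trans ?_ (measureReal_mono hsub)
  rw [measureReal_def, Measure.pi_pi, ENNReal.toReal_prod, ← Finset.card_univ, ← Finset.prod_const]
  refine Finset.prod_le_prod (fun i _ => by positivity) fun i _ => ?_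
  have h2 : |ξ₀ i| ≤ U := le_trans (by simpa using PiLp.norm_apply_le ξ₀ i) hU
  refine le_trans (le_of_eq ?_) (le_gaussianReal_Icc (ξ₀ i) hs0 hs1 h2)
  rw [hs, Finset.card_univ]
  field_simp

theorem exists_stdGaussian_closedBall_ge {ε : ℝ} (hε : 0 < ε) :
    ∃ k : ℕ, 1 - ε ≤ (stdGaussian (EuclideanSpace ℝ ι)).real (Metric.closedBall 0 k) := by
  have h1 := tendsto_measure_iUnion_atTop (μ := stdGaussian (EuclideanSpace ℝ ι))
    (s := fun k : ℕ => Metric.closedBall 0 (k : ℝ)) fun i j hij =>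
      Metric.closedBall_subset_closedBall (by exact_mod_cast hij)
  rw [Metric.iUnion_closedBall_nat, measure_univ] at h1
  have h2 := (ENNReal.tendsto_toReal ENNReal.one_ne_top).comp h1
  obtain ⟨k, hk⟩ := (h2.eventually (lt_mem_nhds (show 1 - ε < ENNReal.toReal 1 by simpa using hε))).exists
  exact ⟨k, hk.le⟩

end Gaussian

/-! ### Concentration of Dirichlet distributions -/

section Dirichlet

theorem mul_gammaPDFReal {a : ℝ} (ha : 0 < a) (x : ℝ) :
    x * gammaPDFReal a 1 x = a * gammaPDFReal (a + 1) 1 x := by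
  unfold gammaPDFReal
  split_ifs with hx
  · rw [Real.Gamma_add_one ha.ne', add_sub_cancel_right]
    have h1 : x ^ a = x * x ^ (a - 1) := by
      rcases hx.eq_or_lt with rfl | hx
      · rw [Real.zero_rpow ha.ne', zero_mul]
      · rw [Real.rpow_sub_one hx.ne']
        field_simp
    have h2 := (Real.Gamma_pos_of_pos ha).ne'
    rw [h1, Real.one_rpow, Real.one_rpow]
    field_simp
  · simp

theorem integrable_gammaPDFReal {a : ℝ} (ha : 0 < a) : Integrable (gammaPDFReal a 1) := by
  refine ⟨(measurable_gammaPDFReal a 1).aestronglyMeasurable, ?_⟩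
  rw [hasFiniteIntegral_iff_ofReal (Eventually.of_forall (gammaPDFReal_nonneg ha one_pos))]
  have := lintegral_gammaPDF_eq_one ha one_pos
  unfold gammaPDF at this
  rw [this]
  exact ENNReal.one_lt_top

theorem integral_gammaPDFReal {a : ℝ} (ha : 0 < a) : ∫ x, gammaPDFReal a 1 x = 1 := by
  rw [integral_eq_lintegral_of_nonneg_ae (Eventually.of_forall (gammaPDFReal_nonneg ha one_pos))
    (measurable_gammaPDFReal a 1).aestronglyMeasurable]
  have := lintegral_gammaPDF_eq_one ha one_pos
  unfold gammaPDF at this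
  rw [this, ENNReal.toReal_one]

/-- Chebyshev's inequality for the Gamma distribution with mean and variance `a`. -/
theorem gammaMeasure_le {a s : ℝ} (ha : 0 < a) (hs : 0 < s) :
    (gammaMeasure a 1).real {x | s < |x - a|} ≤ a / s ^ 2 := by
  have hpt : ∀ x, (x - a) ^ 2 * gammaPDFReal a 1 x =
      a * ((a + 1) * gammaPDFReal (a + 1 + 1) 1 x) - 2 * a * (a * gammaPDFReal (a + 1) 1 x) +
        a ^ 2 * gammaPDFReal a 1 x := by
    intro x
    rw [← mul_gammaPDFReal (by linarith : 0 < a + 1), ← mul_gammaPDFReal ha]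
    have := mul_gammaPDFReal ha x
    linear_combination x * this
  have i0 := integrable_gammaPDFReal ha
  have i1 := integrable_gammaPDFReal (by linarith : 0 < a + 1)
  have i2 := integrable_gammaPDFReal (by linarith : 0 < a + 1 + 1)
  have e1 : Integrable fun x => a * ((a + 1) * gammaPDFReal (a + 1 + 1) 1 x) :=
    (i2.const_mul _).const_mul _
  have e2 : Integrable fun x => 2 * a * (a * gammaPDFReal (a + 1) 1 x) :=
    (i1.const_mul _).const_mul _
  have e12 : Integrable fun x => a * ((a + 1) * gammaPDFReal (a + 1 + 1) 1 x) -
      2 * a * (a * gammaPDFReal (a + 1) 1 x) := e1.sub e2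
  have hint : Integrable fun x => (x - a) ^ 2 * gammaPDFReal a 1 x := by
    simp_rw [hpt]
    exact e12.add (i0.const_mul _)
  have hval : ∫ x, (x - a) ^ 2 * gammaPDFReal a 1 x = a := by
    simp_rw [hpt]
    rw [integral_add e12 (i0.const_mul _), integral_sub e1 e2]
    simp only [integral_const_mul]
    rw [integral_gammaPDFReal ha, integral_gammaPDFReal (by linarith : 0 < a + 1),
      integral_gammaPDFReal (by linarith : 0 < a + 1 + 1)]
    ring
  have hms : MeasurableSet {x : ℝ | s < |x - a|} :=
    measurableSet_lt measurable_const (by fun_prop)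
  rw [measureReal_def, gammaMeasure, withDensity_apply _ hms]
  have h1 : ∫⁻ x in {x : ℝ | s < |x - a|}, gammaPDF a 1 x ≤
      ∫⁻ x, ENNReal.ofReal ((x - a) ^ 2 / s ^ 2 * gammaPDFReal a 1 x) := by
    refine (setLIntegral_mono_ae (by fun_prop) (Eventually.of_forall fun x hx => ?_)).trans
      (setLIntegral_le_lintegral _ _)
    refine ENNReal.ofReal_le_ofReal (le_mul_of_one_le_left (gammaPDFReal_nonneg ha one_pos x) ?_)
    rw [one_le_div (by positivity), ← sq_abs (x - a)]
    exact pow_le_pow_left₀ hs.le (le_of_lt hx) 2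
  have h2 : ∫⁻ x, ENNReal.ofReal ((x - a) ^ 2 / s ^ 2 * gammaPDFReal a 1 x) =
      ENNReal.ofReal (a / s ^ 2) := by
    rw [← ofReal_integral_eq_lintegral_ofReal]
    · rw [← hval, ← integral_div, hval]
      congr 2
      ext x
      ring
    · convert hint.div_const (s ^ 2) using 2
      ring
    · exact Eventually.of_forall fun x =>
        mul_nonneg (by positivity) (gammaPDFReal_nonneg ha one_pos x)
  rw [h2] at h1
  exact ENNReal.toReal_le_of_le_ofReal (by positivity) h1

theorem gammaMeasure_ae_pos (a : ℝ) : ∀ᵐ x ∂(gammaMeasure a 1), 0 < x := by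
  rw [ae_iff]
  have h1 : {x : ℝ | ¬ 0 < x} = Set.Iic 0 := by ext; simp
  rw [h1, gammaMeasure, withDensity_apply _ measurableSet_Iic,
    ← setLIntegral_congr (Iio_ae_eq_Iic (a := (0 : ℝ))), lintegral_gammaPDF_of_nonpos le_rfl]

variable {ι : Type*} [Fintype ι]

theorem measurable_normalize : Measurable fun (g : ι → ℝ) k => g k / ∑ l, g l := by
  fun_prop

theorem isProbabilityMeasure_dirichlet {a : ι → ℝ} (ha : ∀ k, 0 < a k) :
    IsProbabilityMeasure (dirichlet a) := by
  have := fun k => isProbabilityMeasure_gammaMeasure (ha k) one_pos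
  exact Measure.isProbabilityMeasure_map measurable_normalize.aemeasurable

/-- A union bound for product measures. -/
theorem le_pi_real {α : ι → Type*} [∀ i, MeasurableSpace (α i)] (ν : ∀ i, Measure (α i))
    [∀ i, IsProbabilityMeasure (ν i)] (B : ∀ i, Set (α i)) (hB : ∀ i, MeasurableSet (B i)) :
    1 - ∑ i, (1 - (ν i).real (B i)) ≤ (Measure.pi ν).real {x | ∀ i, x i ∈ B i} := by
  have hm : MeasurableSet {x : ∀ i, α i | ∀ i, x i ∈ B i} := by
    have : {x : ∀ i, α i | ∀ i, x i ∈ B i} = ⋂ i, (Function.eval i) ⁻¹' B i := by ext; simp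
    rw [this]
    exact MeasurableSet.iInter fun i => measurable_pi_apply i (hB i)
  have h1 : (Measure.pi ν).real {x | ∀ i, x i ∈ B i}ᶜ ≤ ∑ i, (1 - (ν i).real (B i)) := by
    have h2 : {x : ∀ i, α i | ∀ i, x i ∈ B i}ᶜ ⊆ ⋃ i, (Function.eval i) ⁻¹' (B i)ᶜ := by
      intro x hx
      simpa using hx
    refine (measureReal_mono h2).trans ((measureReal_iUnion_fintype_le _).trans ?_)
    refine Finset.sum_le_sum fun i _ => ?_
    rw [measureReal_def, (measurePreserving_eval ν i).measure_preimage (hB i).compl.nullMeasurableSet,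
      ← measureReal_def, probReal_compl_eq_one_sub (hB i)]
  rw [probReal_compl_eq_one_sub hm] at h1
  linarith

theorem dirichlet_ae_simplex [Nonempty ι] {a : ι → ℝ} (ha : ∀ k, 0 < a k) :
    ∀ᵐ x ∂(dirichlet a), x ∈ stdSimplex ℝ ι := by
  have := fun k => isProbabilityMeasure_gammaMeasure (ha k) one_pos
  have hs : MeasurableSet (stdSimplex ℝ ι) := (isClosed_stdSimplex ℝ ι).measurableSet
  refine (ae_map_iff (p := fun x => x ∈ stdSimplex ℝ ι) measurable_normalize.aemeasurable hs).2 ?_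
  have h1 : ∀ k, ∀ᵐ g ∂(Measure.pi fun k => gammaMeasure (a k) 1), 0 < g k := fun k =>
    (measurePreserving_eval _ k).quasiMeasurePreserving.ae (gammaMeasure_ae_pos (a k))
  filter_upwards [ae_all_iff.2 h1] with g hg
  have hpos : 0 < ∑ l, g l := Finset.sum_pos (fun l _ => hg l) Finset.univ_nonempty
  refine ⟨fun k => div_nonneg (hg k).le hpos.le, ?_⟩
  rw [← Finset.sum_div, div_self hpos.ne']

/-- A Dirichlet distribution with large total parameter is concentrated near its mean. -/
theorem le_dirichlet [Nonempty ι] {a : ι → ℝ} (ha : ∀ k, 0 < a k) {u : ℝ} (hu : 0 < u)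
    (hu1 : Fintype.card ι * u ≤ 1 / 2) :
    1 - 1 / ((∑ l, a l) * u ^ 2) ≤ (dirichlet a).real
      {x | ∀ k, |x k - a k / ∑ l, a l| ≤ 2 * (1 + Fintype.card ι) * u} := by
  have := fun k => isProbabilityMeasure_gammaMeasure (ha k) one_pos
  set T := ∑ l, a l with hT
  have hTpos : 0 < T := Finset.sum_pos (fun l _ => ha l) Finset.univ_nonempty
  have hms : MeasurableSet {x : ι → ℝ | ∀ k, |x k - a k / T| ≤ 2 * (1 + Fintype.card ι) * u} := by
    rw [Set.ofPred_forall]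
    exact MeasurableSet.iInter fun k => measurableSet_le (by fun_prop) measurable_const
  rw [dirichlet, map_measureReal_apply measurable_normalize hms]
  have h1 := le_pi_real (fun k => gammaMeasure (a k) 1) (fun k => {x | |x - a k| ≤ u * T})
    fun k => measurableSet_le (by fun_prop) measurable_const
  have h2 : ∑ k, (1 - (gammaMeasure (a k) 1).real {x | |x - a k| ≤ u * T}) ≤ 1 / (T * u ^ 2) := by
    calc ∑ k, (1 - (gammaMeasure (a k) 1).real {x | |x - a k| ≤ u * T})
        ≤ ∑ k, a k / (u * T) ^ 2 := by
          refine Finset.sum_le_sum fun k _ => ?_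
          rw [← probReal_compl_eq_one_sub (measurableSet_le (by fun_prop) measurable_const)]
          have : {x : ℝ | |x - a k| ≤ u * T}ᶜ = {x | u * T < |x - a k|} := by ext; simp
          rw [this]
          exact gammaMeasure_le (ha k) (by positivity)
      _ = 1 / (T * u ^ 2) := by
          rw [← Finset.sum_div, ← hT]
          field_simp
  refine le_trans (by linarith) (h1.trans (measureReal_mono fun g hg => ?_))
  simp only [Set.mem_preimage, Set.mem_ofPred_eq] at hg ⊢
  intro k
  have h3 : |∑ l, g l - T| ≤ Fintype.card ι * (u * T) := by
    rw [hT, ← Finset.sum_sub_distrib]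
    refine (Finset.abs_sum_le_sum_abs _ _).trans ?_
    exact (Finset.sum_le_card_nsmul _ _ (u * T) fun l _ => hg l).trans
      (by rw [Finset.card_univ, nsmul_eq_mul])
  have h4 : T / 2 ≤ ∑ l, g l := by
    have : Fintype.card ι * (u * T) ≤ T / 2 := by nlinarith
    linarith [(abs_le.1 h3).1]
  have h5 : 0 < ∑ l, g l := by linarith
  have h6 : a k ≤ T := Finset.single_le_sum (fun l _ => (ha l).le) (Finset.mem_univ k)
  rw [div_sub_div _ _ h5.ne' hTpos.ne', abs_div, abs_of_pos (mul_pos h5 hTpos),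
    div_le_iff₀ (mul_pos h5 hTpos)]
  have h7 : |g k * T - (∑ l, g l) * a k| ≤ u * T * T + a k * (Fintype.card ι * (u * T)) := by
    have : g k * T - (∑ l, g l) * a k = (g k - a k) * T + -(a k * (∑ l, g l - T)) := by ring
    rw [this]
    refine (abs_add_le _ _).trans (add_le_add ?_ ?_)
    · rw [abs_mul, abs_of_pos hTpos]
      exact mul_le_mul_of_nonneg_right (hg k) hTpos.le
    · rw [abs_neg, abs_mul, abs_of_pos (ha k)]
      exact mul_le_mul_of_nonneg_left h3 (ha k).le
  calc |g k * T - (∑ l, g l) * a k| ≤ u * T * T + T * (Fintype.card ι * (u * T)) := by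
        refine h7.trans ?_
        gcongr
    _ = 2 * (1 + Fintype.card ι) * u * (T / 2 * T) := by ring
    _ ≤ _ := by gcongr

end Dirichlet

/-! ### Posteriors and the law of one round -/

section Posterior

variable {S A : Type*} {h : ℕ} [Fintype S] [DecidableEq S] [Fintype A] [DecidableEq A]

/-- Number of transitions `(s, a) → s'` observed before round `n`. -/
noncomputable def transCount (n : ℕ) (c : ℕ → Round S A h) (s : S) (a : A) (s' : S) : ℝ :=
  ∑ k ∈ Finset.range n, ∑ j : Fin 2, transitions ((c k).traj j) s a s'

/-- Number of visits to `(s, a)` before round `n`. -/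
noncomputable def visitCount (n : ℕ) (c : ℕ → Round S A h) (q : S × A) : ℝ :=
  ∑ k ∈ Finset.range n, ∑ j : Fin 2, visits ((c k).traj j) q

theorem transCount_nonneg (n : ℕ) (c : ℕ → Round S A h) (s : S) (a : A) (s' : S) :
    0 ≤ transCount n c s a s' :=
  Finset.sum_nonneg fun _ _ => Finset.sum_nonneg fun _ _ => transitions_nonneg _ _ _ _

theorem visitCount_nonneg (n : ℕ) (c : ℕ → Round S A h) (q : S × A) : 0 ≤ visitCount n c q :=
  Finset.sum_nonneg fun _ _ => Finset.sum_nonneg fun _ _ => visits_nonneg _ _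

theorem sum_transCount (n : ℕ) (c : ℕ → Round S A h) (s : S) (a : A) :
    ∑ s', transCount n c s a s' = visitCount n c (s, a) := by
  unfold transCount visitCount
  rw [Finset.sum_comm]
  refine Finset.sum_congr rfl fun k _ => ?_
  rw [Finset.sum_comm]
  exact Finset.sum_congr rfl fun j _ => sum_transitions _ s a

theorem visitCount_succ (n : ℕ) (c : ℕ → Round S A h) (q : S × A) :
    visitCount (n + 1) c q = visitCount n c q + ∑ j : Fin 2, visits ((c n).traj j) q :=
  Finset.sum_range_succ _ _

theorem transCount_succ (n : ℕ) (c : ℕ → Round S A h) (s : S) (a : A) (s' : S) :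
    transCount (n + 1) c s a s' =
      transCount n c s a s' + ∑ j : Fin 2, transitions ((c n).traj j) s a s' :=
  Finset.sum_range_succ _ _

theorem visitCount_mono (c : ℕ → Round S A h) (q : S × A) :
    Monotone fun n => visitCount n c q := by
  refine monotone_nat_of_le_succ fun n => ?_
  rw [visitCount_succ]
  have : 0 ≤ ∑ j : Fin 2, visits ((c n).traj j) q := Finset.sum_nonneg fun j _ => visits_nonneg _ _
  linarith

variable {P : Params S A}

theorem dynPosterior_eq (P : Params S A) (n : ℕ) (c : ℕ → Round S A h) :
    dynPosterior P n c = Measure.pi fun s => Measure.pi fun a =>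
      dirichlet fun s' => P.α s a s' + transCount n c s a s' := rfl

theorem dirichletParam_pos (hα : ∀ s a s', 0 < P.α s a s') (n : ℕ) (c : ℕ → Round S A h)
    (s : S) (a : A) (s' : S) : 0 < P.α s a s' + transCount n c s a s' :=
  add_pos_of_pos_of_nonneg (hα s a s') (transCount_nonneg n c s a s')

theorem isProbabilityMeasure_dynPosterior (hα : ∀ s a s', 0 < P.α s a s') (n : ℕ)
    (c : ℕ → Round S A h) : IsProbabilityMeasure (dynPosterior P n c) := by
  have := fun s a => isProbabilityMeasure_dirichlet (dirichletParam_pos hα n c s a)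
  rw [dynPosterior_eq]
  infer_instance

instance isProbabilityMeasure_rewPosterior (P : Params S A) (n : ℕ) (c : ℕ → Round S A h) :
    IsProbabilityMeasure (rewPosterior P n c) := by
  unfold rewPosterior
  infer_instance

variable {p₀ : S → ℝ}

theorem TieBreak.prob_le_one (tb : TieBreak S A h p₀) (p : Dyn S A) (r : Rew S A)
    (π : Policy S A h) : tb.prob p r π ≤ 1 := by
  rw [← tb.sum_eq_one p r]
  exact Finset.single_le_sum (fun π _ => tb.nonneg p r π) (Finset.mem_univ π)

theorem TieBreak.integrable_prob (tb : TieBreak S A h p₀) (π : Policy S A h)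
    (ν : Measure (Dyn S A × Rew S A)) [IsFiniteMeasure ν] :
    Integrable (fun q => tb.prob q.1 q.2 π) ν := by
  refine Integrable.of_bound (tb.measurable_prob π).aestronglyMeasurable 1
    (Eventually.of_forall fun q => ?_)
  rw [Real.norm_of_nonneg (tb.nonneg _ _ _)]
  exact tb.prob_le_one _ _ _

theorem selectProb_nonneg (tb : TieBreak S A h p₀) (n : ℕ) (c : ℕ → Round S A h)
    (π : Policy S A h) : 0 ≤ selectProb P tb n c π :=
  integral_nonneg fun _ => tb.nonneg _ _ _

theorem sum_selectProb (hα : ∀ s a s', 0 < P.α s a s') (tb : TieBreak S A h p₀) (n : ℕ)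
    (c : ℕ → Round S A h) : ∑ π, selectProb P tb n c π = 1 := by
  have := isProbabilityMeasure_dynPosterior hα n c
  unfold selectProb
  rw [← integral_finsetSum _ fun π _ => tb.integrable_prob π _]
  simp [tb.sum_eq_one]

/-- If all samples from a set of dynamics and a set of rewards lead to policies in `T`, then the
selection probability of `T` is at least the posterior probability of the two sets. -/
theorem le_sum_selectProb (hα : ∀ s a s', 0 < P.α s a s') (tb : TieBreak S A h p₀) (n : ℕ)
    (c : ℕ → Round S A h) {D : Set (Dyn S A)} {V : Set (Rew S A)} (hD : MeasurableSet D)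
    (hV : MeasurableSet V) (T : Finset (Policy S A h))
    (hT : ∀ p ∈ D, ∀ r ∈ V, ∀ π, IsOptimal p₀ p r π → π ∈ T) :
    (dynPosterior P n c).real D * (rewPosterior P n c).real V ≤ ∑ π ∈ T, selectProb P tb n c π := by
  have := isProbabilityMeasure_dynPosterior hα n c
  unfold selectProb
  rw [← integral_finsetSum _ fun π _ => tb.integrable_prob π _, ← measureReal_prod_prod,
    ← integral_indicator_one (hD.prod hV)]
  refine integral_mono ((integrable_const (1 : ℝ)).indicator (hD.prod hV))
    (integrable_finsetSum _ fun π _ => tb.integrable_prob π _) fun q => ?_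
  · by_cases hq : q ∈ D ×ˢ V
    · rw [Set.indicator_of_mem hq, Pi.one_apply, ← tb.sum_eq_one q.1 q.2]
      refine (Finset.sum_subset (Finset.subset_univ T) fun π _ hπ => ?_).ge
      by_contra h0
      exact hπ (hT q.1 hq.1 q.2 hq.2 π (tb.optimal _ _ _ h0))
    · rw [Set.indicator_of_notMem hq]
      exact Finset.sum_nonneg fun π _ => tb.nonneg _ _ _

end Posterior

section RoundProb

variable {S A : Type*} {h : ℕ} [Fintype S] [DecidableEq S] [Fintype A] [DecidableEq A]

/-- A round is a choice of two policies, two trajectories and a preference. -/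
def Round.equiv (S A : Type*) (h : ℕ) :
    Round S A h ≃ (Fin 2 → Policy S A h) × (Fin 2 → Traj S A h) × Bool where
  toFun c := (c.pol, c.traj, c.pref)
  invFun q := ⟨q.1, q.2.1, q.2.2⟩
  left_inv _ := rfl
  right_inv _ := rfl

noncomputable instance : Fintype (Round S A h) := Fintype.ofEquiv _ (Round.equiv S A h).symm

/-- Rounds form a finite set, every subset of which is measurable. -/
instance : MeasurableSpace (Round S A h) := ⊤

instance : DiscreteMeasurableSpace (Round S A h) := ⟨fun _ => trivial⟩

theorem sum_round (f : Round S A h → ℝ) :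
    ∑ d, f d = ∑ pol : Fin 2 → Policy S A h, ∑ traj : Fin 2 → Traj S A h, ∑ b, f ⟨pol, traj, b⟩ := by
  rw [← (Round.equiv S A h).symm.sum_comp, Fintype.sum_prod_type]
  refine Finset.sum_congr rfl fun _ _ => ?_
  rw [Fintype.sum_prod_type]
  rfl

variable (E : Env S A h) {P : Params S A} (tb : TieBreak S A h E.p₀)

theorem Env.trajProb_nonneg (π : Policy S A h) (τ : Traj S A h) : 0 ≤ trajProb E.p₀ E.p π τ :=
  DPS.trajProb_nonneg E.p₀_mem.1 (fun s a => (E.p_mem s a).1) π τ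

theorem Env.sum_trajProb (π : Policy S A h) : ∑ τ, trajProb E.p₀ E.p π τ = 1 :=
  DPS.sum_trajProb E.p₀_mem E.p_mem π

/-- The probability that given trajectories are observed under given policies. -/
noncomputable def pairProb (P : Params S A) (n : ℕ) (c : ℕ → Round S A h)
    (pol : Fin 2 → Policy S A h) (traj : Fin 2 → Traj S A h) : ℝ :=
  ∏ j : Fin 2, selectProb P tb n c (pol j) * trajProb E.p₀ E.p (pol j) (traj j)

theorem roundProb_eq (n : ℕ) (c : ℕ → Round S A h) (d : Round S A h) :
    roundProb E P tb n c d =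
      pairProb E tb P n c d.pol d.traj * prefProb E.r (d.traj 0) (d.traj 1) d.pref := rfl

theorem pairProb_nonneg (n : ℕ) (c : ℕ → Round S A h)
    (pol : Fin 2 → Policy S A h) (traj : Fin 2 → Traj S A h) : 0 ≤ pairProb E tb P n c pol traj :=
  Finset.prod_nonneg fun _ _ => mul_nonneg (selectProb_nonneg _ _ _ _) (E.trajProb_nonneg _ _)

variable {E tb}

/-- Trajectories that occur have utilities that differ by at most `1/2`. -/
theorem abs_utility_sub_le {n : ℕ} {c : ℕ → Round S A h}
    {pol : Fin 2 → Policy S A h} {traj : Fin 2 → Traj S A h}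
    (hpos : pairProb E tb P n c pol traj ≠ 0) :
    |utility E.r (traj 1) - utility E.r (traj 0)| ≤ 1 / 2 := by
  rw [pairProb, Fin.prod_univ_two] at hpos
  have h1 := right_ne_zero_of_mul (left_ne_zero_of_mul hpos)
  have h2 := right_ne_zero_of_mul (right_ne_zero_of_mul hpos)
  exact E.link_range (pol 0) (pol 1) (traj 0) (traj 1)
    ((E.trajProb_nonneg _ _).lt_of_ne' h1) ((E.trajProb_nonneg _ _).lt_of_ne' h2)

theorem prefProb_nonneg {r : Rew S A} {τ₁ τ₂ : Traj S A h}
    (hle : |utility r τ₂ - utility r τ₁| ≤ 1 / 2) (b : Bool) : 0 ≤ prefProb r τ₁ τ₂ b := by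
  rw [abs_le] at hle
  unfold prefProb
  split_ifs <;> linarith

theorem roundProb_nonneg (n : ℕ) (c : ℕ → Round S A h) (d : Round S A h) :
    0 ≤ roundProb E P tb n c d := by
  rw [roundProb_eq]
  by_cases h0 : pairProb E tb P n c d.pol d.traj = 0
  · rw [h0, zero_mul]
  · exact mul_nonneg (pairProb_nonneg E tb _ _ _ _) (prefProb_nonneg (abs_utility_sub_le h0) _)

theorem sum_prefProb (r : Rew S A) (τ₁ τ₂ : Traj S A h) : ∑ b, prefProb r τ₁ τ₂ b = 1 := by
  rw [Fintype.sum_bool]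
  simp only [prefProb, if_true, Bool.false_eq_true, if_false]
  ring

theorem sum_pairProb (n : ℕ) (c : ℕ → Round S A h) (pol : Fin 2 → Policy S A h) :
    ∑ traj : Fin 2 → Traj S A h, pairProb E tb P n c pol traj =
      ∏ j, selectProb P tb n c (pol j) := by
  unfold pairProb
  have := Finset.prod_univ_sum (fun _ : Fin 2 => (Finset.univ : Finset (Traj S A h)))
    (fun j τ => selectProb P tb n c (pol j) * trajProb E.p₀ E.p (pol j) τ)
  rw [Fintype.piFinset_univ] at this
  rw [← this]
  simp_rw [← Finset.mul_sum, E.sum_trajProb, mul_one]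

theorem sum_prod_selectProb (hα : ∀ s a s', 0 < P.α s a s') (n : ℕ) (c : ℕ → Round S A h) :
    ∑ pol : Fin 2 → Policy S A h, ∏ j, selectProb P tb n c (pol j) = 1 := by
  have := Finset.prod_univ_sum (fun _ : Fin 2 => (Finset.univ : Finset (Policy S A h)))
    (fun _ π => selectProb P tb n c π)
  rw [Fintype.piFinset_univ] at this
  rw [← this]
  simp_rw [sum_selectProb hα, Finset.prod_const_one]

theorem sum_roundProb (hα : ∀ s a s', 0 < P.α s a s') (n : ℕ) (c : ℕ → Round S A h) :
    ∑ d, roundProb E P tb n c d = 1 := by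
  rw [sum_round, ← sum_prod_selectProb (tb := tb) hα n c]
  refine Finset.sum_congr rfl fun pol _ => ?_
  rw [← sum_pairProb (E := E)]
  refine Finset.sum_congr rfl fun traj _ => ?_
  simp only [roundProb_eq]
  rw [← Finset.mul_sum, sum_prefProb, mul_one]

/-- To bound an expectation over a round it suffices to average over the preference. -/
theorem sum_roundProb_mul_le (hα : ∀ s a s', 0 < P.α s a s') (n : ℕ) (c : ℕ → Round S A h)
    (f : Round S A h → ℝ) {C : ℝ}
    (hf : ∀ pol traj, |utility E.r (traj 1) - utility E.r (traj 0)| ≤ 1 / 2 →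
      ∑ b, prefProb E.r (traj 0) (traj 1) b * f ⟨pol, traj, b⟩ ≤ C) :
    ∑ d, roundProb E P tb n c d * f d ≤ C := by
  rw [sum_round]
  calc ∑ pol, ∑ traj, ∑ b, roundProb E P tb n c ⟨pol, traj, b⟩ * f ⟨pol, traj, b⟩
      ≤ ∑ pol, ∑ traj, pairProb E tb P n c pol traj * C := by
        refine Finset.sum_le_sum fun pol _ => Finset.sum_le_sum fun traj _ => ?_
        simp only [roundProb_eq, mul_assoc]
        rw [← Finset.mul_sum]
        by_cases h0 : pairProb E tb P n c pol traj = 0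
        · rw [h0, zero_mul, zero_mul]
        · exact mul_le_mul_of_nonneg_left (hf pol traj (abs_utility_sub_le h0))
            (pairProb_nonneg E tb _ _ _ _)
    _ = C := by
        simp_rw [← Finset.sum_mul, sum_pairProb]
        rw [sum_prod_selectProb hα, one_mul]

end RoundProb

/-! ### Functions of the history and supermartingales -/

section DependsOnPast

variable {S A : Type*} {h : ℕ} [Fintype S] [DecidableEq S] [Fintype A] [DecidableEq A]
  {P : Params S A}

theorem dependsOn_gram (n : ℕ) :
    DependsOn (gram P n : (ℕ → Round S A h) → _) (Set.Iio n) := by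
  intro c c' hc
  simp only [gram]
  congr 1
  exact Finset.sum_congr rfl fun k hk => by rw [hc k (Finset.mem_range.1 hk)]

theorem dependsOn_beta (n : ℕ) :
    DependsOn (beta P n : (ℕ → Round S A h) → _) (Set.Iio n) := by
  intro c c' hc
  simp only [beta]
  rw [dependsOn_gram n hc]

theorem dependsOn_transCount (n : ℕ) :
    DependsOn (transCount n : (ℕ → Round S A h) → _) (Set.Iio n) := by
  intro c c' hc
  funext s a s'
  exact Finset.sum_congr rfl fun k hk => by rw [hc k (Finset.mem_range.1 hk)]

theorem dependsOn_visitCount (n : ℕ) :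
    DependsOn (visitCount n : (ℕ → Round S A h) → _) (Set.Iio n) := by
  intro c c' hc
  funext q
  exact Finset.sum_congr rfl fun k hk => by rw [hc k (Finset.mem_range.1 hk)]

theorem dependsOn_rewPosterior (n : ℕ) :
    DependsOn (rewPosterior P n : (ℕ → Round S A h) → _) (Set.Iio n) := by
  intro c c' hc
  simp only [rewPosterior, rewMean]
  rw [dependsOn_gram n hc, dependsOn_beta n hc,
    Finset.sum_congr rfl fun k hk => by rw [hc k (Finset.mem_range.1 hk)]]

theorem dependsOn_dynPosterior (n : ℕ) :
    DependsOn (dynPosterior P n : (ℕ → Round S A h) → _) (Set.Iio n) := by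
  intro c c' hc
  simp only [dynPosterior_eq]
  rw [dependsOn_transCount n hc]

theorem dependsOn_selectProb {p₀ : S → ℝ} (tb : TieBreak S A h p₀) (n : ℕ) :
    DependsOn (selectProb P tb n : (ℕ → Round S A h) → _) (Set.Iio n) := by
  intro c c' hc
  funext π
  simp only [selectProb]
  rw [dependsOn_rewPosterior n hc, dependsOn_dynPosterior n hc]

theorem dependsOn_roundProb (E : Env S A h) (tb : TieBreak S A h E.p₀) (n : ℕ) :
    DependsOn (roundProb E P tb n : (ℕ → Round S A h) → _) (Set.Iio n) := by
  intro c c' hc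
  funext d
  simp only [roundProb]
  rw [dependsOn_selectProb tb n hc]

end DependsOnPast

section Run

variable {S A : Type*} {h : ℕ} [Fintype S] [DecidableEq S] [Fintype A] [DecidableEq A]
  {P : Params S A} {E : Env S A h} {tb : TieBreak S A h E.p₀}
  {Ω : Type*} [MeasurableSpace Ω] {μ : Measure Ω} {X : ℕ → Ω → Round S A h}

theorem IsDPS.measurable (hX : IsDPS μ E P tb X) (n : ℕ) : Measurable (X n) :=
  measurable_to_countable' fun d => hX.measurableSet_eq n d

/-- The history of the rounds before `n`. -/
def history (X : ℕ → Ω → Round S A h) (n : ℕ) (ω : Ω) : Fin n → Round S A h := fun k => X k ω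

theorem IsDPS.measurable_history (hX : IsDPS μ E P tb X) (n : ℕ) : Measurable (history X n) :=
  measurable_pi_lambda _ fun k => hX.measurable k

/-- Continue a finite history by the constant sequence `d`. -/
def pad (d : Round S A h) {n : ℕ} (e : Fin n → Round S A h) (k : ℕ) : Round S A h :=
  if hk : k < n then e ⟨k, hk⟩ else d

theorem pad_history (d : Round S A h) (n : ℕ) (ω : Ω) {k : ℕ} (hk : k < n) :
    pad d (history X n ω) k = X k ω := by
  simp [pad, hk, history]

theorem DependsOn.comp_pad_history {β : Type*} {f : (ℕ → Round S A h) → β} {n : ℕ}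
    (hf : DependsOn f (Set.Iio n)) (d : Round S A h) (ω : Ω) :
    f (pad d (history X n ω)) = f fun k => X k ω :=
  hf fun _ hk => pad_history d n ω hk

theorem IsDPS.measurable_comp [Nonempty Ω] {β : Type*} [MeasurableSpace β]
    (hX : IsDPS μ E P tb X) {f : (ℕ → Round S A h) → β}
    {n : ℕ} (hf : DependsOn f (Set.Iio n)) : Measurable fun ω => f fun k => X k ω := by
  have h1 : (fun ω => f fun k => X k ω) =
      (fun e => f (pad (X 0 (Classical.arbitrary Ω)) e)) ∘ history X n :=
    funext fun ω => (DependsOn.comp_pad_history hf _ ω).symm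
  rw [h1]
  exact (measurable_of_countable _).comp (hX.measurable_history n)

theorem IsDPS.integrable_comp [Nonempty Ω] [IsFiniteMeasure μ]
    (hX : IsDPS μ E P tb X) {f : (ℕ → Round S A h) → ℝ}
    {n : ℕ} (hf : DependsOn f (Set.Iio n)) : Integrable (fun ω => f fun k => X k ω) μ := by
  obtain ⟨C, hC⟩ := (Set.finite_range fun e : Fin n → Round S A h =>
    ‖f (pad (X 0 (Classical.arbitrary Ω)) e)‖).bddAbove
  refine Integrable.of_bound (hX.measurable_comp hf).aestronglyMeasurable C
    (Eventually.of_forall fun ω => ?_)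
  rw [← DependsOn.comp_pad_history hf (X 0 (Classical.arbitrary Ω)) ω]
  exact hC ⟨_, rfl⟩

theorem IsDPS.integral_eq_sum [IsFiniteMeasure μ]
    (hX : IsDPS μ E P tb X) (d : Round S A h) {f : (ℕ → Round S A h) → ℝ}
    {n : ℕ} (hf : DependsOn f (Set.Iio n)) : ∫ ω, f (fun k => X k ω) ∂μ =
      ∑ e : Fin n → Round S A h, μ.real {ω | ∀ k < n, X k ω = pad d e k} * f (pad d e) := by
  simp_rw [← DependsOn.comp_pad_history hf d]
  rw [← integral_map (φ := history X n) (f := fun e => f (pad d e))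
    (hX.measurable_history n).aemeasurable (measurable_of_countable _).aestronglyMeasurable,
    integral_fintype (Integrable.of_finite ..)]
  refine Finset.sum_congr rfl fun e _ => ?_
  rw [smul_eq_mul, map_measureReal_apply (hX.measurable_history n) (measurableSet_singleton e)]
  congr 2
  ext ω
  simp only [Set.mem_preimage, Set.mem_singleton_iff, Set.mem_ofPred_eq, funext_iff, history, pad]
  constructor
  · intro h1 k hk
    simp [hk, h1 ⟨k, hk⟩]
  · intro h1 k
    simpa using h1 k k.2

/-- The law of total expectation: round `n` may be averaged out by means of `roundProb`. -/
theorem IsDPS.integral_succ [IsProbabilityMeasure μ]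
    (hX : IsDPS μ E P tb X) {f : (ℕ → Round S A h) → ℝ}
    {n : ℕ} (hf : DependsOn f (Set.Iio (n + 1))) : ∫ ω, f (fun k => X k ω) ∂μ =
      ∫ ω, ∑ d, roundProb E P tb n (fun k => X k ω) d *
        f (Function.update (fun k => X k ω) n d) ∂μ := by
  have hΩ : Nonempty Ω := nonempty_of_isProbabilityMeasure μ
  set d₀ := X 0 (Classical.arbitrary Ω)
  have hg : DependsOn (fun c => ∑ d, roundProb E P tb n c d * f (Function.update c n d))
      (Set.Iio n) := by
    intro c c' hc
    refine Finset.sum_congr rfl fun d _ => ?_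
    rw [dependsOn_roundProb E tb n hc]
    congr 1
    refine hf fun k hk => ?_
    rcases eq_or_ne k n with rfl | hkn
    · simp
    · rw [Function.update_of_ne hkn, Function.update_of_ne hkn,
        hc k (lt_of_le_of_ne (Nat.lt_succ_iff.1 hk) hkn)]
  rw [hX.integral_eq_sum d₀ hf, hX.integral_eq_sum d₀ hg,
    ← (Fin.snocEquiv fun _ => Round S A h).sum_comp, Fintype.sum_prod_type, Finset.sum_comm]
  refine Finset.sum_congr rfl fun e _ => ?_
  rw [Finset.mul_sum]
  refine Finset.sum_congr rfl fun d _ => ?_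
  set e' : Fin (n + 1) → Round S A h := Fin.snocEquiv (fun _ => Round S A h) (d, e)
  have h1 : ∀ k < n, pad d₀ e' k = pad d₀ e k := by
    intro k hk
    simp [pad, hk, hk.trans (Nat.lt_succ_self n), e', Fin.snocEquiv, Fin.snoc]
  have h2 : pad d₀ e' n = d := by
    simp [pad, e', Fin.snocEquiv, Fin.snoc]
  rw [hX.law n (pad d₀ e'), h2, dependsOn_roundProb E tb n (y := pad d₀ e) h1]
  have h3 : {ω | ∀ k < n, X k ω = pad d₀ e' k} = {ω | ∀ k < n, X k ω = pad d₀ e k} := by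
    ext ω
    exact forall₂_congr fun k hk => by rw [h1 k hk]
  have h4 : f (pad d₀ e') = f (Function.update (pad d₀ e) n d) := by
    refine hf fun k hk => ?_
    rcases eq_or_ne k n with rfl | hkn
    · simp [h2]
    · rw [Function.update_of_ne hkn, h1 k (lt_of_le_of_ne (Nat.lt_succ_iff.1 hk) hkn)]
  rw [h3, h4, mul_assoc]

/-- The filtration generated by the rounds. -/
def IsDPS.filtration (hX : IsDPS μ E P tb X) : Filtration ℕ ‹MeasurableSpace Ω› where
  seq n := MeasurableSpace.comap (history X n) inferInstance
  mono' m n hmn := by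
    have h1 : history X m = (fun e : Fin n → Round S A h => fun k => e (Fin.castLE hmn k)) ∘
        history X n := rfl
    change MeasurableSpace.comap (history X m) _ ≤ MeasurableSpace.comap (history X n) _
    rw [h1, ← MeasurableSpace.comap_comp]
    refine MeasurableSpace.comap_mono ?_
    exact Measurable.comap_le (measurable_pi_lambda _ fun k => measurable_pi_apply _)
  le' n := (hX.measurable_history n).comap_le

/-- A nonnegative function of the history that does not increase on average from one round to the
next is almost surely bounded along a run. -/
theorem IsDPS.ae_exists_bound [IsProbabilityMeasure μ] (hX : IsDPS μ E P tb X)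
    {F : ℕ → (ℕ → Round S A h) → ℝ} (hF : ∀ n, DependsOn (F n) (Set.Iio n))
    (hF0 : ∀ n c, 0 ≤ F n c)
    (hstep : ∀ n c, ∑ d, roundProb E P tb n c d * F (n + 1) (Function.update c n d) ≤ F n c) :
    ∀ᵐ ω ∂μ, ∃ C, ∀ n, F n (fun k => X k ω) ≤ C := by
  have hΩ : Nonempty Ω := nonempty_of_isProbabilityMeasure μ
  have hint : ∀ n, Integrable (fun ω => F n fun k => X k ω) μ := fun n => hX.integrable_comp (hF n)
  have hsuper : Supermartingale (fun n ω => F n fun k => X k ω) hX.filtration μ := by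
    refine supermartingale_of_setIntegral_succ_le (fun n => ?_) hint fun n s hs => ?_
    · refine Measurable.stronglyMeasurable ?_
      have h1 : (fun ω => F n fun k => X k ω) =
          (fun e => F n (pad (X 0 (Classical.arbitrary Ω)) e)) ∘ history X n :=
        funext fun ω => (DependsOn.comp_pad_history (hF n) _ ω).symm
      rw [h1]
      exact (measurable_of_countable _).comp (comap_measurable _)
    · obtain ⟨t, -, rfl⟩ := hs
      classical
      have hms := hX.measurable_history n (Set.to_countable t).measurableSet
      -- the indicator of the event as a function of the sequence of rounds
      set I : (ℕ → Round S A h) → ℝ := fun c => if (fun k : Fin n => c k) ∈ t then 1 else 0 with hI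
      have hId : DependsOn I (Set.Iio n) := by
        intro c c' hc
        have : (fun k : Fin n => c k) = fun k : Fin n => c' k := funext fun k => hc k k.2
        simp only [hI, this]
      have hI0 : ∀ c, 0 ≤ I c := fun c => by simp only [hI]; split_ifs <;> simp
      have hIu : ∀ c d, I (Function.update c n d) = I c := fun c d => hId fun k hk =>
        Function.update_of_ne (ne_of_lt hk) _ _
      have hset : ∀ g : Ω → ℝ, ∫ ω in history X n ⁻¹' t, g ω ∂μ =
          ∫ ω, I (fun k => X k ω) * g ω ∂μ := by
        intro g
        rw [← integral_indicator hms]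
        refine integral_congr_ae (Eventually.of_forall fun ω => ?_)
        by_cases hω : history X n ω ∈ t
        · have h1 : I (fun k => X k ω) = 1 := if_pos hω
          simp only [h1, one_mul]
          exact Set.indicator_of_mem (s := history X n ⁻¹' t) hω g
        · have h1 : I (fun k => X k ω) = 0 := if_neg hω
          simp only [h1, zero_mul]
          exact Set.indicator_of_notMem (s := history X n ⁻¹' t) hω g
      rw [hset, hset, hX.integral_succ (n := n) (f := fun c => I c * F (n + 1) c)]
      · simp_rw [hIu]
        refine integral_mono ?_ ?_ fun ω => ?_
        · refine hX.integrable_comp (n := n) (f := fun c => ∑ d, roundProb E P tb n c d *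
            (I c * F (n + 1) (Function.update c n d))) ?_
          intro c c' hc
          refine Finset.sum_congr rfl fun d _ => ?_
          rw [dependsOn_roundProb E tb n hc, hId hc, hF (n + 1) (y := Function.update c' n d)]
          intro k hk
          rcases eq_or_ne k n with rfl | hkn
          · simp
          · rw [Function.update_of_ne hkn, Function.update_of_ne hkn,
              hc k (lt_of_le_of_ne (Nat.lt_succ_iff.1 hk) hkn)]
        · refine hX.integrable_comp (n := n) (f := fun c => I c * F n c) ?_
          intro c c' hc
          simp only [hId hc, hF n hc]
        · have h1 : ∑ d, roundProb E P tb n (fun k => X k ω) d *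
              (I (fun k => X k ω) * F (n + 1) (Function.update (fun k => X k ω) n d)) =
              I (fun k => X k ω) * ∑ d, roundProb E P tb n (fun k => X k ω) d *
              F (n + 1) (Function.update (fun k => X k ω) n d) := by
            rw [Finset.mul_sum]
            exact Finset.sum_congr rfl fun d _ => by ring
          simp only [h1]
          exact mul_le_mul_of_nonneg_left (hstep n _) (hI0 fun k => X k ω)
      · intro c c' hc
        have h2 := hId fun k (hk : k ∈ Set.Iio n) => hc k (hk.trans (Nat.lt_succ_self n))
        simp only [h2, hF (n + 1) hc]
  have hanti : ∀ n, ∫ ω, F n (fun k => X k ω) ∂μ ≤ ∫ ω, F 0 (fun k => X k ω) ∂μ := by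
    intro n
    simpa using hsuper.setIntegral_le (Nat.zero_le n) MeasurableSet.univ
  have hbdd : ∀ n, eLpNorm ((-fun n ω => F n fun k => X k ω) n) 1 μ ≤
      (∫ ω, F 0 (fun k => X k ω) ∂μ).toNNReal := by
    intro n
    rw [Pi.neg_apply, eLpNorm_neg, eLpNorm_one_eq_lintegral_enorm]
    have h1 : ∀ ω, ‖F n fun k => X k ω‖ₑ = ENNReal.ofReal (F n fun k => X k ω) := fun ω =>
      Real.enorm_of_nonneg (hF0 n _)
    simp_rw [h1]
    rw [← ofReal_integral_eq_lintegral_ofReal (hint n) (Eventually.of_forall fun ω => hF0 n _)]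
    exact ENNReal.ofReal_le_ofReal (hanti n)
  filter_upwards [hsuper.neg.ae_tendsto_limitProcess hbdd] with ω hω
  obtain ⟨C, hC⟩ := hω.neg.bddAbove_range
  exact ⟨C, fun n => by simpa using hC ⟨n, rfl⟩⟩

end Run

/-! ### The error of the utility estimate -/

section Exponential

theorem exp_le_add_exp_sq (x : ℝ) : Real.exp x ≤ x + Real.exp (x ^ 2) := by
  -- compare with the quadratic Taylor bounds on `[-1, 1]`, and `x` with `x ^ 2` or `0` outside
  rcases le_or_gt |x| 1 with hx | hx
  · have h1 := (abs_le.1 (Real.abs_exp_sub_one_sub_id_le hx)).2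
    have h2 := Real.add_one_le_exp (x ^ 2)
    linarith
  · rcases lt_abs.1 hx with hx | hx
    · have : Real.exp x ≤ Real.exp (x ^ 2) := Real.exp_le_exp.2 (by nlinarith)
      linarith
    · have h1 : Real.exp x ≤ 1 := Real.exp_le_one_iff.2 (by linarith)
      have h2 := Real.add_one_le_exp (x ^ 2)
      nlinarith

/-- A centered random variable with values in `[-1, 1]` is sub-Gaussian. The constant is not the
optimal one, so that `exp_le_add_exp_sq` suffices. -/
theorem sum_mul_exp_le {ι : Type*} (T : Finset ι) (p ζ : ι → ℝ) (s : ℝ) (hp : ∀ i ∈ T, 0 ≤ p i)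
    (hp1 : ∑ i ∈ T, p i = 1) (hζ : ∀ i ∈ T, |ζ i| ≤ 1) (hm : ∑ i ∈ T, p i * ζ i = 0) :
    ∑ i ∈ T, p i * Real.exp (s * ζ i - s ^ 2) ≤ 1 := by
  calc ∑ i ∈ T, p i * Real.exp (s * ζ i - s ^ 2)
      ≤ ∑ i ∈ T, (s * Real.exp (-s ^ 2) * (p i * ζ i) + p i) := by
        refine Finset.sum_le_sum fun i hi => ?_
        have h1 : (s * ζ i) ^ 2 ≤ s ^ 2 := by
          rw [mul_pow]
          exact mul_le_of_le_one_right (sq_nonneg s) ((sq_le_one_iff_abs_le_one _).2 (hζ i hi))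
        have h2 : Real.exp (s * ζ i) ≤ s * ζ i + Real.exp (s ^ 2) :=
          (exp_le_add_exp_sq _).trans (by gcongr)
        calc p i * Real.exp (s * ζ i - s ^ 2) = p i * (Real.exp (s * ζ i) * Real.exp (-s ^ 2)) := by
              rw [← Real.exp_add, sub_eq_add_neg]
          _ ≤ p i * ((s * ζ i + Real.exp (s ^ 2)) * Real.exp (-s ^ 2)) := by
              have := hp i hi
              gcongr
          _ = s * Real.exp (-s ^ 2) * (p i * ζ i) +
                p i * (Real.exp (s ^ 2) * Real.exp (-s ^ 2)) := by ring
          _ = _ := by rw [← Real.exp_add, add_neg_cancel, Real.exp_zero, mul_one]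
    _ = 1 := by rw [Finset.sum_add_distrib, ← Finset.mul_sum, hm, hp1, mul_zero, zero_add]

end Exponential

section RewardEstimate

open Matrix

variable {S A : Type*} {h : ℕ} [Fintype S] [DecidableEq S] [Fintype A] [DecidableEq A]
  {P : Params S A} {E : Env S A h} {tb : TieBreak S A h E.p₀}

/-- The image `M (r̂ - r)` of the estimation error under the Gram matrix. -/
noncomputable def errVec (P : Params S A) (r : Rew S A) (n : ℕ) (c : ℕ → Round S A h) :
    S × A → ℝ :=
  ∑ k ∈ Finset.range n, (c k).y • (c k).x - gram P n c *ᵥ r.ofLp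

theorem errVec_succ (r : Rew S A) (n : ℕ) (c : ℕ → Round S A h) :
    errVec P r (n + 1) c = errVec P r n c + (c n).noise r • (c n).x := by
  rw [errVec, errVec, Finset.sum_range_succ, gram_succ, add_mulVec, vecMulVec_mulVec,
    op_smul_eq_smul, Round.noise, sub_smul, dotProduct_comm (c n).x]
  abel

theorem dependsOn_errVec (r : Rew S A) (n : ℕ) :
    DependsOn (errVec P r n : (ℕ → Round S A h) → _) (Set.Iio n) := by
  intro c c' hc
  rw [errVec, errVec, dependsOn_gram n hc,
    Finset.sum_congr rfl fun k hk => by rw [hc k (Finset.mem_range.1 hk)]]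

theorem dependsOn_infoGain (n : ℕ) :
    DependsOn (infoGain P n : (ℕ → Round S A h) → _) (Set.Iio n) := by
  intro c c' hc
  rw [infoGain, infoGain, dependsOn_gram n hc, gram_zero, gram_zero]

theorem quad_gram_rewMean_sub (hlam : 0 < P.lam) (r : Rew S A) (n : ℕ) (c : ℕ → Round S A h) :
    quad (gram P n c) (rewMean P n c - r).ofLp = quad (gram P n c)⁻¹ (errVec P r n c) := by
  have hM := gram_posDef hlam n c
  rw [← quad_inv_mulVec hM, errVec, mulVec_sub, mulVec_mulVec _ (gram P n c)⁻¹ (gram P n c),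
    nonsing_inv_mul _ ((isUnit_iff_isUnit_det _).1 hM.isUnit), one_mulVec]
  rfl

/-- One step of the exponential supermartingale for online linear regression: `g` is the expected
label, `a` the component of the error in the observed direction and `w` the novelty. -/
theorem sum_bool_exp_le {g a w : ℝ} (hg : |g| ≤ 1 / 2) (hw : 0 ≤ w) :
    ∑ b : Bool, (if b then 1 / 2 + g else 1 / 2 - g) *
      Real.exp ((-a ^ 2 + 2 * ((if b then 1 / 2 else -(1 / 2)) - g) * a +
        ((if b then 1 / 2 else -(1 / 2)) - g) ^ 2 * w) / (1 + w) / 4 - Real.log (1 + w)) ≤ 1 := by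
  rw [abs_le] at hg
  have h1w : 0 < 1 + w := by linarith
  refine le_trans (Finset.sum_le_sum fun b _ => ?_) (sum_mul_exp_le Finset.univ
    (fun b : Bool => if b then 1 / 2 + g else 1 / 2 - g)
    (fun b : Bool => (if b then 1 / 2 else -(1 / 2)) - g) (a / (2 * (1 + w))) ?_ ?_ ?_ ?_)
  · have hζ : ((if b then 1 / 2 else -(1 / 2)) - g) ^ 2 ≤ 1 := by
      split_ifs <;> nlinarith
    generalize hz : (if b then 1 / 2 else -(1 / 2)) - g = ζ at hζ ⊢
    refine mul_le_mul_of_nonneg_left (Real.exp_le_exp.2 ?_) (by split_ifs <;> linarith)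
    have h3 : w / (1 + w) ≤ Real.log (1 + w) := by
      have := Real.one_sub_inv_le_log_of_pos h1w
      refine le_trans (le_of_eq ?_) this
      field_simp
      ring
    have h4 : ζ ^ 2 * w / (1 + w) ≤ w / (1 + w) := by
      gcongr
      nlinarith
    have h5 : 0 ≤ w / (1 + w) := by positivity
    have h6 : a ^ 2 / (1 + w) ^ 2 ≤ a ^ 2 / (1 + w) := by
      gcongr
      nlinarith
    have h7 : (-a ^ 2 + 2 * ζ * a + ζ ^ 2 * w) / (1 + w) / 4 =
        a / (2 * (1 + w)) * ζ - a ^ 2 / (1 + w) / 4 + ζ ^ 2 * w / (1 + w) / 4 := by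
      field_simp
      ring
    have h8 : (a / (2 * (1 + w))) ^ 2 = a ^ 2 / (1 + w) ^ 2 / 4 := by
      field_simp
      ring
    rw [h7, h8]
    linarith
  · intro b _
    split_ifs <;> linarith
  · rw [Fintype.sum_bool]
    simp only [if_true, Bool.false_eq_true, if_false]
    ring
  · intro b _
    rw [abs_le]
    split_ifs <;> constructor <;> linarith
  · rw [Fintype.sum_bool]
    simp only [if_true, Bool.false_eq_true, if_false]
    ring

variable {Ω : Type*} [MeasurableSpace Ω] {μ : Measure Ω} {X : ℕ → Ω → Round S A h}

/-- Self-normalized bound: almost surely, the error of the reward estimate in the metric of the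
Gram matrix is of the order of `β`. -/
theorem IsDPS.ae_reward_error [IsProbabilityMeasure μ] (hX : IsDPS μ E P tb X) (hP : P.Good)
    (hα : ∀ s a s', 0 < P.α s a s') :
    ∀ᵐ ω ∂μ, ∃ K, ∀ n, quad (gram P n fun k => X k ω) (rewMean P n (fun k => X k ω) - E.r).ofLp ≤
      K * beta P n (fun k => X k ω) ^ 2 := by
  have hl := hP.lam_pos
  -- the growth of the quadratic form is compensated by the information gain, which is at most
  -- `β ^ 2 / R ^ 2`
  set F : ℕ → (ℕ → Round S A h) → ℝ := fun n c =>
    Real.exp (quad (gram P n c)⁻¹ (errVec P E.r n c) / 4 - infoGain P n c) with hF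
  have hdep : ∀ n, DependsOn (F n) (Set.Iio n) := by
    intro n c c' hc
    simp only [hF]
    rw [dependsOn_gram n hc, dependsOn_errVec E.r n hc, dependsOn_infoGain n hc]
  have hstep : ∀ n c, ∑ d, roundProb E P tb n c d * F (n + 1) (Function.update c n d) ≤
      F n c := by
    intro n c
    refine sum_roundProb_mul_le hα n c _ fun pol traj hu => ?_
    have hupd : ∀ d, ∀ k ∈ Set.Iio n, Function.update c n d k = c k := fun d k hk =>
      Function.update_of_ne (ne_of_lt hk) _ _
    set x : S × A → ℝ := visits (traj 1) - visits (traj 0) with hx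
    have hg : E.r.ofLp ⬝ᵥ x = utility E.r (traj 1) - utility E.r (traj 0) := by
      rw [hx, dotProduct_sub, utility_eq_dotProduct, utility_eq_dotProduct]
    have hFn : ∀ b, F (n + 1) (Function.update c n ⟨pol, traj, b⟩) = F n c *
        Real.exp ((-(errVec P E.r n c ⬝ᵥ (gram P n c)⁻¹ *ᵥ x) ^ 2 +
          2 * ((if b then 1 / 2 else -(1 / 2)) - E.r.ofLp ⬝ᵥ x) *
            (errVec P E.r n c ⬝ᵥ (gram P n c)⁻¹ *ᵥ x) +
          ((if b then 1 / 2 else -(1 / 2)) - E.r.ofLp ⬝ᵥ x) ^ 2 * quad (gram P n c)⁻¹ x) /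
          (1 + quad (gram P n c)⁻¹ x) / 4 - Real.log (1 + quad (gram P n c)⁻¹ x)) := by
      intro b
      simp only [hF]
      rw [gram_succ, errVec_succ, infoGain_succ hl, novelty, dependsOn_gram n (hupd _),
        dependsOn_errVec E.r n (hupd _), dependsOn_infoGain n (hupd _), Function.update_self,
        ← Real.exp_add]
      have h1 : (⟨pol, traj, b⟩ : Round S A h).x = x := rfl
      have h2 : (⟨pol, traj, b⟩ : Round S A h).noise E.r =
        (if b then 1 / 2 else -(1 / 2)) - E.r.ofLp ⬝ᵥ x := rfl
      rw [h1, h2, quad_inv_add_vecMulVec (gram_posDef hl n c)]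
      congr 1
      ring
    simp_rw [hFn]
    have hF0 : 0 ≤ F n c := (Real.exp_pos _).le
    have h3 := sum_bool_exp_le (g := E.r.ofLp ⬝ᵥ x)
      (a := errVec P E.r n c ⬝ᵥ (gram P n c)⁻¹ *ᵥ x) (w := quad (gram P n c)⁻¹ x)
      (by rw [hg]; exact hu) (quad_nonneg (gram_posDef hl n c).inv x)
    refine le_trans (le_of_eq ?_) (mul_le_of_le_one_right hF0 h3)
    rw [Finset.mul_sum]
    refine Finset.sum_congr rfl fun b _ => ?_
    rw [prefProb, ← hg]
    ring
  filter_upwards [hX.ae_exists_bound hdep (fun n c => (Real.exp_pos _).le) hstep] with ω ⟨C, hC⟩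
  refine ⟨4 / P.R ^ 2 + 4 * |Real.log C| / betaMin P ^ 2, fun n => ?_⟩
  rw [quad_gram_rewMean_sub hl]
  have h1 := Real.log_le_log (Real.exp_pos _) (hC n)
  rw [Real.log_exp] at h1
  have h2 := R_sq_mul_infoGain_le hP n fun k => X k ω
  have h3 := pow_le_pow_left₀ (betaMin_pos hP).le (betaMin_le hP n fun k => X k ω) 2
  have h4 : infoGain P n (fun k => X k ω) ≤ beta P n (fun k => X k ω) ^ 2 / P.R ^ 2 := by
    rw [le_div_iff₀ (pow_pos hP.R_pos 2)]
    linarith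
  have h5 : |Real.log C| ≤ |Real.log C| / betaMin P ^ 2 * beta P n (fun k => X k ω) ^ 2 := by
    rw [div_mul_eq_mul_div, le_div_iff₀ (pow_pos (betaMin_pos hP) 2)]
    exact mul_le_mul_of_nonneg_left h3 (abs_nonneg _)
  have h6 := le_abs_self (Real.log C)
  calc quad (gram P n fun k => X k ω)⁻¹ (errVec P E.r n fun k => X k ω)
      ≤ 4 * (beta P n (fun k => X k ω) ^ 2 / P.R ^ 2) +
        4 * (|Real.log C| / betaMin P ^ 2 * beta P n (fun k => X k ω) ^ 2) := by linarith
    _ = _ := by ring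

end RewardEstimate

/-! ### The error of the transition frequencies, and a conditional Borel-Cantelli lemma -/

section TransitionEstimate

variable {S A : Type*} {h : ℕ} [Fintype S] [DecidableEq S] [Fintype A] [DecidableEq A]
  {P : Params S A} {E : Env S A h} {tb : TieBreak S A h E.p₀}

/-- Exponential tilting of the transition probabilities: multiplying the probability of a
trajectory by `exp (∑ f)` amounts to changing the dynamics to substochastic ones. -/
theorem Env.sum_trajProb_mul_exp_le (E : Env S A h) (f : S → A → S → ℝ)
    (hf : ∀ s a, ∑ s', E.p s a s' * Real.exp (f s a s') ≤ 1) (π : Policy S A h) :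
    ∑ τ, trajProb E.p₀ E.p π τ *
      Real.exp (∑ t : Fin h, f (τ.st t.castSucc) (τ.act t) (τ.st t.succ)) ≤ 1 := by
  refine le_trans (le_of_eq ?_) (sum_trajProb_le_one (p := fun s a s' => E.p s a s' *
    Real.exp (f s a s')) E.p₀_mem
    (fun s a s' => mul_nonneg ((E.p_mem s a).1 s') (Real.exp_pos _).le) hf π)
  refine Finset.sum_congr rfl fun τ _ => ?_
  rw [trajProb, trajProb, mul_assoc, Real.exp_sum, ← Finset.prod_mul_distrib]
  congr 1
  refine Finset.prod_congr rfl fun t _ => ?_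
  split_ifs
  · rfl
  · rw [zero_mul]

theorem sum_roundProb_mul_prod_le (hα : ∀ s a s', 0 < P.α s a s') (n : ℕ) (c : ℕ → Round S A h)
    (g : Traj S A h → ℝ) (hg0 : ∀ τ, 0 ≤ g τ)
    (hg : ∀ π, ∑ τ, trajProb E.p₀ E.p π τ * g τ ≤ 1) :
    ∑ d, roundProb E P tb n c d * ∏ j, g (d.traj j) ≤ 1 := by
  rw [sum_round, ← sum_prod_selectProb (tb := tb) hα n c]
  refine Finset.sum_le_sum fun pol _ => ?_
  have h1 : ∀ traj : Fin 2 → Traj S A h,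
      ∑ b, roundProb E P tb n c ⟨pol, traj, b⟩ * ∏ j, g (traj j) =
        ∏ j, selectProb P tb n c (pol j) * (trajProb E.p₀ E.p (pol j) (traj j) * g (traj j)) := by
    intro traj
    rw [← Finset.sum_mul]
    simp only [roundProb_eq]
    rw [← Finset.mul_sum, sum_prefProb, mul_one, pairProb, ← Finset.prod_mul_distrib]
    exact Finset.prod_congr rfl fun j _ => by ring
  simp_rw [h1]
  have h2 := Finset.prod_univ_sum (fun _ : Fin 2 => (Finset.univ : Finset (Traj S A h)))
    (fun j τ => selectProb P tb n c (pol j) * (trajProb E.p₀ E.p (pol j) τ * g τ))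
  rw [Fintype.piFinset_univ] at h2
  rw [← h2]
  simp_rw [← Finset.mul_sum]
  refine Finset.prod_le_prod (fun j _ => mul_nonneg (selectProb_nonneg _ _ _ _)
    (Finset.sum_nonneg fun τ _ => mul_nonneg (E.trajProb_nonneg _ _) (hg0 τ))) fun j _ => ?_
  exact mul_le_of_le_one_right (selectProb_nonneg _ _ _ _) (hg _)

/-- The deviation of the number of transitions `(s, a) → s'` from its compensator. -/
noncomputable def transDev (E : Env S A h) (s : S) (a : A) (s' : S) (n : ℕ)
    (c : ℕ → Round S A h) : ℝ :=
  transCount n c s a s' - E.p s a s' * visitCount n c (s, a)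

/-- The exponential supermartingale with parameter `u` for the deviation `transDev`. -/
noncomputable def transExp (E : Env S A h) (s : S) (a : A) (s' : S) (u : ℝ) (n : ℕ)
    (c : ℕ → Round S A h) : ℝ :=
  Real.exp (u * transDev E s a s' n c - u ^ 2 * visitCount n c (s, a))

theorem dependsOn_transDev (s : S) (a : A) (s' : S) (n : ℕ) :
    DependsOn (transDev E s a s' n) (Set.Iio n) := by
  intro c c' hc
  rw [transDev, transDev, dependsOn_transCount n hc, dependsOn_visitCount n hc]

theorem dependsOn_transExp (s : S) (a : A) (s' : S) (u : ℝ) (n : ℕ) :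
    DependsOn (transExp E s a s' u n) (Set.Iio n) := by
  intro c c' hc
  rw [transExp, transExp, dependsOn_transDev s a s' n hc, dependsOn_visitCount n hc]

theorem sum_roundProb_mul_transExp_le (hα : ∀ s a s', 0 < P.α s a s') (s : S) (a : A) (s' : S)
    (u : ℝ) (n : ℕ) (c : ℕ → Round S A h) :
    ∑ d, roundProb E P tb n c d * transExp E s a s' u (n + 1) (Function.update c n d) ≤
      transExp E s a s' u n c := by
  -- the exponent is a sum over the steps of the two trajectories, so that the exponential is an
  -- exponential tilting of the dynamics
  set f : S → A → S → ℝ := fun s₁ a₁ s₁' => if s₁ = s ∧ a₁ = a then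
    u * ((if s₁' = s' then 1 else 0) - E.p s a s') - u ^ 2 else 0 with hf
  have hf1 : ∀ s₁ a₁, ∑ s₁', E.p s₁ a₁ s₁' * Real.exp (f s₁ a₁ s₁') ≤ 1 := by
    intro s₁ a₁
    by_cases h1 : s₁ = s ∧ a₁ = a
    · obtain ⟨rfl, rfl⟩ := h1
      simp only [hf, and_self, if_true]
      have h01 := mem_Icc_of_mem_stdSimplex (E.p_mem s₁ a₁) s'
      refine sum_mul_exp_le _ _ (fun s₁' => (if s₁' = s' then 1 else 0) - E.p s₁ a₁ s') u
        (fun i _ => (E.p_mem s₁ a₁).1 i) (E.p_mem s₁ a₁).2 (fun i _ => ?_) ?_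
      · rw [abs_le]
        split_ifs <;> constructor <;> linarith [h01.1, h01.2]
      · simp only [mul_sub]
        rw [Finset.sum_sub_distrib, ← Finset.sum_mul, (E.p_mem s₁ a₁).2]
        simp
    · simp only [hf, if_neg h1, Real.exp_zero, mul_one]
      exact (E.p_mem s₁ a₁).2.le
  have hsum : ∀ τ : Traj S A h, ∑ t : Fin h, f (τ.st t.castSucc) (τ.act t) (τ.st t.succ) =
      u * (transitions τ s a s' - E.p s a s' * visits τ (s, a)) - u ^ 2 * visits τ (s, a) := by
    intro τ
    simp only [transitions, visits, Finset.mul_sum, ← Finset.sum_sub_distrib, hf, Prod.mk.injEq]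
    refine Finset.sum_congr rfl fun t _ => ?_
    by_cases h1 : τ.st t.castSucc = s ∧ τ.act t = a
    · simp [h1]
    · have h2 : ¬ (τ.st t.castSucc = s ∧ τ.act t = a ∧ τ.st t.succ = s') := by tauto
      simp [h1, h2]
  have hupd : ∀ d, ∀ k ∈ Set.Iio n, Function.update c n d k = c k := fun d k hk =>
    Function.update_of_ne (ne_of_lt hk) _ _
  have hFn : ∀ d, transExp E s a s' u (n + 1) (Function.update c n d) = transExp E s a s' u n c *
      ∏ j : Fin 2, Real.exp (∑ t : Fin h, f ((d.traj j).st t.castSucc) ((d.traj j).act t)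
        ((d.traj j).st t.succ)) := by
    intro d
    rw [← Real.exp_sum, transExp, transExp, ← Real.exp_add, transDev, transCount_succ,
      visitCount_succ, dependsOn_transCount n (hupd d), dependsOn_visitCount n (hupd d),
      Function.update_self, transDev]
    congr 1
    simp only [hsum, Fin.sum_univ_two]
    ring
  simp_rw [hFn]
  have h1 := sum_roundProb_mul_prod_le (E := E) (tb := tb) hα n c
    (fun τ => Real.exp (∑ t : Fin h, f (τ.st t.castSucc) (τ.act t) (τ.st t.succ)))
    (fun τ => (Real.exp_pos _).le) fun π => E.sum_trajProb_mul_exp_le f hf1 π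
  refine le_trans (le_of_eq ?_) (mul_le_of_le_one_right (Real.exp_pos _).le h1)
  rw [Finset.mul_sum]
  exact Finset.sum_congr rfl fun d _ => by rw [transExp]; ring

variable {Ω : Type*} [MeasurableSpace Ω] {μ : Measure Ω} {X : ℕ → Ω → Round S A h}

theorem summable_transExp (s : S) (a : A) (s' : S) (σ : ℝ) (hσ : |σ| ≤ 1) (n : ℕ)
    (c : ℕ → Round S A h) :
    Summable fun j : ℕ => (1 / 2 : ℝ) ^ j * transExp E s a s' (σ / (j + 1)) n c := by
  refine Summable.of_nonneg_of_le (fun j => mul_nonneg (by positivity) (Real.exp_pos _).le)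
    (fun j => ?_) (summable_geometric_two.mul_right (Real.exp |transDev E s a s' n c|))
  refine mul_le_mul_of_nonneg_left (Real.exp_le_exp.2 ?_) (by positivity)
  have h1 : |σ / (j + 1)| ≤ 1 := by
    rw [abs_div, abs_of_pos (by positivity : (0 : ℝ) < (j : ℝ) + 1), div_le_one (by positivity)]
    have : (0 : ℝ) ≤ j := j.cast_nonneg
    linarith
  have h2 : σ / (j + 1) * transDev E s a s' n c ≤ 1 * |transDev E s a s' n c| := by
    refine (le_abs_self _).trans ?_
    rw [abs_mul]
    gcongr
  have h3 := mul_nonneg (sq_nonneg (σ / (j + 1))) (visitCount_nonneg n c (s, a))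
  linarith

/-- The mixture `∑ 2⁻ʲ exp (…)` of exponential supermartingales gives a deviation bound that can
be optimized over the exponent afterwards. -/
theorem IsDPS.ae_transDev_le_of_sign [IsProbabilityMeasure μ] (hX : IsDPS μ E P tb X)
    (hα : ∀ s a s', 0 < P.α s a s') (s : S) (a : A) (s' : S) (σ : ℝ) (hσ : σ ^ 2 = 1) :
    ∀ᵐ ω ∂μ, ∃ C, ∀ (n i : ℕ), 1 ≤ i → σ * transDev E s a s' n (fun k => X k ω) ≤
      visitCount n (fun k => X k ω) (s, a) / i + C * i ^ 2 := by
  have hσ1 : |σ| ≤ 1 := (sq_le_one_iff_abs_le_one _).1 hσ.le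
  set F : ℕ → (ℕ → Round S A h) → ℝ := fun n c =>
    ∑' j : ℕ, (1 / 2 : ℝ) ^ j * transExp E s a s' (σ / (j + 1)) n c with hF
  have hs := fun n c => summable_transExp (E := E) s a s' σ hσ1 n c
  have hterm : ∀ n c (j : ℕ), 0 ≤ (1 / 2 : ℝ) ^ j * transExp E s a s' (σ / (j + 1)) n c :=
    fun n c j => mul_nonneg (by positivity) (Real.exp_pos _).le
  have hdep : ∀ n, DependsOn (F n) (Set.Iio n) := by
    intro n c c' hc
    simp only [hF]
    exact tsum_congr fun j => by rw [dependsOn_transExp s a s' _ n hc]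
  have hstep : ∀ n c, ∑ d, roundProb E P tb n c d * F (n + 1) (Function.update c n d) ≤
      F n c := by
    intro n c
    simp only [hF, ← tsum_mul_left]
    rw [← Summable.tsum_finsetSum fun d _ => (hs _ _).mul_left _]
    refine Summable.tsum_le_tsum (fun j => ?_)
      (summable_sum fun d _ => (hs _ _).mul_left _) (hs n c)
    have h1 := sum_roundProb_mul_transExp_le (E := E) (tb := tb) hα s a s' (σ / (j + 1)) n c
    refine le_trans (le_of_eq ?_) (mul_le_mul_of_nonneg_left h1 (by positivity))
    rw [Finset.mul_sum]
    exact Finset.sum_congr rfl fun d _ => by ring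
  filter_upwards [hX.ae_exists_bound hdep (fun n c => tsum_nonneg (hterm n c)) hstep]
    with ω ⟨C, hC⟩
  refine ⟨|Real.log C| + 1, fun n i hi => ?_⟩
  -- the term of the mixture with exponent `1 / i`
  obtain ⟨j, rfl⟩ := Nat.exists_eq_add_of_le' hi
  have h1 := ((hs n fun k => X k ω).le_tsum j fun i _ => hterm n _ i).trans (hC n)
  have h2 := Real.log_le_log (by have := Real.exp_pos; unfold transExp; positivity) h1
  rw [transExp, Real.log_mul (by positivity) (Real.exp_pos _).ne', Real.log_pow, Real.log_exp,
    one_div, Real.log_inv] at h2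
  have h3 : (0 : ℝ) < (j : ℝ) + 1 := by positivity
  have h4 : Real.log 2 ≤ 1 := by linarith [Real.log_two_lt_d9]
  have h5 : (j : ℝ) * Real.log 2 ≤ j := mul_le_of_le_one_right j.cast_nonneg h4
  have h6 := le_abs_self (Real.log C)
  push_cast
  set D := transDev E s a s' n fun k => X k ω
  set N := visitCount n (fun k => X k ω) (s, a)
  have h7 : σ / (j + 1) * D ≤ (σ / (j + 1)) ^ 2 * N + (|Real.log C| + j) := by linarith
  have h8 := mul_le_mul_of_nonneg_left h7 h3.le
  have h9 : ((j : ℝ) + 1) * (σ / (j + 1) * D) = σ * D := by field_simp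
  have h10 : ((j : ℝ) + 1) * ((σ / (j + 1)) ^ 2 * N + (|Real.log C| + j)) =
      N / (j + 1) + (j + 1) * (|Real.log C| + j) := by
    rw [div_pow, hσ]
    field_simp
  rw [h9, h10] at h8
  refine h8.trans (add_le_add_right ?_ _)
  have h11 := abs_nonneg (Real.log C)
  have h12 : (0 : ℝ) ≤ j := j.cast_nonneg
  nlinarith [mul_nonneg h11 h12, mul_nonneg (mul_nonneg h11 h12) h12]

/-- Almost surely, the empirical transition frequencies deviate from the transition probabilities
by at most `1 / i + C i² / N` for all `i`, where `N` is the number of visits. -/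
theorem IsDPS.ae_transDev_le [IsProbabilityMeasure μ] (hX : IsDPS μ E P tb X)
    (hα : ∀ s a s', 0 < P.α s a s') :
    ∀ᵐ ω ∂μ, ∃ C, 0 ≤ C ∧ ∀ (n i : ℕ) (s : S) (a : A) (s' : S), 1 ≤ i →
      |transDev E s a s' n (fun k => X k ω)| ≤
        visitCount n (fun k => X k ω) (s, a) / i + C * i ^ 2 := by
  have h1 : ∀ q : S × A × S, ∀ᵐ ω ∂μ, ∃ C, ∀ (n i : ℕ), 1 ≤ i →
      |transDev E q.1 q.2.1 q.2.2 n (fun k => X k ω)| ≤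
        visitCount n (fun k => X k ω) (q.1, q.2.1) / i + C * i ^ 2 := by
    intro q
    filter_upwards [hX.ae_transDev_le_of_sign hα q.1 q.2.1 q.2.2 1 (by norm_num),
      hX.ae_transDev_le_of_sign hα q.1 q.2.1 q.2.2 (-1) (by norm_num)] with ω ⟨C, hC⟩ ⟨C', hC'⟩
    refine ⟨max C C', fun n i hi => abs_le'.2 ⟨?_, ?_⟩⟩
    · have := hC n i hi
      rw [one_mul] at this
      refine this.trans ?_
      gcongr
      exact le_max_left _ _
    · have := hC' n i hi
      rw [neg_one_mul] at this
      refine this.trans ?_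
      gcongr
      exact le_max_right _ _
  filter_upwards [ae_all_iff.2 h1] with ω hω
  choose C hC using hω
  refine ⟨∑ q, |C q|, Finset.sum_nonneg fun q _ => abs_nonneg _, fun n i s a s' hi => ?_⟩
  refine (hC (s, a, s') n i hi).trans ?_
  gcongr
  exact (le_abs_self _).trans (Finset.single_le_sum (f := fun q => |C q|)
    (fun q _ => abs_nonneg _) (Finset.mem_univ (s, a, s')))

end TransitionEstimate

section Counting

variable {S A : Type*} {h : ℕ} [Fintype S] [DecidableEq S] [Fintype A] [DecidableEq A]
  {P : Params S A} {E : Env S A h} {tb : TieBreak S A h E.p₀}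
  {Ω : Type*} [MeasurableSpace Ω] {μ : Measure Ω} {X : ℕ → Ω → Round S A h}

/-- The conditional expectation of a function of the rounds up to `n`, given those before `n`. -/
noncomputable def condMean (E : Env S A h) (P : Params S A) (tb : TieBreak S A h E.p₀) (n : ℕ)
    (e : (ℕ → Round S A h) → ℝ) (c : ℕ → Round S A h) : ℝ :=
  ∑ d, roundProb E P tb n c d * e (Function.update c n d)

theorem dependsOn_condMean {n : ℕ} {e : (ℕ → Round S A h) → ℝ}
    (he : DependsOn e (Set.Iio (n + 1))) : DependsOn (condMean E P tb n e) (Set.Iio n) := by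
  intro c c' hc
  refine Finset.sum_congr rfl fun d _ => ?_
  rw [dependsOn_roundProb E tb n hc, he (y := Function.update c' n d)]
  intro k hk
  rcases eq_or_ne k n with rfl | hkn
  · simp
  · rw [Function.update_of_ne hkn, Function.update_of_ne hkn,
      hc k (lt_of_le_of_ne (Nat.lt_succ_iff.1 hk) hkn)]

/-- A conditional Borel-Cantelli lemma: the sum of the conditional probabilities of events is
controlled by the number of those that occur. -/
theorem IsDPS.ae_sum_condMean_le [IsProbabilityMeasure μ] (hX : IsDPS μ E P tb X)
    (hα : ∀ s a s', 0 < P.α s a s') {e : ℕ → (ℕ → Round S A h) → ℝ}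
    (he : ∀ n, DependsOn (e n) (Set.Iio (n + 1))) (he01 : ∀ n c, e n c = 0 ∨ e n c = 1) :
    ∀ᵐ ω ∂μ, ∃ C, ∀ n, ∑ m ∈ Finset.range n, condMean E P tb m (e m) (fun k => X k ω) ≤
      C + 2 * ∑ m ∈ Finset.range n, e m fun k => X k ω := by
  -- a supermartingale, since `E (exp (-e)) ≤ 1 - E e / 2 ≤ exp (-E e / 2)` for an indicator `e`
  set F : ℕ → (ℕ → Round S A h) → ℝ := fun n c =>
    Real.exp (∑ m ∈ Finset.range n, (condMean E P tb m (e m) c / 2 - e m c)) with hF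
  have hdep : ∀ n, DependsOn (F n) (Set.Iio n) := by
    intro n c c' hc
    simp only [hF]
    congr 1
    refine Finset.sum_congr rfl fun m hm => ?_
    have hm := Finset.mem_range.1 hm
    rw [dependsOn_condMean (he m) fun k hk => hc k ((Set.mem_Iio.1 hk).trans hm),
      he m fun k hk => hc k (lt_of_lt_of_le (Set.mem_Iio.1 hk) hm)]
  have hstep : ∀ n c, ∑ d, roundProb E P tb n c d * F (n + 1) (Function.update c n d) ≤
      F n c := by
    intro n c
    have hupd : ∀ d, ∀ k ∈ Set.Iio n, Function.update c n d k = c k := fun d k hk =>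
      Function.update_of_ne (ne_of_lt hk) _ _
    have hFn : ∀ d, F (n + 1) (Function.update c n d) = F n c *
        (Real.exp (condMean E P tb n (e n) c / 2) *
          Real.exp (-e n (Function.update c n d))) := by
      intro d
      rw [← Real.exp_add, ← hdep n (hupd d)]
      simp only [hF]
      rw [← Real.exp_add, Finset.sum_range_succ, dependsOn_condMean (he n) (hupd d)]
      ring_nf
    simp_rw [hFn]
    have h1 : ∑ d, roundProb E P tb n c d * Real.exp (-e n (Function.update c n d)) ≤
        Real.exp (-(condMean E P tb n (e n) c / 2)) := by
      calc ∑ d, roundProb E P tb n c d * Real.exp (-e n (Function.update c n d))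
          ≤ ∑ d, roundProb E P tb n c d * (1 - e n (Function.update c n d) / 2) := by
            refine Finset.sum_le_sum fun d _ => mul_le_mul_of_nonneg_left ?_ (roundProb_nonneg n c d)
            rcases he01 n (Function.update c n d) with h0 | h0 <;> rw [h0]
            · simp
            · have := Real.exp_neg_one_lt_d9
              norm_num
              linarith
        _ = 1 - condMean E P tb n (e n) c / 2 := by
            simp only [mul_sub, mul_one, Finset.sum_sub_distrib, sum_roundProb hα, condMean,
              Finset.sum_div, mul_div_assoc]
        _ ≤ _ := by
            have := Real.add_one_le_exp (-(condMean E P tb n (e n) c / 2))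
            linarith
    calc ∑ d, roundProb E P tb n c d * (F n c * (Real.exp (condMean E P tb n (e n) c / 2) *
          Real.exp (-e n (Function.update c n d))))
        = F n c * (Real.exp (condMean E P tb n (e n) c / 2) *
          ∑ d, roundProb E P tb n c d * Real.exp (-e n (Function.update c n d))) := by
          rw [Finset.mul_sum, Finset.mul_sum]
          exact Finset.sum_congr rfl fun d _ => by ring
      _ ≤ F n c * (Real.exp (condMean E P tb n (e n) c / 2) *
          Real.exp (-(condMean E P tb n (e n) c / 2))) := by
          have : 0 ≤ F n c := (Real.exp_pos _).le
          gcongr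
      _ = F n c := by rw [← Real.exp_add, add_neg_cancel, Real.exp_zero, mul_one]
  filter_upwards [hX.ae_exists_bound hdep (fun n c => (Real.exp_pos _).le) hstep] with ω ⟨C, hC⟩
  refine ⟨2 * Real.log C, fun n => ?_⟩
  have h1 := Real.log_le_log (Real.exp_pos _) (hC n)
  rw [Real.log_exp, Finset.sum_sub_distrib, ← Finset.sum_div] at h1
  linarith

end Counting

/-! ### Concentration and anti-concentration of the posteriors -/

section PosteriorEvents

variable {S A : Type*} {h : ℕ} [Fintype S] [DecidableEq S] [Fintype A] [DecidableEq A]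
  {P : Params S A} {E : Env S A h}

theorem Env.nonempty_state (E : Env S A h) : Nonempty S := by
  by_contra h0
  rw [not_nonempty_iff] at h0
  simpa using E.p₀_mem.2

/-- The path `c` satisfies the almost sure bounds for the estimates of utilities and dynamics. -/
structure RegularPath (E : Env S A h) (P : Params S A) (c : ℕ → Round S A h) : Prop where
  reward : ∃ K, ∀ n, quad (gram P n c) (rewMean P n c - E.r).ofLp ≤ K * beta P n c ^ 2
  trans : ∃ C, 0 ≤ C ∧ ∀ (n i : ℕ) (s : S) (a : A) (s' : S), 1 ≤ i →
    |transDev E s a s' n c| ≤ visitCount n c (s, a) / i + C * i ^ 2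

/-- The transition probabilities that are within `t / β` of the true ones at all state-action pairs
that have been visited more than `B β³` times. -/
def goodDyn (E : Env S A h) (P : Params S A) (t B : ℝ) (n : ℕ) (c : ℕ → Round S A h) :
    Set (Dyn S A) :=
  {p | ∀ s, p s ∈ {y : A → S → ℝ | ∀ a, y a ∈ {x : S → ℝ | x ∈ stdSimplex ℝ S ∧
    (B * beta P n c ^ 3 < visitCount n c (s, a) →
      ∀ s', |x s' - E.p s a s'| ≤ t / beta P n c)}}}

theorem measurableSet_goodDyn_aux (t B : ℝ) (n : ℕ) (c : ℕ → Round S A h) (s : S) (a : A) :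
    MeasurableSet {x : S → ℝ | x ∈ stdSimplex ℝ S ∧
      (B * beta P n c ^ 3 < visitCount n c (s, a) →
        ∀ s', |x s' - E.p s a s'| ≤ t / beta P n c)} := by
  refine (isClosed_stdSimplex ℝ S).measurableSet.inter ?_
  change MeasurableSet {x : S → ℝ | B * beta P n c ^ 3 < visitCount n c (s, a) →
    ∀ s', |x s' - E.p s a s'| ≤ t / beta P n c}
  rw [Set.ofPred_forall]
  refine MeasurableSet.iInter fun _ => ?_
  rw [Set.ofPred_forall]
  exact MeasurableSet.iInter fun s' => measurableSet_le (by fun_prop) measurable_const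

theorem measurableSet_forall_mem {ι : Type*} [Fintype ι] {α : ι → Type*}
    [∀ i, MeasurableSpace (α i)] {B : ∀ i, Set (α i)} (hB : ∀ i, MeasurableSet (B i)) :
    MeasurableSet {x : ∀ i, α i | ∀ i, x i ∈ B i} := by
  rw [Set.ofPred_forall]
  exact MeasurableSet.iInter fun i => measurable_pi_apply i (hB i)

theorem measurableSet_goodDyn (t B : ℝ) (n : ℕ) (c : ℕ → Round S A h) :
    MeasurableSet (goodDyn E P t B n c) :=
  measurableSet_forall_mem fun s => measurableSet_forall_mem fun a =>
    measurableSet_goodDyn_aux t B n c s a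

/-- The posterior mean of the transition probabilities is accurate for pairs with many visits. -/
theorem abs_dirichlet_mean_sub_le (hP : P.Good) (hα : ∀ s a s', 0 < P.α s a s')
    {c : ℕ → Round S A h} {C : ℝ} (hC0 : 0 ≤ C)
    (hC : ∀ (n i : ℕ) (s : S) (a : A) (s' : S), 1 ≤ i →
      |transDev E s a s' n c| ≤ visitCount n c (s, a) / i + C * i ^ 2)
    {t : ℝ} (ht : 0 < t) (ht1 : t ≤ betaMin P) {B : ℝ} (s : S) (a : A)
    (hB1 : 648 * C / t ^ 3 ≤ B) (hB2 : 8 * (∑ s', P.α s a s') / (t * betaMin P ^ 2) ≤ B)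
    (hB0 : 0 < B) (n : ℕ) (hN : B * beta P n c ^ 3 < visitCount n c (s, a)) (s' : S) :
    |(P.α s a s' + transCount n c s a s') / ∑ k, (P.α s a k + transCount n c s a k) - E.p s a s'| ≤
      t / beta P n c / 2 := by
  set β := beta P n c with hβ
  set N := visitCount n c (s, a) with hNd
  set α := ∑ k, P.α s a k with hαd
  have hb0 := betaMin_pos hP
  have hβ0 : betaMin P ≤ β := betaMin_le hP n c
  have hβpos : 0 < β := beta_pos hP n c
  have hN0 : 0 < N := lt_trans (by positivity) hN
  have hα0 : 0 ≤ α := Finset.sum_nonneg fun k _ => (hα s a k).le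
  have hp := mem_Icc_of_mem_stdSimplex (E.p_mem s a) s'
  rw [Finset.sum_add_distrib, sum_transCount, ← hαd, ← hNd]
  have hA : 0 < α + N := by linarith
  -- with `i` of the order of `β / t`, the error `1 / i + C i ^ 2 / N` is small compared to `t / β`
  -- as soon as `N` is large compared to `β ^ 3`
  set i := ⌈8 * β / t⌉₊ with hi
  have hi0 : 0 < 8 * β / t := by positivity
  have hi1 : 1 ≤ i := Nat.one_le_iff_ne_zero.2 (Nat.ceil_pos.2 hi0).ne'
  have hi2 : 8 * β / t ≤ i := Nat.le_ceil _
  have hi3 : (i : ℝ) ≤ 9 * β / t := by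
    have h1 := (Nat.ceil_lt_add_one hi0.le).le
    have h2 : 1 ≤ β / t := (one_le_div ht).2 (ht1.trans hβ0)
    calc (i : ℝ) ≤ 8 * β / t + 1 := h1
      _ ≤ 8 * β / t + β / t := by linarith
      _ = 9 * β / t := by ring
  have hdev := hC n i s a s' hi1
  have hkey : |P.α s a s' + transCount n c s a s' - (α + N) * E.p s a s'| ≤
      α + (N / i + C * i ^ 2) := by
    have h1 : P.α s a s' + transCount n c s a s' - (α + N) * E.p s a s' =
        (P.α s a s' - α * E.p s a s') + transDev E s a s' n c := by
      rw [transDev]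
      ring
    rw [h1]
    refine (abs_add_le _ _).trans (add_le_add ?_ hdev)
    have h2 : P.α s a s' ≤ α :=
      Finset.single_le_sum (fun k _ => (hα s a k).le) (Finset.mem_univ s')
    rw [abs_le]
    constructor <;> nlinarith [hp.1, hp.2, (hα s a s').le]
  rw [div_sub' hA.ne', abs_div, abs_of_pos hA, div_le_iff₀ hA]
  refine hkey.trans ?_
  have e1 : α ≤ t / β / 8 * N := by
    rw [div_le_iff₀ (by positivity)] at hB2
    have h1 : 8 * α ≤ B * (t * β ^ 2) := hB2.trans (by gcongr)
    have h2 : B * (t * β ^ 2) = t / β * (B * β ^ 3) := by field_simp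
    have h3 : t / β * (B * β ^ 3) ≤ t / β * N := by gcongr
    linarith
  have e2 : N / i ≤ t / β / 8 * N := by
    rw [div_le_iff₀ (by exact_mod_cast hi1)]
    have h1 : t / β / 8 * (8 * β / t) = 1 := by field_simp
    have h2 : t / β / 8 * (8 * β / t) ≤ t / β / 8 * i := by gcongr
    nlinarith
  have e3 : C * i ^ 2 ≤ t / β / 8 * N := by
    rw [div_le_iff₀ (by positivity)] at hB1
    calc C * (i : ℝ) ^ 2 ≤ C * (9 * β / t) ^ 2 := by gcongr
      _ = (648 * C) * (β ^ 2 / (8 * t ^ 2)) := by ring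
      _ ≤ (B * t ^ 3) * (β ^ 2 / (8 * t ^ 2)) := by gcongr
      _ = t / β / 8 * (B * β ^ 3) := by field_simp
      _ ≤ _ := by gcongr
  have e4 : 0 ≤ t / β * N := by positivity
  have e5 : 0 ≤ t / β / 2 * α := by positivity
  linarith

/-- The posterior of the dynamics concentrates on `goodDyn`. -/
theorem RegularPath.exists_le_dynPosterior (hP : P.Good) (hα : ∀ s a s', 0 < P.α s a s')
    {c : ℕ → Round S A h} (hc : RegularPath E P c) {t ε : ℝ} (ht : 0 < t) (hε : 0 < ε) :
    ∃ B₀ : ℝ, 0 < B₀ ∧ ∀ B, B₀ ≤ B → ∀ n, 1 - ε ≤ (dynPosterior P n c).real (goodDyn E P t B n c) := by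
  have := E.nonempty_state
  obtain ⟨C, hC0, hC⟩ := hc.trans
  have hb0 := betaMin_pos hP
  -- shrinking `t` makes the event smaller
  set t' := min t (betaMin P) with ht'
  have ht'0 : 0 < t' := lt_min ht hb0
  set m : ℝ := 1 + Fintype.card S with hm
  have hm0 : 0 < m := by positivity
  set d : ℝ := 1 + Fintype.card (S × A) with hd
  have hd0 : 0 < d := by positivity
  set αs := ∑ s, ∑ a, ∑ s', P.α s a s' with hαs
  -- the first two terms make the posterior mean accurate, the third one the posterior concentrated
  set B₀ := 648 * C / t' ^ 3 + 8 * αs / (t' * betaMin P ^ 2) +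
    16 * m ^ 2 * d / (ε * (betaMin P * t' ^ 2)) with hB₀
  have hαs0 : 0 ≤ αs := Finset.sum_nonneg fun s _ => Finset.sum_nonneg fun a _ =>
    Finset.sum_nonneg fun s' _ => (hα s a s').le
  have q1 : 0 ≤ 648 * C / t' ^ 3 := by positivity
  have q2 : 0 ≤ 8 * αs / (t' * betaMin P ^ 2) := by positivity
  have q3 : 0 < 16 * m ^ 2 * d / (ε * (betaMin P * t' ^ 2)) := by positivity
  refine ⟨B₀, by linarith, fun B hB n => ?_⟩
  have hB0 : 0 < B := by linarith
  have hβ0 : betaMin P ≤ beta P n c := betaMin_le hP n c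
  have hβpos : 0 < beta P n c := beta_pos hP n c
  have hprob := fun s a => isProbabilityMeasure_dirichlet (dirichletParam_pos hα n c s a)
  have hone : ∀ s a, 1 - ε / d ≤ (dirichlet fun s' => P.α s a s' + transCount n c s a s').real
      {x : S → ℝ | x ∈ stdSimplex ℝ S ∧ (B * beta P n c ^ 3 < visitCount n c (s, a) →
        ∀ s', |x s' - E.p s a s'| ≤ t / beta P n c)} := by
    intro s a
    have hsimp := dirichlet_ae_simplex (dirichletParam_pos hα n c s a)
    have hεd : 0 < ε / d := by positivity
    by_cases h0 : B * beta P n c ^ 3 < visitCount n c (s, a)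
    · have hu : 0 < t' / (4 * m * beta P n c) := by positivity
      have hu1 : Fintype.card S * (t' / (4 * m * beta P n c)) ≤ 1 / 2 := by
        rw [mul_div_assoc', div_le_iff₀ (by positivity)]
        have h1 : t' ≤ beta P n c := (min_le_right _ _).trans hβ0
        have h2 : (Fintype.card S : ℝ) ≤ m := by rw [hm]; linarith
        calc (Fintype.card S : ℝ) * t' ≤ m * beta P n c := by gcongr
          _ ≤ 1 / 2 * (4 * m * beta P n c) := by nlinarith [mul_pos hm0 hβpos]
      have h1 := le_dirichlet (dirichletParam_pos hα n c s a) hu hu1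
      have hA : B * beta P n c ^ 3 ≤ ∑ k, (P.α s a k + transCount n c s a k) := by
        rw [Finset.sum_add_distrib, sum_transCount]
        have : 0 ≤ ∑ k, P.α s a k := Finset.sum_nonneg fun k _ => (hα s a k).le
        linarith
      have hA0 : 0 < B * beta P n c ^ 3 := by positivity
      have h2 : 1 / ((∑ k, (P.α s a k + transCount n c s a k)) *
          (t' / (4 * m * beta P n c)) ^ 2) ≤ ε / d := by
        calc 1 / ((∑ k, (P.α s a k + transCount n c s a k)) * (t' / (4 * m * beta P n c)) ^ 2)
            ≤ 1 / ((B * beta P n c ^ 3) * (t' / (4 * m * beta P n c)) ^ 2) := by gcongr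
          _ = 16 * m ^ 2 / (B * (beta P n c * t' ^ 2)) := by
              field_simp
              ring
          _ ≤ 16 * m ^ 2 / (B * (betaMin P * t' ^ 2)) := by gcongr
          _ ≤ ε / d := by
              rw [div_le_div_iff₀ (by positivity) hd0]
              have h3 : 16 * m ^ 2 * d / (ε * (betaMin P * t' ^ 2)) ≤ B := by linarith
              rw [div_le_iff₀ (by positivity)] at h3
              linarith
      refine le_trans (by linarith) (h1.trans
        (ENNReal.toReal_mono (measure_ne_top _ _) (measure_mono_ae ?_)))
      filter_upwards [hsimp] with x hx hx2
      refine ⟨hx, fun _ s' => ?_⟩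
      have hαsa : ∑ s', P.α s a s' ≤ αs := by
        refine (Finset.single_le_sum (f := fun a => ∑ s', P.α s a s') (fun a _ =>
          Finset.sum_nonneg fun s' _ => (hα s a s').le) (Finset.mem_univ a)).trans ?_
        exact Finset.single_le_sum (f := fun s => ∑ a, ∑ s', P.α s a s') (fun s _ =>
          Finset.sum_nonneg fun a _ => Finset.sum_nonneg fun s' _ => (hα s a s').le)
          (Finset.mem_univ s)
      have h4 := abs_dirichlet_mean_sub_le hP hα hC0 hC ht'0 (min_le_right _ _) s a
        (by linarith) (le_trans (by gcongr) (by linarith :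
          8 * αs / (t' * betaMin P ^ 2) ≤ B)) hB0 n h0 s'
      have h5 : |x s' - (P.α s a s' + transCount n c s a s') /
          ∑ k, (P.α s a k + transCount n c s a k)| ≤ t' / beta P n c / 2 := by
        refine (hx2 s').trans (le_of_eq ?_)
        rw [← hm]
        field_simp
        ring
      calc |x s' - E.p s a s'| ≤ t' / beta P n c / 2 + t' / beta P n c / 2 :=
            (abs_sub_le _ _ _).trans (add_le_add h5 h4)
        _ = t' / beta P n c := by ring
        _ ≤ t / beta P n c := by
            gcongr
            exact min_le_left _ _
    · refine le_trans (by linarith : 1 - ε / d ≤ 1) ?_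
      rw [← probReal_univ (μ := dirichlet fun s' => P.α s a s' + transCount n c s a s')]
      refine ENNReal.toReal_mono (measure_ne_top _ _) (measure_mono_ae ?_)
      filter_upwards [hsimp] with x hx _
      exact ⟨hx, fun h1 => absurd h1 h0⟩
  rw [dynPosterior_eq, goodDyn]
  refine le_trans ?_ (le_pi_real _ _ fun s => measurableSet_forall_mem fun a =>
    measurableSet_goodDyn_aux t B n c s a)
  have hsum : ∑ s, (1 - (Measure.pi fun a => dirichlet fun s' =>
      P.α s a s' + transCount n c s a s').real {y : A → S → ℝ | ∀ a, y a ∈ {x : S → ℝ |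
        x ∈ stdSimplex ℝ S ∧ (B * beta P n c ^ 3 < visitCount n c (s, a) →
          ∀ s', |x s' - E.p s a s'| ≤ t / beta P n c)}}) ≤ ∑ s : S, ∑ a : A, ε / d := by
    refine Finset.sum_le_sum fun s _ => ?_
    have h1 := le_pi_real (fun a => dirichlet fun s' => P.α s a s' + transCount n c s a s') _
      fun a => measurableSet_goodDyn_aux (E := E) (P := P) t B n c s a
    have h2 : ∑ a, (1 - (dirichlet fun s' => P.α s a s' + transCount n c s a s').real
        {x : S → ℝ | x ∈ stdSimplex ℝ S ∧ (B * beta P n c ^ 3 < visitCount n c (s, a) →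
          ∀ s', |x s' - E.p s a s'| ≤ t / beta P n c)}) ≤ ∑ a : A, ε / d :=
      Finset.sum_le_sum fun a _ => by linarith [hone s a]
    linarith
  have hfin : ∑ s : S, ∑ a : A, ε / d ≤ ε := by
    simp only [Finset.sum_const, Finset.card_univ, nsmul_eq_mul]
    rw [← mul_assoc, mul_div_assoc', div_le_iff₀ hd0, hd, Fintype.card_prod]
    push_cast
    nlinarith
  linarith

end PosteriorEvents

section RewardEvents

variable {S A : Type*} {h : ℕ} [Fintype S] [DecidableEq S] [Fintype A] [DecidableEq A]
  {P : Params S A} {E : Env S A h}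

theorem norm_sq_le_quad_gram (hlam : 1 ≤ P.lam) (n : ℕ) (c : ℕ → Round S A h) (v : Rew S A) :
    ‖v‖ ^ 2 ≤ quad (gram P n c) v.ofLp := by
  have h1 : ‖v‖ ^ 2 = v.ofLp ⬝ᵥ v.ofLp := by
    rw [EuclideanSpace.real_norm_sq_eq]
    simp [dotProduct, sq]
  have h2 : 0 ≤ ∑ k ∈ Finset.range n, ((c k).x ⬝ᵥ v.ofLp) ^ 2 :=
    Finset.sum_nonneg fun _ _ => sq_nonneg _
  rw [quad_gram, ← h1]
  nlinarith [sq_nonneg ‖v‖]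

theorem measurableSet_quad_le (M : Matrix (S × A) (S × A) ℝ) (y : Rew S A) (b : ℝ) :
    MeasurableSet {x : Rew S A | quad M (x - y).ofLp ≤ b} := by
  unfold quad
  refine measurableSet_le (Continuous.measurable ?_) measurable_const
  fun_prop

/-- The posterior of the rewards concentrates on an ellipsoid of radius of the order of `β`
around the true utilities. -/
theorem RegularPath.exists_le_rewPosterior (hP : P.Good)
    {c : ℕ → Round S A h} (hc : RegularPath E P c) {ε : ℝ} (hε : 0 < ε) :
    ∃ K : ℝ, 0 ≤ K ∧ ∀ n, 1 - ε ≤ (rewPosterior P n c).real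
      {x | quad (gram P n c) (x - E.r).ofLp ≤ K * beta P n c ^ 2} := by
  obtain ⟨K, hK⟩ := hc.reward
  obtain ⟨k, hk⟩ := exists_stdGaussian_closedBall_ge (ι := S × A) hε
  refine ⟨2 * k ^ 2 + 2 * |K|, by positivity, fun n => ?_⟩
  have hM := gram_posDef hP.lam_pos n c
  have hβ := beta_pos hP n c
  obtain ⟨ξ₀, h1, h2⟩ := multivariateGaussian_ball hM hβ (rewMean P n c) (rewMean P n c)
  have h3 : ξ₀ = 0 := by
    rw [sub_self] at h1
    simpa [quad, hβ.ne'] using h1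
  rw [h3] at h2
  refine hk.trans ((h2 k k.cast_nonneg).symm.le.trans (measureReal_mono fun x hx => ?_))
  simp only [Set.mem_ofPred_eq] at hx ⊢
  have h4 : (x - E.r).ofLp = (x - rewMean P n c).ofLp + (rewMean P n c - E.r).ofLp := by
    rw [← WithLp.ofLp_add, sub_add_sub_cancel]
  rw [h4]
  refine (quad_add_le hM _ _).trans ?_
  have h5 := hK n
  have h6 : K * beta P n c ^ 2 ≤ |K| * beta P n c ^ 2 := by
    gcongr
    exact le_abs_self K
  linarith

/-- Every target `y` whose distance from the true utilities is not too large in the metric of the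
Gram matrix is approximated by the sampled rewards with a probability that is at least exponential
in `-β`. -/
theorem RegularPath.exists_le_rewPosterior_ball (hP : P.Good)
    {c : ℕ → Round S A h} (hc : RegularPath E P c) (U : ℝ) :
    ∃ k : ℕ, ∀ n (y : Rew S A),
      quad (gram P n c) (y - E.r).ofLp ≤ U * (1 + beta P n c) * beta P n c ^ 2 →
      Real.exp (-k * (1 + beta P n c)) ≤
        (rewPosterior P n c).real {x | quad (gram P n c) (x - y).ofLp ≤ 1} := by
  obtain ⟨K, hK⟩ := hc.reward
  set b₀ := min 1 (betaMin P) with hb₀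
  have hb₀0 : 0 < b₀ := lt_min one_pos (betaMin_pos hP)
  obtain ⟨D, hD⟩ : ∃ D : ℝ, D = Fintype.card (S × A) := ⟨_, rfl⟩
  have hD0 : 0 ≤ D := hD ▸ Nat.cast_nonneg _
  set L := Real.log (3 * (D + 1) / b₀) with hL
  obtain ⟨k, hk⟩ := exists_nat_ge (D * (|L| + 1 + 2 * U + 2 * |K| + 1))
  refine ⟨k, fun n y hy => ?_⟩
  have hM := gram_posDef hP.lam_pos n c
  have hβ := beta_pos hP n c
  have hβ0 := betaMin_le hP n c
  set β := beta P n c with hβd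
  obtain ⟨ξ₀, h1, h2⟩ := multivariateGaussian_ball hM hβ (rewMean P n c) y
  have h3 : ‖ξ₀‖ ^ 2 ≤ 2 * U * (1 + β) + 2 * |K| := by
    have h4 : (y - rewMean P n c).ofLp = (y - E.r).ofLp + (-1 : ℝ) • (rewMean P n c - E.r).ofLp := by
      rw [← WithLp.ofLp_smul, ← WithLp.ofLp_add]
      congr 1
      module
    rw [h4] at h1
    have h5 := quad_add_le hM (y - E.r).ofLp ((-1 : ℝ) • (rewMean P n c - E.r).ofLp)
    rw [quad_smul] at h5
    have h6 := hK n
    have h7 : K * β ^ 2 ≤ |K| * β ^ 2 := by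
      gcongr
      exact le_abs_self K
    have h8 : β ^ 2 * ‖ξ₀‖ ^ 2 ≤ β ^ 2 * (2 * U * (1 + β) + 2 * |K|) := by
      rw [h1]
      linarith
    exact le_of_mul_le_mul_left h8 (by positivity)
  have hρ0 : 0 ≤ b₀ / β := by positivity
  have hρ1 : b₀ / β ≤ 1 := by
    rw [div_le_one hβ]
    exact (min_le_right _ _).trans hβ0
  have h9 := le_stdGaussian_closedBall ξ₀ hρ0 hρ1 le_rfl
  rw [← h2 _ hρ0, ← hD] at h9
  -- the bound is Gaussian in `‖ξ₀‖`, whose square is of the order of `1 + β` only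
  refine le_trans ?_ (h9.trans (measureReal_mono fun x hx => ?_))
  · have h10 : Real.exp (-(|L| + 1 + 2 * U + 2 * |K| + 1) * (1 + β)) ≤
        b₀ / β / (3 * (D + 1)) * Real.exp (-(‖ξ₀‖ + 1) ^ 2 / 2) := by
      have h11 : b₀ / β / (3 * (D + 1)) = Real.exp (-(L + Real.log β)) := by
        rw [hL, ← Real.log_mul (by positivity) hβ.ne', Real.exp_neg,
          Real.exp_log (by positivity)]
        field_simp
      rw [h11, ← Real.exp_add, Real.exp_le_exp]
      have h12 : Real.log β ≤ β := (Real.log_le_sub_one_of_pos hβ).trans (by linarith)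
      have h13 : (‖ξ₀‖ + 1) ^ 2 / 2 ≤ ‖ξ₀‖ ^ 2 + 1 := by nlinarith [sq_nonneg (‖ξ₀‖ - 1)]
      have h14 := le_abs_self L
      have h15 := mul_nonneg (abs_nonneg L) hβ.le
      have h16 := mul_nonneg (abs_nonneg K) hβ.le
      nlinarith
    calc Real.exp (-k * (1 + β))
        ≤ Real.exp (D * (-(|L| + 1 + 2 * U + 2 * |K| + 1) * (1 + β))) := by
          rw [Real.exp_le_exp]
          have : 0 ≤ 1 + β := by linarith
          nlinarith
      _ = Real.exp (-(|L| + 1 + 2 * U + 2 * |K| + 1) * (1 + β)) ^ Fintype.card (S × A) := by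
          rw [hD, ← Real.exp_nat_mul]
      _ ≤ _ := pow_le_pow_left₀ (Real.exp_pos _).le h10 _
  · refine le_trans (Set.mem_ofPred_eq ▸ hx) ?_
    rw [← mul_pow, mul_div_cancel₀ _ hβ.ne']
    exact pow_le_one₀ hb₀0.le (min_le_left _ _)

end RewardEvents

/-! ### Informed histories select optimal policies -/

section Optimality

variable {S A : Type*} {h : ℕ} [Fintype S] [DecidableEq S] [Fintype A] [DecidableEq A]
  {P : Params S A} {E : Env S A h} {tb : TieBreak S A h E.p₀}

theorem exists_pos_le_of_pos {ι : Type*} [Fintype ι] (f : ι → ℝ) :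
    ∃ Δ, 0 < Δ ∧ ∀ i, 0 < f i → Δ ≤ f i := by
  classical
  by_cases h0 : (Finset.univ.filter fun i => 0 < f i).Nonempty
  · obtain ⟨i, hi, hmin⟩ := Finset.exists_min_image _ f h0
    exact ⟨f i, by simpa using hi, fun j hj => hmin j (by simpa using hj)⟩
  · refine ⟨1, one_pos, fun i hi => absurd ⟨i, by simpa using hi⟩ h0⟩

theorem exists_forall_value_le [Nonempty A] (p₀ : S → ℝ) (p : Dyn S A) (r : Rew S A) :
    ∃ π : Policy S A h, IsOptimal p₀ p r π :=
  Finite.exists_max (value p₀ p r)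

/-- A history is uninformed if some state-action pair that can be reached has been visited
rarely, or if the value differences of some utility vector `v` are not small although `v` is small
in the metric of the Gram matrix. -/
def Uninformed (E : Env S A h) (P : Params S A) (B e : ℝ) (n : ℕ) (c : ℕ → Round S A h) : Prop :=
  (∃ (π : Policy S A h) (τ : Traj S A h) (t : Fin h), 0 < trajProb E.p₀ E.p π τ ∧
    visitCount n c (τ.st t.castSucc, τ.act t) ≤ B * beta P n c ^ 3) ∨
  ∃ (v : Rew S A) (π π' : Policy S A h),
    1 ≤ value E.p₀ E.p v π - value E.p₀ E.p v π' ∧ quad (gram P n c) v.ofLp ≤ (beta P n c / e) ^ 2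

theorem mem_goodDyn {t B : ℝ} {n : ℕ} {c : ℕ → Round S A h} {p : Dyn S A}
    (hp : p ∈ goodDyn E P t B n c) (s : S) (a : A) : p s a ∈ stdSimplex ℝ S ∧
      (B * beta P n c ^ 3 < visitCount n c (s, a) →
        ∀ s', |p s a s' - E.p s a s'| ≤ t / beta P n c) := hp s a

/-- Dynamics from `goodDyn` evaluate policies correctly that avoid rarely visited pairs. -/
theorem abs_value_sub_le_of_mem_goodDyn (hP : P.Good) {t B : ℝ} (ht : 0 ≤ t) {n : ℕ}
    {c : ℕ → Round S A h} {p : Dyn S A} (hp : p ∈ goodDyn E P t B n c) (x : Rew S A)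
    (π : Policy S A h) (hπ : ∀ τ : Traj S A h, 0 < trajProb E.p₀ E.p π τ → ∀ t : Fin h,
      B * beta P n c ^ 3 < visitCount n c (τ.st t.castSucc, τ.act t)) :
    |value E.p₀ p x π - value E.p₀ E.p x π| ≤
      2 * (Fintype.card (Traj S A h) * (h * (t / beta P n c))) * (h * ‖x‖) :=
  abs_value_sub_le E.p₀_mem E.p_mem (fun s a => (mem_goodDyn hp s a).1) x π
    (div_nonneg ht (beta_pos hP n c).le)
    fun τ hτ i s' => (mem_goodDyn hp _ _).2 (hπ τ hτ i) s'

theorem norm_le_of_quad_gram_le (hlam : 1 ≤ P.lam) {n : ℕ} {c : ℕ → Round S A h} {v : Rew S A}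
    {b : ℝ} (hb : 0 ≤ b) (hv : quad (gram P n c) v.ofLp ≤ b ^ 2) : ‖v‖ ≤ b :=
  abs_le_of_sq_le_sq' ((norm_sq_le_quad_gram hlam n c v).trans hv) hb |>.2

/-- An informed history selects an optimal policy with high probability. -/
theorem RegularPath.exists_le_optimalProb [Nonempty A] (hP : P.Good)
    (hα : ∀ s a s', 0 < P.α s a s') {c : ℕ → Round S A h} (hc : RegularPath E P c) {ε : ℝ}
    (hε : 0 < ε) : ∃ e B₀ : ℝ, 0 < e ∧ 0 < B₀ ∧ ∀ B, B₀ ≤ B → ∀ n, ¬ Uninformed E P B e n c →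
      1 - ε ≤ optimalProb E P tb n c := by
  classical
  obtain ⟨πo, hπo⟩ := exists_forall_value_le (h := h) E.p₀ E.p E.r
  obtain ⟨Δ, hΔ, hgap⟩ := exists_pos_le_of_pos fun π : Policy S A h =>
    value E.p₀ E.p E.r πo - value E.p₀ E.p E.r π
  obtain ⟨K', hK'0, hK'⟩ := hc.exists_le_rewPosterior hP (half_pos hε)
  obtain ⟨k, hk0, hk⟩ : ∃ k : ℝ, 0 < k ∧ K' ≤ k ^ 2 :=
    ⟨K' + 1, by linarith, by nlinarith⟩
  have hb0 := betaMin_pos hP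
  set m : ℝ := 2 * Fintype.card (Traj S A h) * h * h * (‖E.r‖ / betaMin P + k) with hm
  have hm0 : 0 ≤ m := by positivity
  -- the norm of sampled utilities is of the order of `β`, which the error `t / β` of the sampled
  -- dynamics makes up for
  set t := Δ / (4 * (m + 1)) with ht
  have ht0 : 0 < t := by positivity
  obtain ⟨B₀, hB₀, hdyn⟩ := hc.exists_le_dynPosterior hP hα ht0 (half_pos hε)
  refine ⟨Δ / (2 * k), B₀, by positivity, hB₀, fun B hB n hinf => ?_⟩
  have hβ := beta_pos hP n c
  have hβ0 := betaMin_le hP n c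
  set β := beta P n c with hβd
  simp only [Uninformed, not_or, not_exists, not_and, not_le] at hinf
  obtain ⟨hvis, hval⟩ := hinf
  have hsel := le_sum_selectProb hα tb n c (measurableSet_goodDyn (E := E) (P := P) t B n c)
    (measurableSet_quad_le (gram P n c) E.r (k ^ 2 * β ^ 2))
    (Finset.univ.filter fun π => IsOptimal E.p₀ E.p E.r π) ?_
  · refine le_trans ?_ hsel
    have := isProbabilityMeasure_dynPosterior hα n c
    have h1 := hdyn B hB n
    have h2 : 1 - ε / 2 ≤ (rewPosterior P n c).real
        {x | quad (gram P n c) (x - E.r).ofLp ≤ k ^ 2 * β ^ 2} :=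
      (hK' n).trans (measureReal_mono fun x hx => by
        simp only [Set.mem_ofPred_eq] at hx ⊢
        exact hx.trans (by gcongr))
    have h3 : (dynPosterior P n c).real (goodDyn E P t B n c) ≤ 1 := measureReal_le_one
    have h4 : (rewPosterior P n c).real
        {x | quad (gram P n c) (x - E.r).ofLp ≤ k ^ 2 * β ^ 2} ≤ 1 := measureReal_le_one
    nlinarith
  · intro p hp x hx π hπ
    rw [Finset.mem_filter]
    refine ⟨Finset.mem_univ _, ?_⟩
    by_contra hno
    have hpos : 0 < value E.p₀ E.p E.r πo - value E.p₀ E.p E.r π := by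
      by_contra hle
      exact hno fun π' => (hπo π').trans (by linarith)
    have h1 := hgap π hpos
    have hx' : quad (gram P n c) (x - E.r).ofLp ≤ (k * β) ^ 2 := by rw [mul_pow]; exact hx
    have hnorm : ‖x‖ ≤ (‖E.r‖ / betaMin P + k) * β := by
      have h2 := norm_le_of_quad_gram_le hP.one_le_lam (by positivity) hx'
      have h3 : ‖x‖ ≤ ‖E.r‖ + ‖x - E.r‖ := by
        simpa using norm_add_le E.r (x - E.r)
      have h4 : ‖E.r‖ ≤ ‖E.r‖ / betaMin P * β := by
        rw [div_mul_eq_mul_div, le_div_iff₀ hb0]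
        gcongr
      linarith
    have hsim : ∀ π' : Policy S A h, |value E.p₀ p x π' - value E.p₀ E.p x π'| ≤ Δ / 4 := by
      intro π'
      refine (abs_value_sub_le_of_mem_goodDyn hP ht0.le hp x π'
        fun τ hτ i => hvis π' τ i hτ).trans ?_
      rw [← hβd]
      calc 2 * (Fintype.card (Traj S A h) * (h * (t / β))) * (h * ‖x‖)
          ≤ 2 * (Fintype.card (Traj S A h) * (h * (t / β))) *
              (h * ((‖E.r‖ / betaMin P + k) * β)) := by gcongr
        _ = m * t := by
            rw [hm]
            field_simp
        _ ≤ (m + 1) * t := by nlinarith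
        _ = Δ / 4 := by
            rw [ht]
            field_simp
    have h5 := abs_le.1 (hsim π)
    have h6 := abs_le.1 (hsim πo)
    have h7 := hπ πo
    have hsplit : ∀ π' : Policy S A h, value E.p₀ E.p x π' =
        value E.p₀ E.p E.r π' + value E.p₀ E.p (x - E.r) π' := by
      intro π'
      rw [← value_add, add_sub_cancel]
    -- the scaled error of the utilities would witness an uninformed history
    have h8 := hval ((Δ / 2)⁻¹ • (x - E.r)) π πo
    rw [value_smul, value_smul, WithLp.ofLp_smul, quad_smul, ← hβd] at h8
    have h9 : value E.p₀ E.p (x - E.r) π - value E.p₀ E.p (x - E.r) πo < Δ / 2 := by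
      by_contra hle
      rw [not_lt] at hle
      have h10 : 1 ≤ (Δ / 2)⁻¹ * value E.p₀ E.p (x - E.r) π -
          (Δ / 2)⁻¹ * value E.p₀ E.p (x - E.r) πo := by
        rw [← mul_sub, inv_mul_eq_div, one_le_div (by positivity)]
        exact hle
      refine absurd (h8 h10) (not_lt.2 ?_)
      calc (Δ / 2)⁻¹ ^ 2 * quad (gram P n c) (x - E.r).ofLp ≤ (Δ / 2)⁻¹ ^ 2 * (k * β) ^ 2 := by
            gcongr
        _ = (β / (Δ / (2 * k))) ^ 2 := by
            field_simp
    rw [hsplit] at h5 h6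
    linarith

end Optimality

/-! ### Informative rounds -/

section Informative

variable {S A : Type*} {h : ℕ} [Fintype S] [DecidableEq S] [Fintype A] [DecidableEq A]
  {P : Params S A} {E : Env S A h} {tb : TieBreak S A h E.p₀}

/-- Round `n` is informative: the feature vector is novel, or a state-action pair is visited that
has been visited rarely before. -/
def Informative (P : Params S A) (k : ℝ) (n : ℕ) (c : ℕ → Round S A h) : Prop :=
  1 ≤ k * (1 + beta P n c) ^ 3 * novelty P n c ∨ ∃ (j : Fin 2) (t : Fin h),
    visitCount n c (((c n).traj j).st t.castSucc, ((c n).traj j).act t) ≤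
      k * (1 + beta P n c) ^ 3

open Classical in
/-- The indicator function of the informative rounds. -/
noncomputable def informativeInd (P : Params S A) (k : ℝ) (n : ℕ) (c : ℕ → Round S A h) : ℝ :=
  if Informative P k n c then 1 else 0

theorem informativeInd_mem (k : ℝ) (n : ℕ) (c : ℕ → Round S A h) :
    informativeInd P k n c = 0 ∨ informativeInd P k n c = 1 := by
  unfold informativeInd
  split_ifs <;> simp

theorem informativeInd_nonneg (k : ℝ) (n : ℕ) (c : ℕ → Round S A h) :
    0 ≤ informativeInd P k n c := by
  rcases informativeInd_mem (P := P) k n c with h0 | h0 <;> simp [h0]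

theorem dependsOn_informativeInd (k : ℝ) (n : ℕ) :
    DependsOn (informativeInd P k n : (ℕ → Round S A h) → ℝ) (Set.Iio (n + 1)) := by
  intro c c' hc
  have hc' : ∀ i ∈ Set.Iio n, c i = c' i := fun i hi => hc i (Nat.lt_succ_of_lt hi)
  have hn : c n = c' n := hc n (Nat.lt_succ_self n)
  unfold informativeInd Informative novelty
  rw [dependsOn_gram n hc', dependsOn_beta n hc', dependsOn_visitCount n hc', hn]

theorem pairProb_le_condMean_informativeInd {k : ℝ} {n : ℕ} {c : ℕ → Round S A h}
    {pol : Fin 2 → Policy S A h} {traj : Fin 2 → Traj S A h}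
    (hinf : ∀ b, Informative P k n (Function.update c n ⟨pol, traj, b⟩)) :
    pairProb E tb P n c pol traj ≤ condMean E P tb n (informativeInd P k n) c := by
  have h1 : pairProb E tb P n c pol traj = ∑ b, roundProb E P tb n c ⟨pol, traj, b⟩ *
      informativeInd P k n (Function.update c n ⟨pol, traj, b⟩) := by
    have h2 : ∀ b, informativeInd P k n (Function.update c n ⟨pol, traj, b⟩) = 1 := fun b => by
      rw [informativeInd, if_pos (hinf b)]
    simp only [h2, mul_one, roundProb_eq]
    rw [← Finset.mul_sum, sum_prefProb, mul_one]
  have hpos : ∀ d, 0 ≤ roundProb E P tb n c d *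
      informativeInd P k n (Function.update c n d) := fun d =>
    mul_nonneg (roundProb_nonneg n c d) (informativeInd_nonneg _ _ _)
  rw [h1, condMean, sum_round]
  refine le_trans ?_ (Finset.single_le_sum (f := fun pol => ∑ traj, ∑ b, _)
    (fun pol _ => Finset.sum_nonneg fun traj _ => Finset.sum_nonneg fun b _ => hpos ⟨pol, traj, b⟩)
    (Finset.mem_univ pol))
  exact Finset.single_le_sum (f := fun traj => ∑ b, roundProb E P tb n c ⟨pol, traj, b⟩ *
      informativeInd P k n (Function.update c n ⟨pol, traj, b⟩))
    (fun traj _ => Finset.sum_nonneg fun b _ => hpos ⟨pol, traj, b⟩) (Finset.mem_univ traj)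

theorem informative_update_iff {k : ℝ} {n : ℕ} {c : ℕ → Round S A h} (d : Round S A h) :
    Informative P k n (Function.update c n d) ↔
      1 ≤ k * (1 + beta P n c) ^ 3 * quad (gram P n c)⁻¹ d.x ∨ ∃ (j : Fin 2) (t : Fin h),
        visitCount n c ((d.traj j).st t.castSucc, (d.traj j).act t) ≤
          k * (1 + beta P n c) ^ 3 := by
  have hc' : ∀ i ∈ Set.Iio n, Function.update c n d i = c i := fun i hi =>
    Function.update_of_ne (ne_of_lt hi) _ _
  unfold Informative novelty
  rw [dependsOn_gram n hc', dependsOn_beta n hc', dependsOn_visitCount n hc',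
    Function.update_self]

/-- Constant factors can be absorbed in the exponent. -/
theorem exists_exp_le_mul_exp {a : ℝ} (ha : 0 < a) (k : ℕ) :
    ∃ k' : ℕ, ∀ b : ℝ, 0 ≤ b → Real.exp (-k' * (1 + b)) ≤ a * Real.exp (-k * (1 + b)) := by
  obtain ⟨m, hm⟩ := exists_nat_ge (-Real.log a)
  refine ⟨k + m, fun b hb => ?_⟩
  rw [← Real.exp_log ha, ← Real.exp_add, Real.exp_le_exp]
  push_cast
  nlinarith [mul_nonneg (Nat.cast_nonneg m : (0 : ℝ) ≤ m) hb]

/-- Posterior sampling selects, with a probability that is at least exponential in `-β`, some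
policy that is optimal for dynamics close to the true ones and for rewards close to a given
target `y`. -/
theorem RegularPath.exists_le_selectProb (hP : P.Good)
    (hα : ∀ s a s', 0 < P.α s a s') {c : ℕ → Round S A h} (hc : RegularPath E P c) {t : ℝ}
    (ht : 0 < t) : ∃ B₀ : ℝ, 0 < B₀ ∧ ∀ B, B₀ ≤ B → ∀ U : ℝ, ∃ k : ℕ, ∀ n (y : Rew S A),
      quad (gram P n c) (y - E.r).ofLp ≤ U * (1 + beta P n c) * beta P n c ^ 2 →
      ∃ π, Real.exp (-k * (1 + beta P n c)) ≤ selectProb P tb n c π ∧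
        ∃ p ∈ goodDyn E P t B n c, ∃ x, ‖x - y‖ ≤ 1 ∧ IsOptimal E.p₀ p x π := by
  classical
  obtain ⟨B₀, hB₀, hdyn⟩ := hc.exists_le_dynPosterior hP hα ht (by norm_num : (0 : ℝ) < 1 / 2)
  refine ⟨B₀, hB₀, fun B hB U => ?_⟩
  obtain ⟨k₁, hk₁⟩ := hc.exists_le_rewPosterior_ball hP U
  obtain ⟨k, hk⟩ := exists_exp_le_mul_exp
    (by positivity : (0 : ℝ) < 1 / 2 / (Fintype.card (Policy S A h) + 1)) k₁
  refine ⟨k, fun n y hy => ?_⟩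
  have hβ := beta_pos hP n c
  set T : Finset (Policy S A h) := Finset.univ.filter fun π => ∃ p ∈ goodDyn E P t B n c,
    ∃ x, ‖x - y‖ ≤ 1 ∧ IsOptimal E.p₀ p x π with hT
  have hsel := le_sum_selectProb hα tb n c (measurableSet_goodDyn (E := E) (P := P) t B n c)
    (measurableSet_quad_le (gram P n c) y 1) T fun p hp x hx π hπ => by
      rw [hT, Finset.mem_filter]
      exact ⟨Finset.mem_univ _, p, hp, x,
        norm_le_of_quad_gram_le hP.one_le_lam zero_le_one (by rw [one_pow]; exact hx), hπ⟩
  have h1 : 1 / 2 * Real.exp (-k₁ * (1 + beta P n c)) ≤ ∑ π ∈ T, selectProb P tb n c π := by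
    refine le_trans (mul_le_mul ?_ (hk₁ n y hy) (Real.exp_pos _).le measureReal_nonneg) hsel
    have := hdyn B hB n
    linarith
  by_contra! hno
  have h2 : ∑ π ∈ T, selectProb P tb n c π ≤
      ∑ _π ∈ T, Real.exp (-k * (1 + beta P n c)) := by
    refine Finset.sum_le_sum fun π hπ => ?_
    by_contra hlt
    rw [not_le] at hlt
    obtain ⟨p, hp, x, hx, hopt⟩ := (Finset.mem_filter.1 hπ).2
    exact hno π hlt.le p hp x hx hopt
  rw [Finset.sum_const, nsmul_eq_mul] at h2
  have h3 : (T.card : ℝ) ≤ Fintype.card (Policy S A h) := by exact_mod_cast Finset.card_le_univ T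
  have h4 := hk _ hβ.le
  have h5 := Real.exp_pos (-k₁ * (1 + beta P n c))
  set x₁ := Real.exp (-k₁ * (1 + beta P n c))
  set N : ℝ := ((Fintype.card (Policy S A h) : ℕ) : ℝ)
  have hN : 0 ≤ N := Nat.cast_nonneg _
  have h6 : (T.card : ℝ) * Real.exp (-k * (1 + beta P n c)) ≤ N * (1 / 2 / (N + 1) * x₁) := by
    gcongr
  have h7 : N * (1 / 2 / (N + 1) * x₁) = N / (N + 1) * (1 / 2 * x₁) := by ring
  have h8 : N / (N + 1) < 1 := by
    rw [div_lt_one (by linarith)]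
    linarith
  nlinarith

/-- If two policies are selected with high probability and the two trajectories under them make
the round informative, then the round is informative with a probability that is not too small. -/
theorem exists_exp_le_condMean {η : ℝ} (hη : 0 < η) (k₁ : ℕ) : ∃ k : ℕ, ∀ (q : ℝ) (n : ℕ)
    (c : ℕ → Round S A h) (π₁ π₂ : Policy S A h) (τ₁ τ₂ : Traj S A h), 0 < beta P n c →
    Real.exp (-k₁ * (1 + beta P n c)) ≤ selectProb P tb n c π₁ →
    Real.exp (-k₁ * (1 + beta P n c)) ≤ selectProb P tb n c π₂ →
    η ≤ trajProb E.p₀ E.p π₁ τ₁ → η ≤ trajProb E.p₀ E.p π₂ τ₂ →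
    (∀ b, Informative P q n (Function.update c n ⟨![π₁, π₂], ![τ₁, τ₂], b⟩)) →
    Real.exp (-k * (1 + beta P n c)) ≤ condMean E P tb n (informativeInd P q n) c := by
  obtain ⟨k, hk⟩ := exists_exp_le_mul_exp (by positivity : 0 < η * η) (k₁ + k₁)
  refine ⟨k, fun q n c π₁ π₂ τ₁ τ₂ hβ h1 h2 h3 h4 h5 => ?_⟩
  refine le_trans ((hk _ hβ.le).trans ?_) (pairProb_le_condMean_informativeInd h5)
  rw [pairProb, Fin.prod_univ_two]
  simp only [Matrix.cons_val_zero, Matrix.cons_val_one]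
  calc η * η * Real.exp (-(k₁ + k₁ : ℕ) * (1 + beta P n c))
      = (Real.exp (-k₁ * (1 + beta P n c)) * η) * (Real.exp (-k₁ * (1 + beta P n c)) * η) := by
        rw [show (-(k₁ + k₁ : ℕ) * (1 + beta P n c) : ℝ) =
          -k₁ * (1 + beta P n c) + -k₁ * (1 + beta P n c) by push_cast; ring, Real.exp_add]
        ring
    _ ≤ _ := by
        have h0 := (Real.exp_pos (-k₁ * (1 + beta P n c))).le
        exact mul_le_mul (mul_le_mul h1 h3 hη.le (h0.trans h1)) (mul_le_mul h2 h4 hη.le (h0.trans h2))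
          (by positivity) (mul_nonneg (h0.trans h1) (hη.le.trans h3))

end Informative

/-! ### Uninformed histories lead to informative rounds -/

section Exploration

variable {S A : Type*} {h : ℕ} [Fintype S] [DecidableEq S] [Fintype A] [DecidableEq A]
  {P : Params S A} {E : Env S A h} {tb : TieBreak S A h E.p₀}

theorem Env.exists_value_le_utility (E : Env S A h) (v : Rew S A) (π : Policy S A h) :
    ∃ τ, 0 < trajProb E.p₀ E.p π τ ∧ value E.p₀ E.p v π ≤ utility v τ := by
  by_contra! hno
  have h1 : ∃ τ, 0 < trajProb E.p₀ E.p π τ := by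
    by_contra! hle
    have := E.sum_trajProb π
    have h2 : ∑ τ, trajProb E.p₀ E.p π τ ≤ 0 := Finset.sum_nonpos fun τ _ => hle τ
    linarith
  obtain ⟨τ₀, hτ₀⟩ := h1
  have h2 : ∑ τ, trajProb E.p₀ E.p π τ * utility v τ <
      ∑ τ, trajProb E.p₀ E.p π τ * value E.p₀ E.p v π := by
    refine Finset.sum_lt_sum (fun τ _ => ?_)
      ⟨τ₀, Finset.mem_univ _, mul_lt_mul_of_pos_left (hno τ₀ hτ₀) hτ₀⟩
    rcases (E.trajProb_nonneg π τ).eq_or_lt with h3 | h3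
    · rw [← h3, zero_mul, zero_mul]
    · exact (mul_lt_mul_of_pos_left (hno τ h3) h3).le
  rw [← Finset.sum_mul, E.sum_trajProb, one_mul] at h2
  exact lt_irrefl _ h2

open Classical in
/-- The rewards that pay `1` for every visit to a state-action pair that has been visited at most
`b` times. -/
noncomputable def rarityBonus (n : ℕ) (c : ℕ → Round S A h) (b : ℝ) : Rew S A :=
  WithLp.toLp 2 fun q => if visitCount n c q ≤ b then 1 else 0

theorem utility_rarityBonus_nonneg (n : ℕ) (c : ℕ → Round S A h) (b : ℝ) (τ : Traj S A h) :
    0 ≤ utility (rarityBonus n c b) τ :=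
  Finset.sum_nonneg fun t _ => by
    simp only [rarityBonus]
    split_ifs <;> simp

theorem one_le_utility_rarityBonus {n : ℕ} {c : ℕ → Round S A h} {b : ℝ} {τ : Traj S A h}
    {t : Fin h} (ht : visitCount n c (τ.st t.castSucc, τ.act t) ≤ b) :
    1 ≤ utility (rarityBonus n c b) τ := by
  have h1 : (rarityBonus n c b) (τ.st t.castSucc, τ.act t) = 1 := by
    simp only [rarityBonus, if_pos ht]
  rw [← h1]
  refine Finset.single_le_sum (f := fun t : Fin h =>
    (rarityBonus n c b) (τ.st t.castSucc, τ.act t)) (fun t _ => ?_) (Finset.mem_univ t)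
  simp only [rarityBonus]
  split_ifs <;> simp

theorem utility_rarityBonus_eq_zero {n : ℕ} {c : ℕ → Round S A h} {b : ℝ} {τ : Traj S A h}
    (hτ : ∀ t : Fin h, b < visitCount n c (τ.st t.castSucc, τ.act t)) :
    utility (rarityBonus n c b) τ = 0 :=
  Finset.sum_eq_zero fun t _ => by simp only [rarityBonus, if_neg (not_le.2 (hτ t))]

theorem dotProduct_rarityBonus_le (n : ℕ) (c : ℕ → Round S A h) (b : ℝ) :
    (rarityBonus n c b).ofLp ⬝ᵥ (rarityBonus n c b).ofLp ≤ Fintype.card (S × A) := by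
  have h1 : ∀ q, (rarityBonus n c b).ofLp q * (rarityBonus n c b).ofLp q ≤ 1 := fun q => by
    simp only [rarityBonus]
    split_ifs <;> simp
  exact (Finset.sum_le_sum fun q _ => h1 q).trans (by simp)

theorem norm_rarityBonus_le (n : ℕ) (c : ℕ → Round S A h) (b : ℝ) :
    ‖rarityBonus n c b‖ ≤ Fintype.card (S × A) + 1 := by
  refine abs_le_of_sq_le_sq' ?_ (by positivity) |>.2
  have h1 : ‖rarityBonus n c b‖ ^ 2 =
      (rarityBonus n c b).ofLp ⬝ᵥ (rarityBonus n c b).ofLp := by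
    rw [EuclideanSpace.real_norm_sq_eq]
    simp [dotProduct, sq]
  have h2 := dotProduct_rarityBonus_le n c b
  have h3 : (0 : ℝ) ≤ Fintype.card (S × A) := Nat.cast_nonneg _
  rw [h1]
  nlinarith

/-- Rarely visited pairs contribute little to the Gram matrix. -/
theorem quad_gram_rarityBonus_le (hlam : 0 ≤ P.lam) (n : ℕ) (c : ℕ → Round S A h) {b : ℝ}
    (hb : 0 ≤ b) : quad (gram P n c) (rarityBonus n c b).ofLp ≤
      P.lam * Fintype.card (S × A) + 2 * h * (Fintype.card (S × A) * b) := by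
  classical
  set f : S × A → ℝ := (rarityBonus n c b).ofLp with hf
  have hf0 : ∀ q, 0 ≤ f q := fun q => by
    simp only [hf, rarityBonus]
    split_ifs <;> simp
  have hf1 : ∀ q, f q ≤ 1 := fun q => by
    simp only [hf, rarityBonus]
    split_ifs <;> simp
  rw [quad_gram]
  refine add_le_add (mul_le_mul_of_nonneg_left (dotProduct_rarityBonus_le n c b) hlam) ?_
  -- one factor is bounded by the length of the trajectories, the other one by the visits
  have h1 : ∀ k, ((c k).x ⬝ᵥ f) ^ 2 ≤
      2 * h * ∑ q, (∑ j : Fin 2, visits ((c k).traj j) q) * f q := by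
    intro k
    have h2 : |(c k).x ⬝ᵥ f| ≤ ∑ q, |(c k).x q| * f q := by
      refine (Finset.abs_sum_le_sum_abs _ _).trans_eq (Finset.sum_congr rfl fun q _ => ?_)
      rw [abs_mul, abs_of_nonneg (hf0 q)]
    have h3 : ∑ q, |(c k).x q| * f q ≤ 2 * h :=
      (Finset.sum_le_sum fun q _ => mul_le_of_le_one_right (abs_nonneg _) (hf1 q)).trans
        (sum_abs_x_le (c k))
    have h4 : ∑ q, |(c k).x q| * f q ≤
        ∑ q, (∑ j : Fin 2, visits ((c k).traj j) q) * f q := by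
      refine Finset.sum_le_sum fun q _ => mul_le_mul_of_nonneg_right ?_ (hf0 q)
      rw [Fin.sum_univ_two]
      refine (abs_sub _ _).trans_eq ?_
      rw [abs_of_nonneg (visits_nonneg _ _), abs_of_nonneg (visits_nonneg _ _), add_comm]
    rw [← sq_abs, sq]
    exact mul_le_mul (h2.trans h3) (h2.trans h4) (abs_nonneg _) (by positivity)
  calc ∑ k ∈ Finset.range n, ((c k).x ⬝ᵥ f) ^ 2
      ≤ ∑ k ∈ Finset.range n, 2 * h * ∑ q, (∑ j : Fin 2, visits ((c k).traj j) q) * f q :=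
        Finset.sum_le_sum fun k _ => h1 k
    _ = 2 * h * ∑ q, visitCount n c q * f q := by
        rw [← Finset.mul_sum, Finset.sum_comm]
        simp only [visitCount, Finset.sum_mul]
    _ ≤ 2 * h * ∑ _q : S × A, b := by
        refine mul_le_mul_of_nonneg_left (Finset.sum_le_sum fun q _ => ?_) (by positivity)
        simp only [hf, rarityBonus]
        split_ifs with h5
        · simpa using h5
        · simpa using hb
    _ = _ := by simp

theorem norm_le_of_norm_sub_le {x r v : Rew S A} {k : ℝ} (hx : ‖x - (r + k • v)‖ ≤ 1) :
    ‖x‖ ≤ ‖r‖ + 1 + |k| * ‖v‖ := by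
  have h1 : x = (x - (r + k • v)) + r + k • v := by abel
  calc ‖x‖ = ‖(x - (r + k • v)) + r + k • v‖ := by rw [← h1]
    _ ≤ ‖x - (r + k • v)‖ + ‖r‖ + ‖k • v‖ := norm_add₃_le
    _ ≤ _ := by
        rw [norm_smul, Real.norm_eq_abs]
        linarith

theorem norm_sub_smul_le {x r v : Rew S A} {k : ℝ} (hx : ‖x - (r + k • v)‖ ≤ 1) :
    ‖x - k • v‖ ≤ ‖r‖ + 1 := by
  have h1 : x - k • v = (x - (r + k • v)) + r := by abel
  rw [h1]
  exact (norm_add_le _ _).trans (by linarith)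

/-- A large bonus on rarely visited pairs makes every optimal policy visit such a pair, if this is
possible at all. -/
theorem exists_visitCount_le_of_isOptimal (hP : P.Good) {t B : ℝ} (ht : 0 ≤ t) {n : ℕ}
    {c : ℕ → Round S A h} {p : Dyn S A} (hp : p ∈ goodDyn E P t B n c) {x : Rew S A} {k η : ℝ}
    (hk : 0 ≤ k) (hx : ‖x - (E.r + k • rarityBonus n c (B * beta P n c ^ 3))‖ ≤ 1)
    {π : Policy S A h} (hπ : IsOptimal E.p₀ p x π)
    {π₀ : Policy S A h} {τ₀ : Traj S A h} (hτ₀ : η ≤ trajProb E.p₀ E.p π₀ τ₀) {i : Fin h}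
    (hi : visitCount n c (τ₀.st i.castSucc, τ₀.act i) ≤ B * beta P n c ^ 3)
    (h1 : Fintype.card (Traj S A h) * (h * (t / beta P n c)) ≤ η / 2)
    (h2 : 2 * (Fintype.card (Traj S A h) * (h * (t / beta P n c))) *
      (h * (‖E.r‖ + 1 + k * (Fintype.card (S × A) + 1))) ≤ 1)
    (h3 : 2 * (h * (‖E.r‖ + 1)) + 1 < k * η / 2) :
    ∃ τ, 0 < trajProb E.p₀ E.p π τ ∧
      ∃ i : Fin h, visitCount n c (τ.st i.castSucc, τ.act i) ≤ B * beta P n c ^ 3 := by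
  classical
  by_contra! hno
  have hβ := beta_pos hP n c
  have hθ0 : 0 ≤ h * (t / beta P n c) := by positivity
  have hps := fun s a => (mem_goodDyn hp s a).1
  set β := beta P n c with hβd
  set b := B * β ^ 3 with hb
  set u := rarityBonus n c b with hu
  have hux : ∀ τ : Traj S A h, utility x τ = utility (x - k • u) τ + k * utility u τ := by
    intro τ
    rw [← utility_smul, ← utility_add, sub_add_cancel]
  have hz := norm_sub_smul_le hx
  have hnx := norm_le_of_norm_sub_le hx
  rw [abs_of_nonneg hk] at hnx
  have hz' : ∀ τ : Traj S A h, |utility (x - k • u) τ| ≤ h * (‖E.r‖ + 1) := fun τ =>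
    (abs_utility_le _ τ).trans (by gcongr)
  -- the value of `π` is small, since it misses the bonus
  have hup : value E.p₀ p x π ≤ h * (‖E.r‖ + 1) + 1 := by
    have h4 := abs_value_sub_le_of_mem_goodDyn hP ht hp x π hno
    have h5 : 2 * (Fintype.card (Traj S A h) * (h * (t / beta P n c))) * (h * ‖x‖) ≤ 1 := by
      refine le_trans ?_ h2
      have h6 : ‖x‖ ≤ ‖E.r‖ + 1 + k * (Fintype.card (S × A) + 1) := by
        have := mul_le_mul_of_nonneg_left (norm_rarityBonus_le n c b) hk
        linarith
      gcongr
    have h6 : value E.p₀ E.p x π ≤ h * (‖E.r‖ + 1) := by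
      calc value E.p₀ E.p x π ≤ ∑ τ, trajProb E.p₀ E.p π τ * (h * (‖E.r‖ + 1)) := by
            refine Finset.sum_le_sum fun τ _ => ?_
            rcases (E.trajProb_nonneg π τ).eq_or_lt with h7 | h7
            · rw [← h7, zero_mul, zero_mul]
            · rw [hux, utility_rarityBonus_eq_zero (hno τ h7), mul_zero, add_zero]
              exact mul_le_mul_of_nonneg_left ((le_abs_self _).trans (hz' τ)) h7.le
        _ = _ := by rw [← Finset.sum_mul, E.sum_trajProb, one_mul]
    have := abs_le.1 (h4.trans h5)
    linarith
  -- the policy `π₀` collects the bonus with probability at least `η / 2`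
  set L : Finset (Traj S A h) := Finset.univ.filter fun τ =>
    ∃ i : Fin h, visitCount n c (τ.st i.castSucc, τ.act i) ≤ b with hL
  have hprob : η / 2 ≤ ∑ τ ∈ L, trajProb E.p₀ p π₀ τ := by
    have h4 := DPS.sum_trajProb E.p₀_mem hps π₀
    have h5 := E.sum_trajProb π₀
    rw [← Finset.sum_add_sum_compl L] at h4 h5
    have h6 : η ≤ ∑ τ ∈ L, trajProb E.p₀ E.p π₀ τ :=
      hτ₀.trans (Finset.single_le_sum (f := fun τ => trajProb E.p₀ E.p π₀ τ)
        (fun τ _ => E.trajProb_nonneg π₀ τ) (by simpa [hL] using ⟨i, hi⟩))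
    have h7 : ∑ τ ∈ Lᶜ, trajProb E.p₀ p π₀ τ ≤
        ∑ τ ∈ Lᶜ, (trajProb E.p₀ E.p π₀ τ + h * (t / β)) := by
      refine Finset.sum_le_sum fun τ hτ => ?_
      have h8 : ∀ i : Fin h, b < visitCount n c (τ.st i.castSucc, τ.act i) := by
        simpa [hL] using hτ
      have h9 := abs_le.1 (abs_trajProb_sub_le E.p₀_mem E.p_mem hps π₀ τ (div_nonneg ht hβ.le)
        fun i s' => (mem_goodDyn hp _ _).2 (h8 i) s')
      linarith
    rw [Finset.sum_add_distrib, Finset.sum_const, nsmul_eq_mul] at h7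
    have h8 : (Lᶜ.card : ℝ) * (h * (t / β)) ≤ Fintype.card (Traj S A h) * (h * (t / β)) := by
      gcongr
      exact Finset.card_le_univ _
    linarith
  have hlow : k * (η / 2) - h * (‖E.r‖ + 1) ≤ value E.p₀ p x π₀ := by
    have hn := DPS.trajProb_nonneg E.p₀_mem.1 (fun s a => (hps s a).1) π₀
    have h4 : ∑ τ ∈ L, trajProb E.p₀ p π₀ τ ≤ value E.p₀ p u π₀ := by
      calc ∑ τ ∈ L, trajProb E.p₀ p π₀ τ ≤ ∑ τ ∈ L, trajProb E.p₀ p π₀ τ * utility u τ := by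
            refine Finset.sum_le_sum fun τ hτ => ?_
            obtain ⟨i, hi⟩ := (Finset.mem_filter.1 hτ).2
            exact le_mul_of_one_le_right (hn τ) (one_le_utility_rarityBonus hi)
        _ ≤ _ := Finset.sum_le_sum_of_subset_of_nonneg (Finset.subset_univ _) fun τ _ _ =>
            mul_nonneg (hn τ) (utility_rarityBonus_nonneg n c b τ)
    have h5 : value E.p₀ p x π₀ = value E.p₀ p (x - k • u) π₀ + k * value E.p₀ p u π₀ := by
      rw [← value_smul, ← value_add, sub_add_cancel]
    have h6 := abs_le.1 (abs_value_le E.p₀_mem hps (x - k • u) π₀)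
    have h7 : h * ‖x - k • u‖ ≤ h * (‖E.r‖ + 1) := by gcongr
    have h8 := mul_le_mul_of_nonneg_left (hprob.trans h4) hk
    linarith
  have := hπ π₀
  linarith

/-- If all pairs that can be reached have been visited often, then policies that are optimal for
rewards close to `r + k v` nearly maximize the value of `k v`. -/
theorem mul_value_sub_le_of_isOptimal (hP : P.Good) {t B : ℝ} (ht : 0 ≤ t) {n : ℕ}
    {c : ℕ → Round S A h} (hvis : ∀ (π : Policy S A h) (τ : Traj S A h) (t : Fin h),
      0 < trajProb E.p₀ E.p π τ → B * beta P n c ^ 3 < visitCount n c (τ.st t.castSucc, τ.act t))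
    {p : Dyn S A} (hp : p ∈ goodDyn E P t B n c) {x v : Rew S A} {k : ℝ}
    (hx : ‖x - (E.r + k • v)‖ ≤ 1) {π : Policy S A h} (hπ : IsOptimal E.p₀ p x π)
    (π' : Policy S A h) :
    k * (value E.p₀ E.p v π' - value E.p₀ E.p v π) ≤ 2 * (h * (‖E.r‖ + 1)) +
      2 * (2 * (Fintype.card (Traj S A h) * (h * (t / beta P n c))) *
        (h * (‖E.r‖ + 1 + |k| * ‖v‖))) := by
  have hβ := beta_pos hP n c
  have hz := norm_sub_smul_le hx
  have hnx := norm_le_of_norm_sub_le hx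
  have hsim : ∀ π' : Policy S A h, |value E.p₀ p x π' - value E.p₀ E.p x π'| ≤
      2 * (Fintype.card (Traj S A h) * (h * (t / beta P n c))) *
        (h * (‖E.r‖ + 1 + |k| * ‖v‖)) := fun π' =>
    (abs_value_sub_le_of_mem_goodDyn hP ht hp x π' fun τ hτ i => hvis π' τ i hτ).trans
      (by gcongr)
  have hsplit : ∀ π' : Policy S A h, value E.p₀ E.p x π' =
      value E.p₀ E.p (x - k • v) π' + k * value E.p₀ E.p v π' := by
    intro π'
    rw [← value_smul, ← value_add, sub_add_cancel]
  have hval : ∀ π' : Policy S A h, |value E.p₀ E.p (x - k • v) π'| ≤ h * (‖E.r‖ + 1) := fun π' =>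
    (abs_value_le E.p₀_mem E.p_mem _ π').trans (by gcongr)
  have h1 := abs_le.1 (hsim π)
  have h2 := abs_le.1 (hsim π')
  have h3 := abs_le.1 (hval π)
  have h4 := abs_le.1 (hval π')
  have h5 := hπ π'
  rw [hsplit] at h1 h2
  linarith

end Exploration

section Exploration

variable {S A : Type*} {h : ℕ} [Fintype S] [DecidableEq S] [Fintype A] [DecidableEq A]
  {P : Params S A} {E : Env S A h} {tb : TieBreak S A h E.p₀}

theorem exists_exp_le_exp (k : ℕ) {q : ℝ} : ∃ k' : ℕ, q ≤ k' ∧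
    ∀ b : ℝ, 0 ≤ b → Real.exp (-k' * (1 + b)) ≤ Real.exp (-k * (1 + b)) := by
  obtain ⟨m, hm⟩ := exists_nat_ge q
  refine ⟨k + m, ?_, fun b hb => ?_⟩
  · push_cast
    linarith [(Nat.cast_nonneg k : (0 : ℝ) ≤ k)]
  · rw [Real.exp_le_exp]
    push_cast
    nlinarith [mul_nonneg (Nat.cast_nonneg m : (0 : ℝ) ≤ m) hb, (Nat.cast_nonneg m : (0 : ℝ) ≤ m)]

theorem exists_pos_mul_le_one {a b c : ℝ} (ha : 0 ≤ a) (hb : 0 ≤ b) (hc : 0 ≤ c) :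
    ∃ t, 0 < t ∧ a * t ≤ 1 ∧ b * t ≤ 1 ∧ c * t ≤ 1 := by
  refine ⟨1 / (a + b + c + 1), by positivity, ?_, ?_, ?_⟩ <;>
  · rw [mul_one_div, div_le_one (by positivity)]
    linarith

/-- Policies that nearly maximize the value of `v` and of `-v`, respectively, are separated by
trajectories whose feature difference is novel. -/
theorem exists_novel_of_value_sub_le (hlam : 0 < P.lam) {n : ℕ} {c : ℕ → Round S A h} {v : Rew S A}
    {π π' π₁ π₂ : Policy S A h} {r : ℝ}
    (hv : 1 ≤ value E.p₀ E.p v π - value E.p₀ E.p v π') (hq : quad (gram P n c) v.ofLp ≤ r ^ 2)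
    (h1 : value E.p₀ E.p v π - value E.p₀ E.p v π₁ ≤ 1 / 4)
    (h2 : value E.p₀ E.p v π₂ - value E.p₀ E.p v π' ≤ 1 / 4) :
    ∃ τ₁ τ₂ : Traj S A h, 0 < trajProb E.p₀ E.p π₁ τ₁ ∧ 0 < trajProb E.p₀ E.p π₂ τ₂ ∧
      1 ≤ 4 * r ^ 2 * quad (gram P n c)⁻¹ (visits τ₂ - visits τ₁) := by
  obtain ⟨τ₁, hτ₁, hu₁⟩ := E.exists_value_le_utility v π₁
  obtain ⟨τ₂, hτ₂, hu₂⟩ := E.exists_value_le_utility ((-1 : ℝ) • v) π₂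
  rw [value_smul, utility_smul] at hu₂
  refine ⟨τ₁, τ₂, hτ₁, hτ₂, ?_⟩
  have hM := gram_posDef hlam n c
  have h3 := sq_dotProduct_le hM v.ofLp (visits τ₂ - visits τ₁)
  rw [dotProduct_sub, ← utility_eq_dotProduct, ← utility_eq_dotProduct] at h3
  have h4 : 1 / 2 ≤ utility v τ₁ - utility v τ₂ := by linarith
  have h5 := quad_nonneg hM.inv (visits τ₂ - visits τ₁)
  nlinarith [mul_le_mul_of_nonneg_right hq h5]

/-- After an uninformed history, the next round is informative with a probability that is at least
exponential in `-β`. -/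
theorem RegularPath.exists_exp_le_condMean (hP : P.Good)
    (hα : ∀ s a s', 0 < P.α s a s') {c : ℕ → Round S A h} (hc : RegularPath E P c) {e : ℝ}
    (he : 0 < e) : ∃ B₀ : ℝ, 0 < B₀ ∧ ∀ B, B₀ ≤ B → ∃ k : ℕ, ∀ n, Uninformed E P B e n c →
      Real.exp (-k * (1 + beta P n c)) ≤ condMean E P tb n (informativeInd P k n) c := by
  classical
  obtain ⟨η, hη, hmin⟩ := exists_pos_le_of_pos fun q : Policy S A h × Traj S A h =>
    trajProb E.p₀ E.p q.1 q.2
  have hmin' : ∀ (π : Policy S A h) (τ : Traj S A h), 0 < trajProb E.p₀ E.p π τ →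
      η ≤ trajProb E.p₀ E.p π τ := fun π τ => hmin (π, τ)
  have hb0 := betaMin_pos hP
  obtain ⟨H, hH⟩ : ∃ H : ℝ, H = h * (‖E.r‖ + 1) := ⟨_, rfl⟩
  have hH0 : 0 ≤ H := by rw [hH]; positivity
  obtain ⟨N, hN⟩ : ∃ N : ℝ, N = Fintype.card (Traj S A h) := ⟨_, rfl⟩
  have hN0 : 0 ≤ N := by rw [hN]; positivity
  obtain ⟨D, hD⟩ : ∃ D : ℝ, D = Fintype.card (S × A) := ⟨_, rfl⟩
  have hD0 : 0 ≤ D := by rw [hD]; positivity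
  -- the factors of the bonus on rarely visited pairs and of the direction `v`
  obtain ⟨κ₁, hκ₁⟩ : ∃ κ : ℝ, κ = (4 * H + 4) / η := ⟨_, rfl⟩
  obtain ⟨κ₂, hκ₂⟩ : ∃ κ : ℝ, κ = 8 * H + 8 := ⟨_, rfl⟩
  have hκ₁0 : 0 ≤ κ₁ := by rw [hκ₁]; positivity
  have hκ₂0 : 0 < κ₂ := by rw [hκ₂]; positivity
  -- the accuracy of the dynamics must not depend on `B`, since `B₀` is chosen in terms of it
  obtain ⟨t, ht, ht1, ht2, ht3⟩ := exists_pos_mul_le_one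
    (by positivity : 0 ≤ 2 * N * h / (betaMin P * η))
    (by positivity : 0 ≤ 2 * N * h / betaMin P * (h * (‖E.r‖ + 1 + κ₁ * (D + 1))))
    (by positivity : 0 ≤ 4 * N * h * h * ((‖E.r‖ + 1) / betaMin P + κ₂ / e))
  obtain ⟨B₀, hB₀, hsel⟩ := hc.exists_le_selectProb (tb := tb) hP hα ht
  refine ⟨B₀, hB₀, fun B hB => ?_⟩
  have hB0 : 0 < B := hB₀.trans_le hB
  obtain ⟨k₁, hk₁⟩ := hsel B hB
    (κ₁ ^ 2 * (P.lam * D / betaMin P ^ 2 + 2 * h * (D * B)) + κ₂ ^ 2 / e ^ 2)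
  obtain ⟨k₂, hk₂⟩ := DPS.exists_exp_le_condMean (P := P) (tb := tb) hη k₁
  obtain ⟨k, hkq, hk⟩ := exists_exp_le_exp k₂ (q := B + 4 / e ^ 2)
  have hkB : B ≤ k := le_trans (by linarith [(by positivity : 0 < 4 / e ^ 2)]) hkq
  have hke : 4 / e ^ 2 ≤ k := le_trans (by linarith) hkq
  refine ⟨k, fun n hun => ?_⟩
  have hβ := beta_pos hP n c
  have hβ0 := betaMin_le hP n c
  set β := beta P n c with hβd
  refine (hk _ hβ.le).trans ?_
  have hlam := hP.lam_pos
  have hβ1 : β ≤ 1 + β := by linarith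
  by_cases hrare : ∃ (π : Policy S A h) (τ : Traj S A h) (t : Fin h),
      0 < trajProb E.p₀ E.p π τ ∧ visitCount n c (τ.st t.castSucc, τ.act t) ≤ B * β ^ 3
  · obtain ⟨π₀, τ₀, i₀, hτ₀, hi₀⟩ := hrare
    obtain ⟨π, hπ, p, hp, x, hx, hopt⟩ := hk₁ n
      (E.r + κ₁ • rarityBonus n c (B * β ^ 3)) <| by
        rw [add_sub_cancel_left, WithLp.ofLp_smul, quad_smul, ← hβd]
        have h1 := quad_gram_rarityBonus_le hlam.le n c (by positivity : 0 ≤ B * β ^ 3)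
        rw [← hD] at h1
        have h2 : P.lam * D ≤ P.lam * D / betaMin P ^ 2 * ((1 + β) * β ^ 2) := by
          rw [div_mul_eq_mul_div, le_div_iff₀ (by positivity)]
          have h3 : betaMin P ^ 2 ≤ β ^ 2 := by gcongr
          have h4 : β ^ 2 ≤ (1 + β) * β ^ 2 := le_mul_of_one_le_left (by positivity) (by linarith)
          gcongr
          linarith
        have h3 : 2 * h * (D * (B * β ^ 3)) ≤ 2 * h * (D * B) * ((1 + β) * β ^ 2) := by
          have h4 : β ^ 3 ≤ (1 + β) * β ^ 2 := by nlinarith [sq_nonneg β]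
          calc 2 * h * (D * (B * β ^ 3)) = 2 * h * (D * B) * β ^ 3 := by ring
            _ ≤ _ := by gcongr
        have h4 : 0 ≤ κ₂ ^ 2 / e ^ 2 * ((1 + β) * β ^ 2) := by positivity
        have h5 := mul_le_mul_of_nonneg_left (h1.trans (add_le_add h2 h3)) (sq_nonneg κ₁)
        linarith
    obtain ⟨τ, hτ, i, hi⟩ := exists_visitCount_le_of_isOptimal hP ht.le hp hκ₁0 hx hopt
      (hmin' _ _ hτ₀) hi₀
      (by
        rw [← hN, ← hβd]
        calc N * (h * (t / β)) ≤ N * (h * (t / betaMin P)) := by gcongr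
          _ = 2 * N * h / (betaMin P * η) * t * (η / 2) := by field_simp
          _ ≤ 1 * (η / 2) := by gcongr
          _ = η / 2 := one_mul _)
      (by
        rw [← hN, ← hβd, ← hD]
        calc 2 * (N * (h * (t / β))) * (h * (‖E.r‖ + 1 + κ₁ * (D + 1)))
            ≤ 2 * (N * (h * (t / betaMin P))) * (h * (‖E.r‖ + 1 + κ₁ * (D + 1))) := by gcongr
          _ = 2 * N * h / betaMin P * (h * (‖E.r‖ + 1 + κ₁ * (D + 1))) * t := by
            field_simp
          _ ≤ 1 := ht2)
      (by
        rw [← hH, hκ₁]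
        field_simp
        linarith)
    refine hk₂ k n c π π τ τ hβ hπ hπ (hmin' _ _ hτ) (hmin' _ _ hτ) fun b => ?_
    rw [informative_update_iff]
    refine .inr ⟨0, i, ?_⟩
    simp only [Matrix.cons_val_zero]
    exact hi.trans (by rw [← hβd]; gcongr)
  · obtain ⟨v, π, π', hv, hq⟩ := hun.resolve_left hrare
    rw [← hβd] at hq
    simp only [not_exists, not_and, not_le] at hrare
    have hnv : ‖v‖ ≤ β / e := norm_le_of_quad_gram_le hP.one_le_lam (by positivity) hq
    have htarget : ∀ κ : ℝ, κ ^ 2 = κ₂ ^ 2 → quad (gram P n c) (E.r + κ • v - E.r).ofLp ≤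
        (κ₁ ^ 2 * (P.lam * D / betaMin P ^ 2 + 2 * h * (D * B)) + κ₂ ^ 2 / e ^ 2) *
          (1 + β) * β ^ 2 := by
      intro κ hκ
      rw [add_sub_cancel_left, WithLp.ofLp_smul, quad_smul, hκ]
      have h0 : 0 ≤ κ₁ ^ 2 * (P.lam * D / betaMin P ^ 2 + 2 * h * (D * B)) *
        ((1 + β) * β ^ 2) := by positivity
      calc κ₂ ^ 2 * quad (gram P n c) v.ofLp ≤ κ₂ ^ 2 * (β / e) ^ 2 := by gcongr
        _ = κ₂ ^ 2 / e ^ 2 * β ^ 2 := by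
            field_simp
        _ ≤ κ₂ ^ 2 / e ^ 2 * ((1 + β) * β ^ 2) := by
            gcongr
            exact le_mul_of_one_le_left (by positivity) (by linarith)
        _ ≤ _ := by linarith
    have hbound : ∀ κ : ℝ, |κ| = κ₂ → ∀ p ∈ goodDyn E P t B n c, ∀ x : Rew S A,
        ‖x - (E.r + κ • v)‖ ≤ 1 → ∀ π : Policy S A h, IsOptimal E.p₀ p x π →
        ∀ π' : Policy S A h, κ * (value E.p₀ E.p v π' - value E.p₀ E.p v π) ≤ κ₂ / 4 := by
      intro κ hκ p hp x hx π hopt π'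
      refine (mul_value_sub_le_of_isOptimal hP ht.le hrare hp hx hopt π').trans ?_
      rw [hκ, ← hN, ← hβd, ← hH]
      have h1 : 2 * (2 * (N * (h * (t / β))) * (h * (‖E.r‖ + 1 + κ₂ * ‖v‖))) ≤ 1 := by
        have h2 : ‖E.r‖ + 1 + κ₂ * ‖v‖ ≤ ((‖E.r‖ + 1) / betaMin P + κ₂ / e) * β := by
          have h3 : ‖E.r‖ + 1 ≤ (‖E.r‖ + 1) / betaMin P * β := by
            rw [div_mul_eq_mul_div, le_div_iff₀ hb0]
            gcongr
          have h4 : κ₂ * ‖v‖ ≤ κ₂ / e * β := by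
            calc κ₂ * ‖v‖ ≤ κ₂ * (β / e) := by gcongr
              _ = κ₂ / e * β := by ring
          linarith
        calc 2 * (2 * (N * (h * (t / β))) * (h * (‖E.r‖ + 1 + κ₂ * ‖v‖)))
            ≤ 2 * (2 * (N * (h * (t / β))) *
                (h * (((‖E.r‖ + 1) / betaMin P + κ₂ / e) * β))) := by gcongr
          _ = 4 * N * h * h * ((‖E.r‖ + 1) / betaMin P + κ₂ / e) * t := by
            field_simp
            ring
          _ ≤ 1 := ht3
      rw [hκ₂] at h1 ⊢
      linarith
    obtain ⟨π₁, hπ₁, p₁, hp₁, x₁, hx₁, hopt₁⟩ := hk₁ n (E.r + κ₂ • v) (htarget κ₂ rfl)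
    obtain ⟨π₂, hπ₂, p₂, hp₂, x₂, hx₂, hopt₂⟩ := hk₁ n (E.r + (-κ₂) • v)
      (htarget (-κ₂) (neg_sq κ₂))
    have h1 := hbound κ₂ (abs_of_pos hκ₂0) p₁ hp₁ x₁ hx₁ π₁ hopt₁ π
    have h2 := hbound (-κ₂) (by rw [abs_neg, abs_of_pos hκ₂0]) p₂ hp₂ x₂ hx₂ π₂ hopt₂ π'
    obtain ⟨τ₁, τ₂, hτ₁, hτ₂, hnov⟩ := exists_novel_of_value_sub_le hlam (π₁ := π₁) (π₂ := π₂)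
      hv hq
      (le_of_mul_le_mul_left (by linarith) hκ₂0) (le_of_mul_le_mul_left (by linarith) hκ₂0)
    refine hk₂ k n c π₁ π₂ τ₁ τ₂ hβ hπ₁ hπ₂ (hmin' _ _ hτ₁) (hmin' _ _ hτ₂) fun b => ?_
    rw [informative_update_iff]
    refine .inl (hnov.trans ?_)
    have h3 : 4 * (β / e) ^ 2 ≤ k * (1 + β) ^ 3 := by
      calc 4 * (β / e) ^ 2 = 4 / e ^ 2 * β ^ 2 := by
            field_simp
        _ ≤ k * (1 + β) ^ 2 := by gcongr
        _ ≤ k * (1 + β) ^ 3 := by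
            gcongr
            · linarith
            · norm_num
    exact mul_le_mul_of_nonneg_right h3
      (quad_nonneg (gram_posDef hlam n c).inv (visits τ₂ - visits τ₁))

end Exploration

/-! ### Uninformed histories are finite in number -/

section Counting

variable {S A : Type*} {h : ℕ} [Fintype S] [DecidableEq S] [Fintype A] [DecidableEq A]
  {P : Params S A} {E : Env S A h} {tb : TieBreak S A h E.p₀}

/-- There are few informative rounds: each of them increases the information gain or the number
of visits to a pair that has been visited rarely. -/
theorem sum_informativeInd_le_of_le (hP : P.Good) {k b : ℝ} (hb : 0 ≤ b) {n : ℕ}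
    {c : ℕ → Round S A h} (hkb : ∀ m < n, k * (1 + beta P m c) ^ 3 ≤ b) :
    ∑ m ∈ Finset.range n, informativeInd P k m c ≤
      (b + 1) * infoGain P n c + ∑ q, min (visitCount n c q) (b + 1) := by
  -- a round with novelty at least `1 / b` increases the information gain by at least `1 / (b + 1)`,
  -- and any other informative round increases one of the truncated numbers of visits by `1`
  induction n with
  | zero =>
    simp only [Finset.range_zero, Finset.sum_empty, infoGain_zero, mul_zero, zero_add]
    exact Finset.sum_nonneg fun q _ => le_min (visitCount_nonneg _ _ _) (by linarith)
  | succ n ih =>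
    rw [Finset.sum_range_succ, infoGain_succ hP.lam_pos, mul_add]
    have h1 := ih fun m hm => hkb m (Nat.lt_succ_of_lt hm)
    have hw := novelty_nonneg hP.lam_pos n c
    have hlog : 0 ≤ Real.log (1 + novelty P n c) := Real.log_nonneg (by linarith)
    have hmono : ∀ q, min (visitCount n c q) (b + 1) ≤ min (visitCount (n + 1) c q) (b + 1) :=
      fun q => min_le_min_right _ (visitCount_mono c q (Nat.le_succ n))
    suffices h2 : informativeInd P k n c + ∑ q, min (visitCount n c q) (b + 1) ≤
        (b + 1) * Real.log (1 + novelty P n c) + ∑ q, min (visitCount (n + 1) c q) (b + 1) by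
      linarith
    unfold informativeInd
    split_ifs with hinf
    · have hkn := hkb n (Nat.lt_succ_self n)
      rcases hinf with h3 | ⟨j, t, h3⟩
      · have h4 : 1 ≤ b * novelty P n c := h3.trans (by gcongr)
        have h5 := Real.one_sub_inv_le_log_of_pos (by linarith : 0 < 1 + novelty P n c)
        have h6 : 1 ≤ (b + 1) * (1 - (1 + novelty P n c)⁻¹) := by
          field_simp
          linarith
        have h7 : (b + 1) * (1 - (1 + novelty P n c)⁻¹) ≤
          (b + 1) * Real.log (1 + novelty P n c) := by gcongr
        exact add_le_add (h6.trans h7) (Finset.sum_le_sum fun q _ => hmono q)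
      · have h4 : 0 ≤ (b + 1) * Real.log (1 + novelty P n c) := by positivity
        set q₀ := (((c n).traj j).st t.castSucc, ((c n).traj j).act t) with hq₀
        have h5 : 1 + min (visitCount n c q₀) (b + 1) ≤ min (visitCount (n + 1) c q₀) (b + 1) := by
          have h6 : visitCount n c q₀ ≤ b := h3.trans hkn
          rw [min_eq_left (by linarith), le_min_iff, visitCount_succ]
          refine ⟨?_, by linarith⟩
          have h7 : 1 ≤ visits ((c n).traj j) q₀ := one_le_visits t
          have h8 := Finset.single_le_sum (f := fun j => visits ((c n).traj j) q₀)
            (fun j _ => visits_nonneg _ _) (Finset.mem_univ j)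
          linarith
        have h9 : ∑ q ∈ Finset.univ.erase q₀, min (visitCount n c q) (b + 1) ≤
            ∑ q ∈ Finset.univ.erase q₀, min (visitCount (n + 1) c q) (b + 1) :=
          Finset.sum_le_sum fun q _ => hmono q
        rw [← Finset.add_sum_erase _ _ (Finset.mem_univ q₀),
          ← Finset.add_sum_erase _ (fun q => min (visitCount (n + 1) c q) (b + 1))
            (Finset.mem_univ q₀)]
        linarith
    · have h3 : 0 ≤ (b + 1) * Real.log (1 + novelty P n c) := by positivity
      have h4 := Finset.sum_le_sum fun q (_ : q ∈ Finset.univ) => hmono q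
      linarith

theorem sum_informativeInd_le (hP : P.Good) {k : ℝ} (hk : 0 ≤ k) (n : ℕ) (c : ℕ → Round S A h) :
    ∑ m ∈ Finset.range n, informativeInd P k m c ≤
      (k * (1 + beta P n c) ^ 3 + 1) *
        (beta P n c ^ 2 / P.R ^ 2 + Fintype.card (S × A)) := by
  have hβ := beta_pos hP n c
  have hb : 0 ≤ k * (1 + beta P n c) ^ 3 := by positivity
  refine (sum_informativeInd_le_of_le hP hb fun m hm => ?_).trans ?_
  · have h1 := beta_pos hP m c
    have h2 : beta P m c ≤ beta P n c := beta_mono hP c hm.le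
    gcongr
  · rw [mul_add]
    refine add_le_add ?_ ?_
    · have h1 : infoGain P n c ≤ beta P n c ^ 2 / P.R ^ 2 := by
        rw [le_div_iff₀ (pow_pos hP.R_pos 2), mul_comm]
        exact R_sq_mul_infoGain_le hP n c
      gcongr
    · refine (Finset.sum_le_sum fun q _ => min_le_right _ _).trans_eq ?_
      simp only [Finset.sum_const, Finset.card_univ, nsmul_eq_mul]
      rw [mul_comm]

theorem Uninformed.of_le (hP : P.Good) {B e : ℝ} (hB : 0 ≤ B) {m n : ℕ}
    {c : ℕ → Round S A h} (hun : Uninformed E P B e n c) (hmn : m ≤ n)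
    (hβ : beta P n c / 2 ≤ beta P m c) : Uninformed E P (8 * B) (e / 2) m c := by
  have h0 := beta_pos hP n c
  rcases hun with ⟨π, τ, t, hτ, hv⟩ | ⟨v, π, π', hv, hq⟩
  · refine .inl ⟨π, τ, t, hτ, (visitCount_mono c _ hmn).trans (hv.trans ?_)⟩
    calc B * beta P n c ^ 3 ≤ B * (2 * beta P m c) ^ 3 := by
          gcongr
          linarith
      _ = 8 * B * beta P m c ^ 3 := by ring
  · refine .inr ⟨v, π, π', hv, (quad_gram_mono P hmn c _).trans (hq.trans ?_)⟩
    rw [div_pow, div_pow]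
    calc beta P n c ^ 2 / e ^ 2 ≤ (2 * beta P m c) ^ 2 / e ^ 2 := by
          gcongr
          linarith
      _ = beta P m c ^ 2 / (e / 2) ^ 2 := by
          rw [mul_pow, div_pow, div_div_eq_mul_div, mul_comm]

/-- If the number `l` of rounds is at most exponential in `b`, then its logarithm cannot be of the
order of `b ^ 2`. -/
theorem exists_forall_lt_false {R a d g : ℝ} (hR : 0 < R) (ha : 0 ≤ a) (hd : 0 ≤ d) (hg : 0 ≤ g)
    (k C : ℝ) (hk : 0 ≤ k) : ∃ b₀ : ℝ, ∀ b l : ℝ, b₀ < b → 0 ≤ l →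
      (l - 1) * Real.exp (-k * (1 + b)) ≤
        C + 2 * ((k * (1 + b) ^ 3 + 1) * (b ^ 2 / R ^ 2 + d)) →
      b - a ≤ 2 * R * Real.sqrt (d * Real.log (1 + g * l)) → False := by
  obtain ⟨C', hC'⟩ : ∃ C' : ℝ, C' = |C| + 2 * ((k + 1) * (1 / R ^ 2 + d)) := ⟨_, rfl⟩
  have hC'0 : 0 ≤ C' := by rw [hC']; positivity
  obtain ⟨α, hα⟩ : ∃ α : ℝ, α = Real.log (1 + g * (1 + C')) := ⟨_, rfl⟩
  have hg' : 0 ≤ g * (1 + C') := by positivity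
  have hα0 : 0 ≤ α := by
    rw [hα]
    exact Real.log_nonneg (by linarith)
  obtain ⟨W, hW⟩ : ∃ W : ℝ, W = 4 * R ^ 2 * d * (α + (5 + k)) := ⟨_, rfl⟩
  have hW0 : 0 ≤ W := by rw [hW]; positivity
  refine ⟨a + (W + W * (1 + a) + 1), fun b l hb hl h1 h2 => ?_⟩
  have hWa : 0 ≤ W * (1 + a) := by positivity
  have hb0 : 0 ≤ b := by linarith
  have hb1 : 1 ≤ 1 + b := by linarith
  have h3 : C + 2 * ((k * (1 + b) ^ 3 + 1) * (b ^ 2 / R ^ 2 + d)) ≤ C' * (1 + b) ^ 5 := by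
    have e1 : k * (1 + b) ^ 3 + 1 ≤ (k + 1) * (1 + b) ^ 3 := by
      have := one_le_pow₀ hb1 (n := 3)
      linarith
    have e2 : b ^ 2 / R ^ 2 + d ≤ (1 / R ^ 2 + d) * (1 + b) ^ 2 := by
      have e3 : b ^ 2 / R ^ 2 ≤ 1 / R ^ 2 * (1 + b) ^ 2 := by
        rw [one_div_mul_eq_div]
        gcongr
        linarith
      have e4 : d ≤ d * (1 + b) ^ 2 := le_mul_of_one_le_right hd (one_le_pow₀ hb1)
      linarith
    have e5 : C ≤ |C| * (1 + b) ^ 5 :=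
      (le_abs_self C).trans (le_mul_of_one_le_right (abs_nonneg C) (one_le_pow₀ hb1))
    calc C + 2 * ((k * (1 + b) ^ 3 + 1) * (b ^ 2 / R ^ 2 + d))
        ≤ |C| * (1 + b) ^ 5 +
            2 * (((k + 1) * (1 + b) ^ 3) * ((1 / R ^ 2 + d) * (1 + b) ^ 2)) := by gcongr
      _ = C' * (1 + b) ^ 5 := by
        rw [hC']
        ring
  have h4 : (1 + b) ^ 5 ≤ Real.exp (5 * (1 + b)) := by
    have e1 : 1 + b ≤ Real.exp (1 + b) := by linarith [Real.add_one_le_exp (1 + b)]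
    calc (1 + b) ^ 5 ≤ Real.exp (1 + b) ^ 5 := by gcongr
      _ = Real.exp (5 * (1 + b)) := by
        rw [← Real.exp_nat_mul]
        norm_num
  have h5 : l ≤ (1 + C') * Real.exp ((5 + k) * (1 + b)) := by
    have e1 : l - 1 ≤ C' * Real.exp (5 * (1 + b)) * Real.exp (k * (1 + b)) := by
      rw [neg_mul, Real.exp_neg, ← div_eq_mul_inv, div_le_iff₀ (Real.exp_pos _)] at h1
      exact h1.trans (by gcongr; exact h3.trans (by gcongr))
    rw [mul_assoc, ← Real.exp_add, ← add_mul] at e1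
    have e2 : 1 ≤ Real.exp ((5 + k) * (1 + b)) := Real.one_le_exp (by positivity)
    linarith
  have h6 : Real.log (1 + g * l) ≤ α + (5 + k) * (1 + b) := by
    rw [hα, ← Real.log_exp ((5 + k) * (1 + b)),
      ← Real.log_mul (by positivity) (Real.exp_pos _).ne']
    refine Real.log_le_log (by positivity) ?_
    have e2 : 1 ≤ Real.exp ((5 + k) * (1 + b)) := Real.one_le_exp (by positivity)
    have e3 := mul_le_mul_of_nonneg_left h5 hg
    linarith
  have h7 : d * Real.log (1 + g * l) ≤ d * ((α + (5 + k)) * (1 + b)) := by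
    have e1 : α ≤ α * (1 + b) := le_mul_of_one_le_right hα0 hb1
    gcongr
    linarith
  have h8 : (b - a) ^ 2 ≤ W * (1 + b) := by
    have e1 : 0 ≤ d * Real.log (1 + g * l) :=
      mul_nonneg hd (Real.log_nonneg (by linarith [mul_nonneg hg hl]))
    calc (b - a) ^ 2 ≤ (2 * R * Real.sqrt (d * Real.log (1 + g * l))) ^ 2 := by
          gcongr
          linarith
      _ = 4 * R ^ 2 * (d * Real.log (1 + g * l)) := by
          rw [mul_pow, Real.sq_sqrt e1]
          ring
      _ ≤ 4 * R ^ 2 * (d * ((α + (5 + k)) * (1 + b))) := by gcongr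
      _ = W * (1 + b) := by
          rw [hW]
          ring
  obtain ⟨s, hs⟩ : ∃ s, s = b - a := ⟨_, rfl⟩
  have hs1 : W + W * (1 + a) + 1 < s := by linarith
  have hs2 : b = a + s := by linarith
  rw [← hs, hs2] at h8
  nlinarith [mul_le_mul_of_nonneg_left hs1.le (by linarith : 0 ≤ s)]

end Counting

section Pathwise

variable {S A : Type*} {h : ℕ} [Fintype S] [DecidableEq S] [Fintype A] [DecidableEq A]
  {P : Params S A} {E : Env S A h} {tb : TieBreak S A h E.p₀}

theorem condMean_informativeInd_nonneg (k : ℝ) (n : ℕ) (c : ℕ → Round S A h) :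
    0 ≤ condMean E P tb n (informativeInd P k n) c :=
  Finset.sum_nonneg fun d _ =>
    mul_nonneg (roundProb_nonneg n c d) (informativeInd_nonneg _ _ _)

/-- `β` is bounded along the uninformed rounds. -/
theorem exists_beta_le_of_uninformed (hP : P.Good) {c : ℕ → Round S A h} {B e : ℝ} (hB : 0 ≤ B)
    {k : ℕ} (hk : ∀ n, Uninformed E P (8 * B) (e / 2) n c →
      Real.exp (-k * (1 + beta P n c)) ≤ condMean E P tb n (informativeInd P k n) c)
    {C : ℝ} (hC : ∀ n, ∑ m ∈ Finset.range n, condMean E P tb m (informativeInd P k m) c ≤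
      C + 2 * ∑ m ∈ Finset.range n, informativeInd P k m c) :
    ∃ b, ∀ n, Uninformed E P B e n c → beta P n c ≤ b := by
  have hk0 : (0 : ℝ) ≤ k := Nat.cast_nonneg k
  obtain ⟨b₀, hb₀⟩ := exists_forall_lt_false hP.R_pos
    (mul_nonneg zero_le_two (mul_nonneg (Real.sqrt_nonneg P.lam) hP.Sr_nonneg))
    (Nat.cast_nonneg (Fintype.card (S × A))) (sq_nonneg (2 * (h : ℝ))) k C hk0
  refine ⟨max b₀ (2 * beta P 0 c), fun n hun => ?_⟩
  by_contra! hlt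
  rw [max_lt_iff] at hlt
  -- the rounds since `β` has exceeded half of its present value are all uninformed
  have hex : ∃ m, beta P n c / 2 ≤ beta P m c := ⟨n, by linarith [beta_pos hP n c]⟩
  classical
  obtain ⟨m, hm, hmin⟩ : ∃ m, beta P n c / 2 ≤ beta P m c ∧ ∀ i < m, beta P i c < beta P n c / 2 :=
    ⟨Nat.find hex, Nat.find_spec hex, fun i hi => not_le.1 (Nat.find_min hex hi)⟩
  have hm0 : m ≠ 0 := by
    rintro rfl
    linarith [hlt.2]
  obtain ⟨p, rfl⟩ := Nat.exists_eq_succ_of_ne_zero hm0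
  have hpn : p + 1 ≤ n := by
    by_contra! hlt'
    linarith [hmin n hlt', beta_pos hP n c]
  have hpn' : (p : ℝ) + 1 ≤ n := by exact_mod_cast hpn
  refine hb₀ (beta P n c) ((n : ℝ) - p) hlt.1 (by linarith) ?_ ?_
  · calc ((n : ℝ) - p - 1) * Real.exp (-k * (1 + beta P n c))
        = ∑ _m ∈ Finset.Ico (p + 1) n, Real.exp (-k * (1 + beta P n c)) := by
          rw [Finset.sum_const, Nat.card_Ico, nsmul_eq_mul, Nat.cast_sub hpn]
          push_cast
          ring
      _ ≤ ∑ m ∈ Finset.Ico (p + 1) n, condMean E P tb m (informativeInd P k m) c := by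
          refine Finset.sum_le_sum fun i hi => ?_
          rw [Finset.mem_Ico] at hi
          have h1 : beta P i c ≤ beta P n c := beta_mono hP c hi.2.le
          have h2 : beta P (p + 1) c ≤ beta P i c := beta_mono hP c hi.1
          refine le_trans ?_ (hk i (hun.of_le hP hB hi.2.le (hm.trans h2)))
          rw [Real.exp_le_exp]
          nlinarith
      _ ≤ ∑ m ∈ Finset.range n, condMean E P tb m (informativeInd P k m) c := by
          refine Finset.sum_le_sum_of_subset_of_nonneg (fun i hi => ?_)
            fun i _ _ => condMean_informativeInd_nonneg _ _ _
          rw [Finset.mem_Ico] at hi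
          exact Finset.mem_range.2 hi.2
      _ ≤ _ := (hC n).trans (by linarith [sum_informativeInd_le hP hk0 n c])
  · refine (infoGain_sub_ge_of_beta_lt hP (hmin p (Nat.lt_succ_self p))).trans ?_
    have := hP.R_pos
    gcongr
    exact infoGain_sub_le hP.one_le_lam (by omega) c

/-- Only finitely many rounds are uninformed. -/
theorem RegularPath.eventually_not_uninformed (hP : P.Good) (hα : ∀ s a s', 0 < P.α s a s')
    {c : ℕ → Round S A h} (hc : RegularPath E P c)
    (hexp : ∀ k : ℕ, ∃ C, ∀ n, ∑ m ∈ Finset.range n, condMean E P tb m (informativeInd P k m) c ≤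
      C + 2 * ∑ m ∈ Finset.range n, informativeInd P k m c) {e : ℝ} (he : 0 < e) :
    ∃ B₁, ∀ B, B₁ ≤ B → ∀ᶠ n in atTop, ¬ Uninformed E P B e n c := by
  obtain ⟨B₀, hB₀, hB₀'⟩ := hc.exists_exp_le_condMean (tb := tb) hP hα (half_pos he)
  refine ⟨B₀, fun B hB => ?_⟩
  have hB0 : 0 ≤ B := hB₀.le.trans hB
  obtain ⟨k, hk⟩ := hB₀' (8 * B) (by linarith)
  obtain ⟨C, hC⟩ := hexp k
  obtain ⟨b, hb⟩ := exists_beta_le_of_uninformed hP hB0 hk hC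
  have hk0 : (0 : ℝ) ≤ k := Nat.cast_nonneg k
  by_contra hfreq
  rw [not_eventually] at hfreq
  simp only [not_not] at hfreq
  have hβb : ∀ n, beta P n c ≤ b := fun n => by
    obtain ⟨m, hm, hun⟩ := frequently_atTop.1 hfreq n
    exact (beta_mono hP c hm).trans (hb m hun)
  -- every uninformed round contributes at least `exp (-k (1 + b))` to a bounded sum
  have hsum : Summable fun m => condMean E P tb m (informativeInd P k m) c := by
    refine summable_of_sum_range_le (fun m => condMean_informativeInd_nonneg _ _ _)
      (c := C + 2 * ((k * (1 + b) ^ 3 + 1) * (b ^ 2 / P.R ^ 2 + Fintype.card (S × A))))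
      fun n => (hC n).trans ?_
    have h1 := sum_informativeInd_le hP hk0 n c
    have h2 := beta_pos hP n c
    have h3 := hβb n
    have hb0 : 0 ≤ b := h2.le.trans h3
    have h4 : (k * (1 + beta P n c) ^ 3 + 1) *
        (beta P n c ^ 2 / P.R ^ 2 + Fintype.card (S × A)) ≤
        (k * (1 + b) ^ 3 + 1) * (b ^ 2 / P.R ^ 2 + Fintype.card (S × A)) := by
      gcongr
    linarith
  have hlim := hsum.tendsto_atTop_zero.eventually
    (gt_mem_nhds (Real.exp_pos (-k * (1 + b))))
  obtain ⟨n, hun, hn⟩ := (hfreq.and_eventually hlim).exists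
  have h1 := hk n (hun.of_le hP hB0 le_rfl (by linarith [beta_pos hP n c]))
  have h2 : Real.exp (-k * (1 + b)) ≤ Real.exp (-k * (1 + beta P n c)) := by
    rw [Real.exp_le_exp]
    nlinarith [hβb n]
  linarith

theorem optimalProb_le_one (hα : ∀ s a s', 0 < P.α s a s') (n : ℕ) (c : ℕ → Round S A h) :
    optimalProb E P tb n c ≤ 1 := by
  classical
  rw [← sum_selectProb hα tb n c, optimalProb]
  exact Finset.sum_le_sum_of_subset_of_nonneg (Finset.filter_subset _ _)
    fun π _ _ => selectProb_nonneg tb n c π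

theorem optimalProb_nonneg (n : ℕ) (c : ℕ → Round S A h) : 0 ≤ optimalProb E P tb n c :=
  Finset.sum_nonneg fun π _ => selectProb_nonneg tb n c π

theorem RegularPath.tendsto_optimalProb [Nonempty A] (hP : P.Good)
    (hα : ∀ s a s', 0 < P.α s a s') {c : ℕ → Round S A h} (hc : RegularPath E P c)
    (hexp : ∀ k : ℕ, ∃ C, ∀ n, ∑ m ∈ Finset.range n, condMean E P tb m (informativeInd P k m) c ≤
      C + 2 * ∑ m ∈ Finset.range n, informativeInd P k m c) :
    Tendsto (fun n => optimalProb E P tb n c) atTop (𝓝 1) := by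
  refine tendsto_order.2 ⟨fun a ha => ?_, fun a ha =>
    Eventually.of_forall fun n => (optimalProb_le_one hα n c).trans_lt ha⟩
  obtain ⟨e, B₀, he, hB₀, hopt⟩ := hc.exists_le_optimalProb (tb := tb) hP hα
    (by linarith : 0 < (1 - a) / 2)
  obtain ⟨B₁, hB₁⟩ := hc.eventually_not_uninformed hP hα hexp he
  filter_upwards [hB₁ (max B₀ B₁) (le_max_right _ _)] with n hn
  have := hopt _ (le_max_left _ _) n hn
  linarith

end Pathwise

/-! ### Convergence of the process -/

section Run

variable {S A : Type*} {h : ℕ} [Fintype S] [DecidableEq S] [Fintype A] [DecidableEq A]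
  {P : Params S A} {E : Env S A h} {tb : TieBreak S A h E.p₀}
  {Ω : Type*} [MeasurableSpace Ω] {μ : Measure Ω} {X : ℕ → Ω → Round S A h}

/-- Two identical trajectories are compared with positive probability. -/
theorem exists_roundProb_pos (hα : ∀ s a s', 0 < P.α s a s') (E : Env S A h)
    (tb : TieBreak S A h E.p₀) (n : ℕ) (c : ℕ → Round S A h) :
    ∃ d, 0 < roundProb E P tb n c d ∧ d.noise E.r = 1 / 2 := by
  obtain ⟨π, hπ⟩ : ∃ π, 0 < selectProb P tb n c π := by
    by_contra! hle
    have h1 := sum_selectProb hα tb n c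
    have h2 := Finset.sum_nonpos fun π (_ : π ∈ Finset.univ) => hle π
    linarith
  obtain ⟨τ, hτ, -⟩ := E.exists_value_le_utility 0 π
  refine ⟨⟨![π, π], ![τ, τ], true⟩, ?_, ?_⟩
  · rw [roundProb_eq, pairProb, Fin.prod_univ_two, prefProb]
    simp only [Matrix.cons_val_zero, Matrix.cons_val_one, sub_self, add_zero, if_true]
    positivity
  · simp [Round.noise, Round.y, Round.x]

theorem two_lt_exp_add_exp_neg {x : ℝ} (hx : x ≠ 0) : 2 < Real.exp x + Real.exp (-x) := by
  linarith [Real.add_one_lt_exp hx, Real.add_one_lt_exp (neg_ne_zero.2 hx)]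

theorem two_le_exp_add_exp_neg (x : ℝ) : 2 ≤ Real.exp x + Real.exp (-x) := by
  linarith [Real.add_one_le_exp x, Real.add_one_le_exp (-x)]

/-- The label noise does not vanish, so that its sub-Gaussian constant is not zero. -/
theorem IsDPS.R_ne_zero [IsProbabilityMeasure μ] (hX : IsDPS μ E P tb X)
    (hα : ∀ s a s', 0 < P.α s a s')
    (hsub : ∀ t : ℝ, μ[fun ω => Real.exp (t * (X 0 ω).noise E.r) | pastSigma E.r X 0]
        ≤ᵐ[μ] fun _ => Real.exp (t ^ 2 * P.R ^ 2 / 2)) : P.R ≠ 0 := by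
  intro hR
  have hΩ : Nonempty Ω := nonempty_of_isProbabilityMeasure μ
  -- the hypothesis for the first round gives `E (exp η + exp (-η)) ≤ 2`, although `η` takes a
  -- nonzero value with positive probability
  have hbot : pastSigma E.r X 0 = ⊥ := iSup_of_empty _
  have hint : ∀ t : ℝ, Integrable (fun ω => Real.exp (t * (X 0 ω).noise E.r)) μ := fun t =>
    hX.integrable_comp (f := fun c => Real.exp (t * (c 0).noise E.r)) (n := 1)
      fun c c' hc => by simp only [hc 0 (Nat.lt_succ_self 0)]
  have hle : ∀ t : ℝ, ∫ ω, Real.exp (t * (X 0 ω).noise E.r) ∂μ ≤ 1 := by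
    intro t
    have h1 := hsub t
    rw [hbot, condExp_bot, hR] at h1
    obtain ⟨ω, hω⟩ := h1.exists
    simpa using hω
  obtain ⟨d, hd, hnoise⟩ := exists_roundProb_pos hα E tb 0 fun k => X k (Classical.arbitrary Ω)
  have hlaw := hX.law 0 fun _ => d
  have hdep := dependsOn_roundProb (P := P) E tb 0 (x := fun _ => d)
    (y := fun k => X k (Classical.arbitrary Ω)) (fun i hi => absurd hi (Nat.not_lt_zero i))
  rw [hdep] at hlaw
  have hset : {ω | ∀ k < 0 + 1, X k ω = d} = {ω | X 0 ω = d} := by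
    ext ω
    simp
  rw [hset] at hlaw
  have hpos : 0 < μ.real {ω | X 0 ω = d} := by
    rw [hlaw]
    simpa using hd
  set q := Real.exp (1 * (1 / 2)) + Real.exp (-1 * (1 / 2)) - 2 with hq
  have hq0 : 0 < q := by
    have := two_lt_exp_add_exp_neg (by norm_num : (1 / 2 : ℝ) ≠ 0)
    rw [hq, one_mul, neg_one_mul]
    linarith
  have hlow : ∫ ω, {ω | X 0 ω = d}.indicator (fun _ => q) ω ∂μ ≤
      ∫ ω, (Real.exp (1 * (X 0 ω).noise E.r) + Real.exp (-1 * (X 0 ω).noise E.r) - 2) ∂μ := by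
    refine integral_mono ((integrable_const q).indicator (hX.measurableSet_eq 0 d))
      (((hint 1).add (hint (-1))).sub (integrable_const 2)) fun ω => ?_
    by_cases hω : X 0 ω = d
    · simp only [Set.indicator, Set.mem_ofPred_eq, hω, if_true, hnoise]
      exact hq.le
    · simp only [Set.indicator, Set.mem_ofPred_eq, hω, if_false]
      have := two_le_exp_add_exp_neg ((X 0 ω).noise E.r)
      rw [one_mul, neg_one_mul]
      linarith
  have hsplit : ∫ ω, (Real.exp (1 * (X 0 ω).noise E.r) + Real.exp (-1 * (X 0 ω).noise E.r) - 2) ∂μ =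
      ∫ ω, Real.exp (1 * (X 0 ω).noise E.r) ∂μ + ∫ ω, Real.exp (-1 * (X 0 ω).noise E.r) ∂μ -
        ∫ _ω, (2 : ℝ) ∂μ := by
    rw [← integral_add (hint 1) (hint (-1))]
    exact integral_sub ((hint 1).add (hint (-1))) (integrable_const 2)
  rw [integral_indicator (hX.measurableSet_eq 0 d), setIntegral_const, smul_eq_mul, hsplit] at hlow
  have h2 : ∫ _ω, (2 : ℝ) ∂μ = 2 := by simp
  have h3 := hle 1
  have h4 := hle (-1)
  have h5 := mul_pos hpos hq0
  linarith

/-- Either policy of a round has the distribution `selectProb`. -/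
theorem sum_roundProb_mul_pol (hα : ∀ s a s', 0 < P.α s a s') (n : ℕ) (c : ℕ → Round S A h)
    (j : Fin 2) (g : Policy S A h → ℝ) :
    ∑ d, roundProb E P tb n c d * g (d.pol j) = ∑ π, selectProb P tb n c π * g π := by
  have h1 : ∑ d, roundProb E P tb n c d * g (d.pol j) =
      ∑ pol : Fin 2 → Policy S A h, (∏ i, selectProb P tb n c (pol i)) * g (pol j) := by
    rw [sum_round]
    refine Finset.sum_congr rfl fun pol _ => ?_
    rw [← sum_pairProb (E := E), Finset.sum_mul]
    refine Finset.sum_congr rfl fun traj _ => ?_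
    simp only [roundProb_eq]
    rw [← Finset.sum_mul, ← Finset.mul_sum, sum_prefProb, mul_one]
  have hs := sum_selectProb hα tb n c
  rw [h1, ← (finTwoArrowEquiv (Policy S A h)).symm.sum_comp, Fintype.sum_prod_type]
  simp only [Fin.prod_univ_two, finTwoArrowEquiv_symm_apply, Matrix.cons_val_zero,
    Matrix.cons_val_one]
  fin_cases j
  · refine Finset.sum_congr rfl fun π _ => ?_
    simp only [Fin.zero_eta, Matrix.cons_val_zero]
    rw [← Finset.sum_mul, ← Finset.mul_sum, hs, mul_one]
  · rw [Finset.sum_comm]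
    refine Finset.sum_congr rfl fun π _ => ?_
    simp only [Fin.mk_one, Matrix.cons_val_one, Matrix.cons_val_zero]
    rw [← Finset.sum_mul, ← Finset.sum_mul, hs, one_mul]

theorem dependsOn_optimalProb (n : ℕ) :
    DependsOn (optimalProb E P tb n : (ℕ → Round S A h) → ℝ) (Set.Iio n) := by
  intro c c' hc
  unfold optimalProb
  rw [dependsOn_selectProb tb n hc]

theorem IsDPS.measurableSet_isOptimal (hX : IsDPS μ E P tb X) (n : ℕ) (j : Fin 2) :
    MeasurableSet {ω | IsOptimal E.p₀ E.p E.r ((X n ω).pol j)} :=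
  hX.measurable n (DiscreteMeasurableSpace.forall_measurableSet
    {d : Round S A h | IsOptimal E.p₀ E.p E.r (d.pol j)})

/-- The probability of selecting an optimal policy is the mean of its conditional probability. -/
theorem IsDPS.measureReal_isOptimal [IsProbabilityMeasure μ] (hX : IsDPS μ E P tb X)
    (hα : ∀ s a s', 0 < P.α s a s') (n : ℕ) (j : Fin 2) :
    μ.real {ω | IsOptimal E.p₀ E.p E.r ((X n ω).pol j)} =
      ∫ ω, optimalProb E P tb n (fun k => X k ω) ∂μ := by
  classical
  have h1 := hX.integral_succ (n := n)
    (f := fun c => if IsOptimal E.p₀ E.p E.r ((c n).pol j) then (1 : ℝ) else 0)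
    fun c c' hc => by simp only [hc n (Nat.lt_succ_self n)]
  have h2 : ∀ c : ℕ → Round S A h, ∑ d, roundProb E P tb n c d *
      (if IsOptimal E.p₀ E.p E.r (d.pol j) then (1 : ℝ) else 0) = optimalProb E P tb n c := by
    intro c
    rw [sum_roundProb_mul_pol hα n c j fun π => if IsOptimal E.p₀ E.p E.r π then (1 : ℝ) else 0]
    simp only [mul_ite, mul_one, mul_zero]
    rw [← Finset.sum_filter, optimalProb]
  simp only [Function.update_self, h2] at h1
  rw [← h1, ← integral_indicator_one (hX.measurableSet_isOptimal n j)]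
  rfl

theorem IsDPS.ae_tendsto_optimalProb [Nonempty A] [IsProbabilityMeasure μ]
    (hX : IsDPS μ E P tb X) (hP : P.Good) (hα : ∀ s a s', 0 < P.α s a s') :
    ∀ᵐ ω ∂μ, Tendsto (fun n => optimalProb E P tb n fun k => X k ω) atTop (𝓝 1) := by
  have h1 : ∀ᵐ ω ∂μ, ∀ k : ℕ, ∃ C, ∀ n,
      ∑ m ∈ Finset.range n, condMean E P tb m (informativeInd P k m) (fun k => X k ω) ≤
        C + 2 * ∑ m ∈ Finset.range n, informativeInd P k m fun k => X k ω :=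
    ae_all_iff.2 fun k => hX.ae_sum_condMean_le hα (fun n => dependsOn_informativeInd _ n)
      fun n c => informativeInd_mem _ n c
  filter_upwards [h1, hX.ae_reward_error hP hα, hX.ae_transDev_le hα] with ω hω1 hω2 hω3
  exact RegularPath.tendsto_optimalProb hP hα ⟨hω2, hω3⟩ hω1

theorem IsDPS.tendsto_measureReal_isOptimal [Nonempty A] [IsProbabilityMeasure μ]
    (hX : IsDPS μ E P tb X) (hP : P.Good) (hα : ∀ s a s', 0 < P.α s a s') (j : Fin 2) :
    Tendsto (fun n => μ.real {ω | IsOptimal E.p₀ E.p E.r ((X n ω).pol j)}) atTop (𝓝 1) := by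
  have hΩ : Nonempty Ω := nonempty_of_isProbabilityMeasure μ
  simp only [hX.measureReal_isOptimal hα]
  have h1 := tendsto_integral_of_dominated_convergence (μ := μ) (f := fun _ => (1 : ℝ))
    (F := fun n ω => optimalProb E P tb n fun k => X k ω) (fun _ => 1)
    (fun n => (hX.measurable_comp (dependsOn_optimalProb n)).aestronglyMeasurable)
    (integrable_const 1) (fun n => Eventually.of_forall fun ω => by
      rw [Real.norm_of_nonneg (optimalProb_nonneg n _)]
      exact optimalProb_le_one hα n _) (hX.ae_tendsto_optimalProb hP hα)
  simpa using h1

end Run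

end DPS

theorem theorem1 {S A : Type*} [Fintype S] [DecidableEq S] [Fintype A] [DecidableEq A]
    [Nonempty A] {h : ℕ}
    (E : DPS.Env S A h) (P : DPS.Params S A) (tb : DPS.TieBreak S A h E.p₀)
    (hlam : 1 ≤ P.lam) (hδ : P.δ ∈ Set.Ioo (0 : ℝ) 1) (hα : ∀ s a s', 0 < P.α s a s')
    (hSr : ‖E.r‖ ≤ P.Sr)
    {Ω : Type*} [MeasurableSpace Ω] (μ : Measure Ω) [IsProbabilityMeasure μ]
    (X : ℕ → Ω → DPS.Round S A h) (hX : DPS.IsDPS μ E P tb X)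
    (hR : 0 ≤ P.R)
    (hsub : ∀ (n : ℕ) (t : ℝ),
      μ[fun ω => Real.exp (t * (X n ω).noise E.r) | DPS.pastSigma E.r X n]
        ≤ᵐ[μ] fun _ => Real.exp (t ^ 2 * P.R ^ 2 / 2)) :
    ∃ G : Set Ω, MeasurableSet G ∧ 1 - P.δ ≤ μ.real G ∧
      (∀ ω ∈ G, Tendsto (fun n => DPS.optimalProb E P tb n fun k => X k ω) atTop (𝓝 1)) ∧
      ∀ j : Fin 2, Tendsto
        (fun n => (μ[|G]).real {ω | DPS.IsOptimal E.p₀ E.p E.r ((X n ω).pol j)}) atTop (𝓝 1) := by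
  have hP : P.Good :=
    { one_le_lam := hlam
      R_pos := lt_of_le_of_ne hR (hX.R_ne_zero hα (hsub 0)).symm
      Sr_nonneg := (norm_nonneg _).trans hSr
      δ_pos := hδ.1
      δ_lt_one := hδ.2 }
  obtain ⟨N, hsubset, hN, hμN⟩ := exists_measurable_superset_of_null
    (ae_iff.1 (hX.ae_tendsto_optimalProb hP hα))
  have hG : ∀ᵐ ω ∂μ, ω ∈ Nᶜ := by simpa [ae_iff] using hμN
  have hG1 : μ Nᶜ = 1 := prob_compl_eq_one_iff hN |>.2 hμN
  have hcond : μ[|Nᶜ] = μ := by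
    rw [ProbabilityTheory.cond, hG1, Measure.restrict_eq_self_of_ae_mem hG, inv_one, one_smul]
  refine ⟨Nᶜ, hN.compl, ?_, fun ω hω => ?_, fun j => ?_⟩
  · rw [measureReal_def, hG1, ENNReal.toReal_one]
    linarith [hδ.1]
  · by_contra hno
    exact hω (hsubset hno)
  · rw [hcond]
    exact hX.tendsto_measureReal_isOptimal hP hα j
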